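/- Let $M=\mathbb R^3$ with coordinates $(x,y,z)$, let $F(M)$ be the algebra of smooth real functions on $M$, $\{1\}\subset F(M)$ the constants, and $p=\partial_x$, $q=\partial_y$, $r=\partial_z$. For a Lie algebra $\mathfrak h$ of vector fields on $M$, $H^1(\mathfrak h,F(M)/\{1\})$ is the space of $1$-cocycles, i.e. linear maps $\eta:\mathfrak h\to F(M)/\{1\}$, $v\mapsto\eta_v$, with $\eta_{[v,w]}=v(\eta_w)-w(\eta_v)$, modulo the coboundaries $v\mapsto v(f)$, $f\in F(M)$. Put $\mathfrak s=\{xq,\ xp-yq,\ yp\}$ and $\mathfrak a=\{p,q,xp,yq,xq,yp,\ x^2p+xyq,\ xyp+y^2q\}$. In each case below the linear span $\mathfrak h$ of the listed vector fields is a Lie algebra, and a set of representatives of $H^1(\mathfrak h,F(M)/\{1\})$ is obtained from the displayed operators $v+\eta_v$, with $\eta_v=0$ for the other generators. The representatives depend linearly on the displayed parameters ($K\in C^\infty(\mathbb R)$, $c,d\in\mathbb R$), each class is represented, and different parameters give different classes, except that in case 3 the function $K$ is determined by the class up to an additive constant. An entry $0$ means $H^1(\mathfrak h,F(M)/\{1\})=0$.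 1. $\mathfrak a$: $xp+K(z)$, $yq+K(z)$, $x^2p+xyq+3xK(z)$, $xyp+y^2q+3yK(z)$. 2. $\mathfrak s\cup\{Z^i(z)p,\ Z^i(z)q : 1\le i\le l\}$, where $Z^1,\dots,Z^l\in C^\infty(\mathbb R)$ are linearly independent and have no common zero: $0$ if $l\ge2$; if $l=1$ and $Z=Z^1$: $Zp-\frac{cy}{Z}$, $Zq+\frac{cx}{Z}$. 3. $\mathfrak s\cup\{xp+yq\}\cup\{Z^i(z)p,\ Z^i(z)q : 1\le i\le l\}$, with $l\ge 1$ and $Z^i$ as in case 2: $xp+yq+K(z)$. 4. $\mathfrak a\cup\{r\}$: $x^2p+xyq+cx$, $xyp+y^2q+cy$. 5. $\mathfrak s\cup\{z^ke^{\lambda_jz}p,\ z^ke^{\lambda_jz}q : 0\le j\le b,\ 0\le k\le n_j\}\cup\{r\}$, where $\lambda_0,\dots,\lambda_b$ are distinct real numbers, $b,n_j\ge0$ are integers, and the only function $z^ke^{\lambda_jz}$ is not the constant $1$ (that is, not $b=n_0=\lambda_0=0$): $0$. 6. $\mathfrak s\cup\{xp+yq\}\cup\{z^ke^{\lambda_jz}p,\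 z^ke^{\lambda_jz}q : 0\le j\le b,\ 0\le k\le n_j\}\cup\{r\}$, with $\lambda_j$ distinct real, $b,n_j\ge 0$: $xp+yq+cz$. 7. $\mathfrak a\cup\{r,zr\}$: $x^2p+xyq+cx$, $xyp+y^2q+cy$. In cases 8, 9, 11 and 12 let $l\ge1$ be an integer and $\mathfrak t_l=\{z^kp,\ z^kq : 0\le k\le l\}$. 8. $\mathfrak s\cup\mathfrak t_l\cup\{r,\ zr+a(xp+yq)\}$, $a\in\mathbb R$: $0$. 9. $\mathfrak s\cup\{xp+yq\}\cup\mathfrak t_l\cup\{r,zr\}$: $0$. 10. $\mathfrak a\cup\{r,zr,z^2r\}$: $x^2p+xyq+cx$, $xyp+y^2q+cy$, $z^2r+dz$. 11. $\mathfrak s\cup\mathfrak t_l\cup\{r,\ zr+\frac l2(xp+yq),\ z^2r+lz(xp+yq)\}$: $z^2r+lz(xp+yq)+cz$. 12. $\mathfrak s\cup\{xp+yq\}\cup\mathfrak t_l\cup\{r,\ zr,\ z^2r+lz(xp+yq)\}$: $z^2r+lz(xp+yq)+cz$. Moreover, in each case and for every value of the parameters, the span $\mathfrak g$ of the operators $v+\eta_v$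 ($v$ a generator of $\mathfrak h$) and $1$ is a Lie algebra of first-order differential operators $v+\eta$ on $F(M)$ whose vector field parts form $\mathfrak h$ and whose multiplication operators are exactly the constants. Every Lie algebra of first-order differential operators with these two properties is carried to one of these by a gauge transformation $T\mapsto e^{f}Te^{-f}$, $f\in F(M)$, and two of these are related by a gauge transformation only if their parameters agree (in case 3: only if the functions $K$ differ by a constant; in that case they are related). -/

import Mathlib

open scoped ContDiff

namespace TypeI

noncomputable section

/-- The algebra of smooth real-valued functions on a real normed space. -/
def smooth (E : Type) [NormedAddCommGroup E] [NormedSpace ℝ E] : Subalgebra ℝ (E → ℝ) where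
  carrier := {f | ContDiff ℝ ∞ f}
  mul_mem' {f g} hf hg := by
    change ContDiff ℝ ∞ f at hf
    change ContDiff ℝ ∞ g at hg
    exact hf.mul hg
  add_mem' {f g} hf hg := by
    change ContDiff ℝ ∞ f at hf
    change ContDiff ℝ ∞ g at hg
    exact hf.add hg
  algebraMap_mem' c := by
    change ContDiff ℝ ∞ (fun _ : E => c)
    exact contDiff_const

theorem mem_smooth {E : Type} [NormedAddCommGroup E] [NormedSpace ℝ E] {f : E → ℝ} :
    f ∈ smooth E ↔ ContDiff ℝ ∞ f := Iff.rfl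

theorem smooth_contDiff {E : Type} [NormedAddCommGroup E] [NormedSpace ℝ E] (f : smooth E) :
    ContDiff ℝ ∞ f.1 := mem_smooth.1 f.2

theorem smooth_differentiableAt {E : Type} [NormedAddCommGroup E] [NormedSpace ℝ E]
    (f : smooth E) (m : E) : DifferentiableAt ℝ f.1 m :=
  ((smooth_contDiff f).differentiable (by simp)) m

/-- The manifold `ℝ³`, with coordinates `(x, y, z)`. -/
abbrev M : Type := ℝ × ℝ × ℝ

/-- The algebra `F(M)` of smooth real-valued functions on `ℝ³`. -/
abbrev F : Type := smooth M

/-- The Lie algebra of vector fields on `ℝ³`, as derivations of `F(M)`. Its bracket is the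
commutator, and `⁅v, f⁆ = v(f)` makes `F(M)` a module over it. -/
abbrev VF : Type := Derivation ℝ F F

/-- The constant vector field `e`, differentiating in the direction `e`. -/
def dirDeriv (e : M) : VF :=
  Derivation.mk'
    { toFun := fun f => ⟨fun m => fderiv ℝ f.1 m e,
        mem_smooth.2 (((smooth_contDiff f).fderiv_right (m := ∞) (by simp)).clm_apply
          contDiff_const)⟩
      map_add' := fun f g => by
        apply Subtype.ext
        funext m
        change fderiv ℝ (f.1 + g.1) m e = fderiv ℝ f.1 m e + fderiv ℝ g.1 m e
        rw [fderiv_add (smooth_differentiableAt f m) (smooth_differentiableAt g m)]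
        rfl
      map_smul' := fun c f => by
        apply Subtype.ext
        funext m
        change fderiv ℝ (c • f.1) m e = c • fderiv ℝ f.1 m e
        rw [fderiv_const_smul (smooth_differentiableAt f m)]
        rfl }
    (fun f g => by
      apply Subtype.ext
      funext m
      change fderiv ℝ (f.1 * g.1) m e = f.1 m * fderiv ℝ g.1 m e + g.1 m * fderiv ℝ f.1 m e
      rw [fderiv_mul (smooth_differentiableAt f m) (smooth_differentiableAt g m)]
      rfl)

/-- `p = ∂/∂x`. -/
def p : VF := dirDeriv (1, 0, 0)

/-- `q = ∂/∂y`. -/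
def q : VF := dirDeriv (0, 1, 0)

/-- `r = ∂/∂z`. -/
def r : VF := dirDeriv (0, 0, 1)

/-- The coordinate function `x`. -/
def x : F := ⟨fun m => m.1, mem_smooth.2 contDiff_fst⟩

/-- The coordinate function `y`. -/
def y : F := ⟨fun m => m.2.1, mem_smooth.2 (contDiff_fst.comp contDiff_snd)⟩

/-- The coordinate function `z`. -/
def z : F := ⟨fun m => m.2.2, mem_smooth.2 (contDiff_snd.comp contDiff_snd)⟩

/-- A function of one variable, regarded as the function `K(z)` on `ℝ³`. -/
def ofZ (K : smooth ℝ) : F :=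
  ⟨fun m => K.1 m.2.2, mem_smooth.2 ((smooth_contDiff K).comp (contDiff_snd.comp contDiff_snd))⟩

/-- The function `t ↦ t ^ k * exp (c * t)` of one variable. -/
def powExp (k : ℕ) (c : ℝ) : smooth ℝ :=
  ⟨fun t => t ^ k * Real.exp (c * t),
    mem_smooth.2 ((contDiff_id.pow k).mul
      (Real.contDiff_exp.comp (contDiff_const.mul contDiff_id)))⟩

/-- The `VF`-submodule `{1}` of constant functions in `F(M)`. -/
def constants : LieSubmodule ℝ VF F where
  toSubmodule := Submodule.span ℝ {1}
  lie_mem := by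
    intro v f hf
    obtain ⟨c, rfl⟩ := Submodule.mem_span_singleton.1 hf
    have h : ⁅v, c • (1 : F)⁆ = 0 := by
      rw [Derivation.bracket_eq_fun, Derivation.map_smul, Derivation.map_one_eq_zero, smul_zero]
    rw [h]
    exact Submodule.zero_mem _

/-- The module `F(M)/{1}`. -/
abbrev FmodConst : Type := F ⧸ constants

/-- The class of a function in `F(M)/{1}`. -/
def modConst (f : F) : FmodConst := LieSubmodule.Quotient.mk f

/-- The Lie algebra of vector fields generated by the family `v`. -/
def lieAlg {ι : Type} (v : ι → VF) : LieSubalgebra ℝ VF :=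
  LieSubalgebra.lieSpan ℝ VF (Set.range v)

/-- A member of the family `v`, as an element of the Lie algebra that `v` generates. -/
def gen {ι : Type} (v : ι → VF) (i : ι) : lieAlg v :=
  ⟨v i, LieSubalgebra.subset_lieSpan (Set.mem_range_self i)⟩

/-- The `F(M)/{1}`-valued `1`-cocycles on `𝔥`: linear maps `φ` with
`φ [v, w] = v (φ w) - w (φ v)`. -/
abbrev Cocycle (𝔥 : LieSubalgebra ℝ VF) : Type := LieDerivation ℝ 𝔥 FmodConst

/-- `H¹(𝔥, F(M)/{1})`: the cocycles modulo the coboundaries `v ↦ v(f)`. -/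
abbrev H1 (𝔥 : LieSubalgebra ℝ VF) : Type :=
  Cocycle 𝔥 ⧸ LinearMap.range (LieDerivation.inner ℝ 𝔥 FmodConst)

/-- The first-order differential operator `v + η` on `F(M)`. -/
def op (v : VF) (η : F) : Module.End ℝ F := (v : F →ₗ[ℝ] F) + LinearMap.mulLeft ℝ η

/-- `𝔤` is a Lie algebra of first-order differential operators (under the commutator) whose vector
field parts make up `𝔥` and whose multiplication operators are the constants. -/
def IsDiffOpAlgebra (𝔥 : LieSubalgebra ℝ VF) (𝔤 : Submodule ℝ (Module.End ℝ F)) : Prop :=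
  (∀ S ∈ 𝔤, ∀ T ∈ 𝔤, S * T - T * S ∈ 𝔤) ∧
  (∀ T ∈ 𝔤, ∃ v ∈ 𝔥, ∃ η : F, T = op v η) ∧
  (∀ v ∈ 𝔥, ∃ η : F, op v η ∈ 𝔤) ∧
  (∀ ζ : F, op 0 ζ ∈ 𝔤 ↔ ζ ∈ constants)

/-- The function `exp f`. -/
def expF (f : F) : F := ⟨fun m => Real.exp (f.1 m), mem_smooth.2 (smooth_contDiff f).exp⟩

/-- The gauge transformation `T ↦ e^f T e^{-f}`. -/
def gaugeConj (f : F) : Module.End ℝ F →ₗ[ℝ] Module.End ℝ F :=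
  LinearMap.mulLeftRight ℝ (LinearMap.mulLeft ℝ (expF f), LinearMap.mulLeft ℝ (expF (-f)))

/-- The linear span of the operators `v i + η i` and `1`. -/
def opSpan {ι : Type} (v : ι → VF) (η : ι → F) : Submodule ℝ (Module.End ℝ F) :=
  Submodule.span ℝ (Set.range (fun i => op (v i) (η i)) ∪ {1})

/-- The family `v` spans a Lie algebra `𝔥` of vector fields; `H¹(𝔥, F(M)/{1})` is `P/P₀`, the class
of `c : P` being that of the cocycle with values `η c i` on the generators `v i`; and the Lie
algebras of first-order differential operators over `𝔥` with multiplication operators `{1}` are, up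
to gauge transformations, the spans of the `v i + η c i` and `1`. -/
structure Classifies {ι P : Type} [AddCommGroup P] [Module ℝ P]
    (v : ι → VF) (η : P → ι → F) (P₀ : Submodule ℝ P) : Prop where
  isLieAlgebra : (lieAlg v).toSubmodule = Submodule.span ℝ (Set.range v)
  cohomology : ∃ Φ : P →ₗ[ℝ] Cocycle (lieAlg v),
    (∀ c i, Φ c (gen v i) = modConst (η c i)) ∧
    (∀ κ : H1 (lieAlg v), ∃ c, Submodule.Quotient.mk (Φ c) = κ) ∧
    (∀ c, (Submodule.Quotient.mk (Φ c) : H1 (lieAlg v)) = 0 ↔ c ∈ P₀)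
  isDiffOpAlgebra : ∀ c, IsDiffOpAlgebra (lieAlg v) (opSpan v (η c))
  gauge_exists : ∀ 𝔤 : Submodule ℝ (Module.End ℝ F), IsDiffOpAlgebra (lieAlg v) 𝔤 →
    ∃ (c : P) (f : F), 𝔤.map (gaugeConj f) = opSpan v (η c)
  gauge_iff : ∀ c c' : P,
    (∃ f : F, (opSpan v (η c)).map (gaugeConj f) = opSpan v (η c')) ↔ c - c' ∈ P₀

/-- `𝔥` has `H¹(𝔥, F(M)/{1}) = 0` (the only representative is the zero cocycle). -/
abbrev ClassifiesZero {ι : Type} (v : ι → VF) : Prop :=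
  Classifies v (fun (_ : Unit) _ => 0) ⊥

/-- `x p + y q`. -/
def E : VF := x • p + y • q

/-- `p, q, xp, yq, xq, yp, x²p + xyq, xyp + y²q`. -/
def projGens : Fin 8 → VF :=
  ![p, q, x • p, y • q, x • q, y • p,
    x ^ 2 • p + (x * y) • q, (x * y) • p + y ^ 2 • q]

/-- `xq, xp - yq, yp`. -/
def slGens : Fin 3 → VF := ![x • q, x • p - y • q, y • p]

/-- `Z k p` and `Z k q`, for a family `Z` of functions of `z`. -/
def planeGens {κ : Type} (Z : κ → smooth ℝ) : κ ⊕ κ → VF :=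
  Sum.elim (fun k => ofZ (Z k) • p) (fun k => ofZ (Z k) • q)

/-- `1, z, …, z ^ l`. -/
def powers (l : ℕ) : Fin (l + 1) → smooth ℝ := fun k => powExp k 0

/-- `z ^ k * exp (μ j * z)` for `j = 0, …, b` and `k = 0, …, n j`. -/
def powExps {b : ℕ} (n : Fin (b + 1) → ℕ) (μ : Fin (b + 1) → ℝ) :
    (Σ j : Fin (b + 1), Fin (n j + 1)) → smooth ℝ :=
  fun jk => powExp jk.2 (μ jk.1)

/-- Values of the cocycle `x²p + xyq + cx`, `xyp + y²q + cy` on `projGens`. -/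
def projVals (c : ℝ) : Fin 8 → F := ![0, 0, 0, 0, 0, 0, c • x, c • y]

end

end TypeI

open scoped ContDiff

set_option linter.unusedSimpArgs false

namespace TypeI

noncomputable section

-- Let `𝔤` be a Lie algebra of operators over `𝔥` whose multiplication operators are the constants.
-- It attaches to each `v` in `𝔥` a function `η` that is unique up to a constant, and closure under
-- commutators is the cocycle identity in `F(M)/{1}`. Conjugation by `e^f` subtracts the coboundary
-- of `f`. Computing `H¹` and classifying the operator algebras is therefore one problem.
-- `classifies_of` reduces it to generators: a bracket table, a linear map on vector fields inducing
-- the representatives, a normal form for cocycles, and a test for coboundaries.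
--
-- The normal form comes from weights. The field `H = xp - yq` acts on `xq`, `yp`, `Zp`, `Zq` with
-- nonzero weights, which singles out one representative of each value (`exists_weightRel`,
-- `WeightRel.unique`). Relations of nonzero weight then hold exactly and not only modulo constants;
-- the bracket `[Z_i p, Z_j q] = 0`, of weight zero, keeps a free constant. Solving these relations
-- (`exists_potential_of_relations`, `exists_plane_normal_form`) makes the cocycle zero on `𝔰`, with
-- values `-yβ_k` and `xβ_k` at `Z_k p` and `Z_k q`, where all `Z_i β_j + Z_j β_i` are constant. The
-- `β_k` vanish if there are at least two `Z_k` and they are pairwise independent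
-- (`eq_zero_of_pairwise_independent`), if `xp + yq` is present, or if `r` scales a single `Z` by a
-- nonzero factor. For a single plane with nothing further, `β` is a multiple of `1/Z`.
--
-- The remaining fields `ρ(z) r + τ(z)(xp + yq)` commute with `𝔰`, so their values depend on `z`
-- alone (`exists_rel_fib`). What is left is calculus in one variable: a primitive removes the value
-- at `r`, and the brackets with `r` and `zr` leave at most a multiple of `z` elsewhere. For the
-- projective algebra, the brackets with `x²p + xyq` leave one function `K(z)`
-- (`exists_rel_projValues`), which the presence of `r` makes constant.
--
-- Conversely, the divergence in the `(x, y)`-planes and the divergence along the `z`-axis are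
-- cocycles on fields that project to the axis. Apart from the single plane, every representative
-- is, modulo constants, `K(z)` times the first plus a constant times the second. The single plane
-- uses the form `W²(x dy - y dx)` with `W = 1/Z`. Different parameters are separated by the remark
-- that a function with constant images under `xq` and `yp` depends on `z` alone, so only such
-- functions can produce competing coboundaries.

local instance : CommRing F := inferInstance
local instance : CommRing (smooth ℝ) := inferInstance
local instance : Module ℝ F := inferInstance

instance : CharZero F :=
  charZero_of_injective_algebraMap (R := ℝ) fun _ _ h =>
    congr_fun (congr_arg Subtype.val h) (0 : M)

instance : CharZero (smooth ℝ) :=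
  charZero_of_injective_algebraMap (R := ℝ) fun _ _ h =>
    congr_fun (congr_arg Subtype.val h) (0 : ℝ)

/-! ### Primitives of smooth functions -/

/-- Induction by differentiating under the integral sign. The target `G` stays universally
quantified because the derivative takes values in `E →L[ℝ] G`. -/
theorem contDiff_integral_unitInterval {E : Type} [NormedAddCommGroup E] [NormedSpace ℝ E]
    [FiniteDimensional ℝ E] (n : ℕ) : ∀ {G : Type} [NormedAddCommGroup G] [NormedSpace ℝ G]
    [CompleteSpace G] (φ : E × ℝ → G), ContDiff ℝ n φ →
    ContDiff ℝ n (fun e => ∫ t in (0 : ℝ)..1, φ (e, t)) := by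
  induction n with
  | zero =>
    intro G _ _ _ φ hφ
    exact contDiff_zero.2
      (intervalIntegral.continuous_parametric_intervalIntegral_of_continuous'
        (f := fun e t => φ (e, t)) (by simpa [Function.uncurry_def] using hφ.continuous) _ _)
  | succ n ih =>
    intro G _ _ _ φ hφ
    have hd : Differentiable ℝ φ := hφ.differentiable (by simp)
    set ψ : E × ℝ → E →L[ℝ] G := fun a => (fderiv ℝ φ a).comp (ContinuousLinearMap.inl ℝ E ℝ)
      with hψdef
    have hψ : ContDiff ℝ n ψ :=
      (hφ.fderiv_right (m := n) (by norm_cast)).clm_comp contDiff_const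
    have hder : ∀ e t, HasFDerivAt (fun e' => φ (e', t)) (ψ (e, t)) e := by
      intro e t
      exact (hd (e, t)).hasFDerivAt.comp e (hasFDerivAt_prodMk_left e t)
    have key : ∀ e, HasFDerivAt (fun e => ∫ t in (0 : ℝ)..1, φ (e, t))
        (∫ t in (0 : ℝ)..1, ψ (e, t)) e := by
      intro e
      have : ProperSpace E := FiniteDimensional.proper_real E
      -- Compactness of the unit ball times `[0, 1]` gives a uniform bound for the derivative, which
      -- serves as the dominating constant.
      obtain ⟨C, hC⟩ := ((isCompact_closedBall e (1 : ℝ)).prod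
        (isCompact_Icc (a := (0 : ℝ)) (b := 1))).exists_bound_of_continuousOn
          hψ.continuous.continuousOn
      refine (intervalIntegral.hasFDerivAt_integral_of_dominated_of_fderiv_le
        (F := fun e t => φ (e, t)) (F' := fun e t => ψ (e, t)) (bound := fun _ => C)
        (Metric.ball_mem_nhds e one_pos) ?_ ?_ ?_ ?_ ?_ ?_)
      · exact Filter.Eventually.of_forall fun e' =>
          (hφ.continuous.comp (by fun_prop : Continuous fun t : ℝ => (e', t))).aestronglyMeasurable
      · exact (hφ.continuous.comp
          (by fun_prop : Continuous fun t : ℝ => (e, t))).intervalIntegrable _ _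
      · exact (hψ.continuous.comp
          (by fun_prop : Continuous fun t : ℝ => (e, t))).aestronglyMeasurable
      · refine Filter.Eventually.of_forall fun t ht e' he' => hC (e', t) ⟨?_, ?_⟩
        · exact Metric.ball_subset_closedBall he'
        · rw [Set.uIoc_of_le zero_le_one] at ht
          exact ⟨ht.1.le, ht.2⟩
      · exact intervalIntegrable_const
      · exact Filter.Eventually.of_forall fun t _ e' _ => hder e' t
    have hfd : fderiv ℝ (fun e => ∫ t in (0 : ℝ)..1, φ (e, t)) =
        fun e => ∫ t in (0 : ℝ)..1, ψ (e, t) := funext fun e => (key e).fderiv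
    rw [Nat.cast_add, Nat.cast_one, contDiff_succ_iff_fderiv]
    refine ⟨fun e => (key e).differentiableAt, by simp, ?_⟩
    rw [hfd]
    exact ih ψ hψ

theorem dirDeriv_apply (e : M) (f : F) (m : M) : (dirDeriv e f).1 m = fderiv ℝ f.1 m e := rfl

theorem hasDerivAt_line (f : F) (m e : M) (s : ℝ) :
    HasDerivAt (fun s : ℝ => f.1 (m + s • e)) ((dirDeriv e f).1 (m + s • e)) s := by
  have h := (smooth_differentiableAt f (m + s • e)).hasFDerivAt
  have h2 : HasDerivAt (fun s : ℝ => m + s • e) e s := by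
    simpa using ((hasDerivAt_id s).smul_const e).const_add m
  exact h.comp_hasDerivAt s h2

theorem dirDeriv_eq_of_hasDerivAt {f : F} {m e : M} {c : ℝ}
    (h : HasDerivAt (fun s : ℝ => f.1 (m + s • e)) c 0) : (dirDeriv e f).1 m = c := by
  have h1 := hasDerivAt_line f m e 0
  simpa using h1.unique h

theorem eq_on_line_of_dirDeriv_eq_zero {f : F} {e : M} (h : dirDeriv e f = 0) (m : M) (s : ℝ) :
    f.1 (m + s • e) = f.1 m := by
  have hd : ∀ s, HasDerivAt (fun s : ℝ => f.1 (m + s • e)) 0 s := by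
    intro s
    have := hasDerivAt_line f m e s
    rw [h] at this
    exact this
  have := is_const_of_deriv_eq_zero (fun s => (hd s).differentiableAt) (fun s => (hd s).deriv) s 0
  simpa using this

/-- Integrate `A` along `e` from the hyperplane `ℓ = 0`. Rescaling to the fixed interval `[0, 1]`
makes smoothness a matter of a parameter integral. The last clause keeps invariance under directions
inside the hyperplane, so that several primitives can be taken in turn. -/
theorem exists_primitive (e : M) (ℓ : M →L[ℝ] ℝ) (hℓ : ℓ e = 1) (A : F) :
    ∃ G : F, dirDeriv e G = A ∧ ∀ e', ℓ e' = 0 → dirDeriv e' A = 0 → dirDeriv e' G = 0 := by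
  have hA := smooth_contDiff A
  have hsm : ContDiff ℝ ∞ fun m : M => ∫ t in (0 : ℝ)..1, A.1 (m - ((1 - t) * ℓ m) • e) * ℓ m := by
    refine contDiff_infty.2 fun n => ?_
    refine contDiff_integral_unitInterval n
      (fun a : M × ℝ => A.1 (a.1 - ((1 - a.2) * ℓ a.1) • e) * ℓ a.1) ?_
    refine ContDiff.of_le (n := ∞) ?_ (by exact_mod_cast le_top)
    fun_prop
  refine ⟨⟨_, mem_smooth.2 hsm⟩, ?_, ?_⟩
  · apply Subtype.ext
    funext m
    refine dirDeriv_eq_of_hasDerivAt ?_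
    -- Substituting `u = t (ℓ m + s)` fixes the integrand and moves `s` into the upper limit, where
    -- the fundamental theorem of calculus applies.
    have hrew : ∀ s : ℝ, (∫ t in (0 : ℝ)..1,
        A.1 ((m + s • e) - ((1 - t) * ℓ (m + s • e)) • e) * ℓ (m + s • e)) =
        ∫ u in (0 : ℝ)..(ℓ m + s), A.1 ((m - ℓ m • e) + u • e) := by
      intro s
      have h1 : ∀ t : ℝ, (m + s • e) - ((1 - t) * ℓ (m + s • e)) • e =
          (m - ℓ m • e) + (t * (ℓ m + s)) • e := by
        intro t
        simp only [map_add, map_smul, hℓ, smul_eq_mul, mul_one]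
        module
      simp only [h1]
      rw [intervalIntegral.integral_mul_const, mul_comm]
      simp only [map_add, map_smul, hℓ, smul_eq_mul, mul_one]
      rw [intervalIntegral.mul_integral_comp_mul_right
        (f := fun u => A.1 ((m - ℓ m • e) + u • e))]
      simp
    simp only [hrew]
    have hc : Continuous fun u : ℝ => A.1 ((m - ℓ m • e) + u • e) := by
      have := hA.continuous
      fun_prop
    have hF := intervalIntegral.integral_hasDerivAt_right
      (hc.intervalIntegrable (μ := MeasureTheory.volume) 0 (ℓ m + 0))
      (hc.stronglyMeasurableAtFilter _ _) hc.continuousAt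
    have hF2 := HasDerivAt.comp_const_add (ℓ m) 0 hF
    simpa using hF2
  · intro e' he' hAe'
    apply Subtype.ext
    funext m
    refine dirDeriv_eq_of_hasDerivAt ?_
    have hc : ∀ s : ℝ, (∫ t in (0 : ℝ)..1,
        A.1 ((m + s • e') - ((1 - t) * ℓ (m + s • e')) • e) * ℓ (m + s • e')) =
        ∫ t in (0 : ℝ)..1, A.1 (m - ((1 - t) * ℓ m) • e) * ℓ m := by
      intro s
      congr 1
      funext t
      simp only [map_add, map_smul, he', smul_eq_mul, mul_zero, add_zero]
      rw [show m + s • e' - ((1 - t) * ℓ m) • e = (m - ((1 - t) * ℓ m) • e) + s • e' by module,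
        eq_on_line_of_dirDeriv_eq_zero hAe']
    simp only [hc]
    exact hasDerivAt_const _ _

/-! ### Coordinates -/

theorem dirDeriv_comm (e e' : M) (f : F) :
    dirDeriv e (dirDeriv e' f) = dirDeriv e' (dirDeriv e f) := by
  apply Subtype.ext
  funext m
  have hf : ContDiff ℝ ∞ f.1 := smooth_contDiff f
  have hd : DifferentiableAt ℝ (fderiv ℝ f.1) m :=
    ((hf.fderiv_right (m := ∞) (by simp)).differentiable (by simp)) m
  have key : ∀ a b : M, fderiv ℝ (fun m => fderiv ℝ f.1 m b) m a =
      fderiv ℝ (fderiv ℝ f.1) m a b := by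
    intro a b
    rw [fderiv_clm_apply hd (by fun_prop)]
    simp
  have hsymm : IsSymmSndFDerivAt ℝ f.1 m :=
    (hf.contDiffAt).isSymmSndFDerivAt (by
      rw [minSmoothness_of_isRCLikeNormedField]
      exact WithTop.coe_le_coe.2 (le_top : (2 : ℕ∞) ≤ ⊤))
  change fderiv ℝ (fun m => fderiv ℝ f.1 m e') m e = fderiv ℝ (fun m => fderiv ℝ f.1 m e) m e'
  rw [key, key]
  exact hsymm e e'

theorem p_q_comm (f : F) : p (q f) = q (p f) := dirDeriv_comm _ _ f
theorem p_r_comm (f : F) : p (r f) = r (p f) := dirDeriv_comm _ _ f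
theorem q_r_comm (f : F) : q (r f) = r (q f) := dirDeriv_comm _ _ f

theorem dirDeriv_of_linear (e : M) (ℓ : M →L[ℝ] ℝ) (f : F) (hf : ∀ m, f.1 m = ℓ m) (m : M) :
    (dirDeriv e f).1 m = ℓ e := by
  have : f.1 = ℓ := funext hf
  rw [dirDeriv_apply, this, ContinuousLinearMap.fderiv]

/-- The coordinate `x` as a linear form. -/
def xForm : M →L[ℝ] ℝ := ContinuousLinearMap.fst ℝ ℝ (ℝ × ℝ)

/-- The coordinate `y` as a linear form. -/
def yForm : M →L[ℝ] ℝ :=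
  (ContinuousLinearMap.fst ℝ ℝ ℝ).comp (ContinuousLinearMap.snd ℝ ℝ (ℝ × ℝ))

/-- The coordinate `z` as a linear form. -/
def zForm : M →L[ℝ] ℝ :=
  (ContinuousLinearMap.snd ℝ ℝ ℝ).comp (ContinuousLinearMap.snd ℝ ℝ (ℝ × ℝ))

@[simp] theorem p_x : p x = 1 :=
  Subtype.ext <| funext fun m => dirDeriv_of_linear _ xForm x (fun _ => rfl) m
@[simp] theorem p_y : p y = 0 :=
  Subtype.ext <| funext fun m => dirDeriv_of_linear _ yForm y (fun _ => rfl) m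
@[simp] theorem p_z : p z = 0 :=
  Subtype.ext <| funext fun m => dirDeriv_of_linear _ zForm z (fun _ => rfl) m
@[simp] theorem q_x : q x = 0 :=
  Subtype.ext <| funext fun m => dirDeriv_of_linear _ xForm x (fun _ => rfl) m
@[simp] theorem q_y : q y = 1 :=
  Subtype.ext <| funext fun m => dirDeriv_of_linear _ yForm y (fun _ => rfl) m
@[simp] theorem q_z : q z = 0 :=
  Subtype.ext <| funext fun m => dirDeriv_of_linear _ zForm z (fun _ => rfl) m
@[simp] theorem r_x : r x = 0 :=
  Subtype.ext <| funext fun m => dirDeriv_of_linear _ xForm x (fun _ => rfl) m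
@[simp] theorem r_y : r y = 0 :=
  Subtype.ext <| funext fun m => dirDeriv_of_linear _ yForm y (fun _ => rfl) m
@[simp] theorem r_z : r z = 1 :=
  Subtype.ext <| funext fun m => dirDeriv_of_linear _ zForm z (fun _ => rfl) m

@[simp] theorem ofZ_add (K L : smooth ℝ) : ofZ (K + L) = ofZ K + ofZ L := rfl
@[simp] theorem ofZ_sub (K L : smooth ℝ) : ofZ (K - L) = ofZ K - ofZ L := rfl
@[simp] theorem ofZ_neg (K : smooth ℝ) : ofZ (-K) = -ofZ K := rfl
@[simp] theorem ofZ_mul (K L : smooth ℝ) : ofZ (K * L) = ofZ K * ofZ L := rfl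
@[simp] theorem ofZ_smul (c : ℝ) (K : smooth ℝ) : ofZ (c • K) = c • ofZ K := rfl
@[simp] theorem ofZ_one : ofZ 1 = 1 := rfl
@[simp] theorem ofZ_zero : ofZ 0 = 0 := rfl

/-- `K ↦ K(z)` as a linear map. -/
def ofZₗ : smooth ℝ →ₗ[ℝ] F where
  toFun := ofZ
  map_add' _ _ := rfl
  map_smul' _ _ := rfl

/-- The restriction of a function to the `z`-axis. -/
def axis : F →ₗ[ℝ] smooth ℝ where
  toFun f := ⟨fun t => f.1 (0, 0, t), mem_smooth.2 ((smooth_contDiff f).comp (by fun_prop))⟩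
  map_add' _ _ := rfl
  map_smul' _ _ := rfl

@[simp] theorem axis_ofZ (K : smooth ℝ) : axis (ofZ K) = K := rfl
@[simp] theorem axis_x : axis x = 0 := rfl
@[simp] theorem axis_y : axis y = 0 := rfl

theorem ofZ_injective : Function.Injective ofZ := fun K L h => by
  rw [← axis_ofZ K, h, axis_ofZ]

@[simp] theorem ofZ_eq_zero {K : smooth ℝ} : ofZ K = 0 ↔ K = 0 :=
  ⟨fun h => ofZ_injective (by simpa using h), fun h => by simp [h]⟩

@[simp] theorem p_ofZ (K : smooth ℝ) : p (ofZ K) = 0 := Subtype.ext <| funext fun m => by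
  refine dirDeriv_eq_of_hasDerivAt ?_
  simpa [ofZ] using hasDerivAt_const (0 : ℝ) (K.1 m.2.2)

@[simp] theorem q_ofZ (K : smooth ℝ) : q (ofZ K) = 0 := Subtype.ext <| funext fun m => by
  refine dirDeriv_eq_of_hasDerivAt ?_
  simpa [ofZ] using hasDerivAt_const (0 : ℝ) (K.1 m.2.2)

theorem eq_ofZ_axis {f : F} (hp : p f = 0) (hq : q f = 0) : f = ofZ (axis f) := by
  apply Subtype.ext
  funext m
  have h1 := eq_on_line_of_dirDeriv_eq_zero hp m (-m.1)
  have h2 := eq_on_line_of_dirDeriv_eq_zero hq (m + (-m.1) • (1, 0, 0)) (-m.2.1)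
  rw [← h1, ← h2]
  change f.1 _ = f.1 (0, 0, m.2.2)
  exact congr_arg f.1 (Prod.ext (by simp) (Prod.ext (by simp) (by simp)))

theorem exists_eq_ofZ {f : F} (hp : p f = 0) (hq : q f = 0) : ∃ K, f = ofZ K :=
  ⟨_, eq_ofZ_axis hp hq⟩

/-- The derivative of a function of one variable. -/
def dz : smooth ℝ →ₗ[ℝ] smooth ℝ := axis ∘ₗ (r : F →ₗ[ℝ] F) ∘ₗ ofZₗ

@[simp] theorem r_ofZ (K : smooth ℝ) : r (ofZ K) = ofZ (dz K) :=
  eq_ofZ_axis (by rw [p_r_comm]; simp) (by rw [q_r_comm]; simp)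

theorem dz_apply {K : smooth ℝ} {t c : ℝ} (h : HasDerivAt K.1 c t) : (dz K).1 t = c := by
  refine dirDeriv_eq_of_hasDerivAt (f := ofZ K) (m := (0, 0, t)) ?_
  have : HasDerivAt (fun s : ℝ => K.1 (t + s)) c 0 :=
    HasDerivAt.comp_const_add t 0 (by simpa using h)
  simpa [ofZ] using this

theorem dz_mul (K L : smooth ℝ) : dz (K * L) = K * dz L + L * dz K := by
  apply ofZ_injective
  rw [← r_ofZ]
  simp [Derivation.leibniz]

theorem exists_dz_eq (K : smooth ℝ) : ∃ G, dz G = K := by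
  obtain ⟨G, hG, h0⟩ := exists_primitive (0, 0, 1) zForm rfl (ofZ K)
  obtain ⟨L, rfl⟩ := exists_eq_ofZ (h0 _ (by simp [zForm]) (p_ofZ K))
    (h0 _ (by simp [zForm]) (q_ofZ K))
  exact ⟨L, ofZ_injective (by rw [← r_ofZ]; exact hG)⟩

/-- The Poincaré lemma in the `(x, y)`-planes with `z` as a parameter: integrate in `x`, then in
`y`. Closedness makes the second integrand, hence its primitive, independent of `x`. -/
theorem exists_potential {A B : F} (h : p B = q A) : ∃ f, p f = A ∧ q f = B := by
  obtain ⟨G, hG, -⟩ := exists_primitive (1, 0, 0) xForm rfl A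
  have hG : p G = A := hG
  obtain ⟨H, hH, h0⟩ := exists_primitive (0, 1, 0) yForm rfl (B - q G)
  have h1 : p (B - q G) = 0 := by rw [map_sub, p_q_comm, hG, h, sub_self]
  have hH : q H = B - q G := hH
  have hH0 : p H = 0 := h0 (1, 0, 0) (by simp [yForm]) h1
  exact ⟨G + H, by simp [hG, hH0], by simp [hH]⟩

/-! ### Cancelling coordinates -/

theorem continuous_coe {E : Type} [NormedAddCommGroup E] [NormedSpace ℝ E] (f : smooth E) :
    Continuous f.1 := (smooth_contDiff f).continuous

/-- The set `x ≠ 0` is dense, so continuity extends the vanishing of `f` to all of `M`. -/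
theorem eq_zero_of_x_mul {f : F} (h : x * f = 0) : f = 0 := by
  have hd : Dense {m : M | m.1 ≠ 0} := (dense_compl_singleton (0 : ℝ)).preimage isOpenMap_fst
  apply Subtype.ext
  refine (continuous_coe f).ext_on hd continuous_const fun m hm => ?_
  have h1 : m.1 * f.1 m = 0 := congr_fun (congr_arg Subtype.val h) m
  exact (mul_eq_zero.1 h1).resolve_left hm

theorem eq_zero_of_y_mul {f : F} (h : y * f = 0) : f = 0 := by
  have hd : Dense {m : M | m.2.1 ≠ 0} :=
    ((dense_compl_singleton (0 : ℝ)).preimage isOpenMap_fst).preimage isOpenMap_snd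
  apply Subtype.ext
  refine (continuous_coe f).ext_on hd continuous_const fun m hm => ?_
  have h1 : m.2.1 * f.1 m = 0 := congr_fun (congr_arg Subtype.val h) m
  exact (mul_eq_zero.1 h1).resolve_left hm

theorem mem_constants {f : F} : f ∈ constants ↔ ∃ c : ℝ, f = c • 1 := by
  change f ∈ Submodule.span ℝ {1} ↔ _
  rw [Submodule.mem_span_singleton]
  exact ⟨fun ⟨c, h⟩ => ⟨c, h.symm⟩, fun ⟨c, h⟩ => ⟨c, h.symm⟩⟩

theorem smul_one_mem_constants (c : ℝ) : c • (1 : F) ∈ constants := mem_constants.2 ⟨c, rfl⟩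

theorem one_mem_constants : (1 : F) ∈ constants := mem_constants.2 ⟨1, by simp⟩

theorem derivation_apply_constant {f : F} (hf : f ∈ constants) (v : VF) : v f = 0 := by
  obtain ⟨c, rfl⟩ := mem_constants.1 hf
  rw [Derivation.map_smul, Derivation.map_one_eq_zero, smul_zero]

theorem constant_eq_zero {f : F} (hf : f ∈ constants) (m : M) (h : f.1 m = 0) : f = 0 := by
  obtain ⟨c, rfl⟩ := mem_constants.1 hf
  have : c * 1 = 0 := h
  rw [mul_one] at this
  rw [this, zero_smul]

/-- A constant divisible by `x` vanishes at the origin. This is how relations known only modulo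
constants become exact. -/
theorem eq_zero_of_x_mul_mem_constants {f : F} (h : x * f ∈ constants) : f = 0 :=
  eq_zero_of_x_mul (constant_eq_zero h 0 (zero_mul _))

theorem eq_zero_of_y_mul_mem_constants {f : F} (h : y * f ∈ constants) : f = 0 :=
  eq_zero_of_y_mul (constant_eq_zero h 0 (zero_mul _))

theorem ofZ_mem_constants_iff {K : smooth ℝ} : ofZ K ∈ constants ↔ dz K = 0 := by
  constructor
  · intro h
    have := derivation_apply_constant h r
    rwa [r_ofZ, ofZ_eq_zero] at this
  · intro h
    refine mem_constants.2 ⟨K.1 0, Subtype.ext (funext fun m => ?_)⟩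
    have h1 : r (ofZ K) = 0 := by rw [r_ofZ, h, ofZ_zero]
    have := eq_on_line_of_dirDeriv_eq_zero h1 0 m.2.2
    have h2 : K.1 m.2.2 = K.1 0 := by simpa [ofZ] using this
    change K.1 m.2.2 = K.1 0 * 1
    rw [h2, mul_one]

/-! ### Brackets of vector fields -/

theorem vf_lie_zero (v : VF) : ⁅v, (0 : VF)⁆ = 0 :=
  Derivation.ext fun f => by simp [Derivation.commutator_apply]

theorem vf_zero_lie (v : VF) : ⁅(0 : VF), v⁆ = 0 :=
  Derivation.ext fun f => by simp [Derivation.commutator_apply]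

theorem vf_lie_add (u v w : VF) : ⁅u, v + w⁆ = ⁅u, v⁆ + ⁅u, w⁆ :=
  Derivation.ext fun f => by
    simp only [Derivation.commutator_apply, Derivation.add_apply, map_add]; ring

theorem vf_add_lie (u v w : VF) : ⁅u + v, w⁆ = ⁅u, w⁆ + ⁅v, w⁆ :=
  Derivation.ext fun f => by
    simp only [Derivation.commutator_apply, Derivation.add_apply, map_add]; ring

theorem vf_lie_smul (c : ℝ) (u v : VF) : ⁅u, c • v⁆ = c • ⁅u, v⁆ :=
  Derivation.ext fun f => by
    simp only [Derivation.commutator_apply, Derivation.smul_apply, Derivation.map_smul, smul_sub]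

theorem vf_smul_lie (c : ℝ) (u v : VF) : ⁅c • u, v⁆ = c • ⁅u, v⁆ :=
  Derivation.ext fun f => by
    simp only [Derivation.commutator_apply, Derivation.smul_apply, Derivation.map_smul, smul_sub]

theorem vf_lie_skew (u v : VF) : ⁅u, v⁆ = -⁅v, u⁆ :=
  Derivation.ext fun f => by
    simp only [Derivation.commutator_apply, Derivation.neg_apply, neg_sub]

/-! ### Cocycles as relations between vector fields and functions -/

theorem modConst_add (f g : F) : modConst (f + g) = modConst f + modConst g := rfl
theorem modConst_sub (f g : F) : modConst (f - g) = modConst f - modConst g := rfl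
theorem modConst_smul (c : ℝ) (f : F) : modConst (c • f) = c • modConst f := rfl

/-- The projection `F(M) → F(M)/{1}` as a linear map. -/
def modConstₗ : F →ₗ[ℝ] FmodConst where
  toFun := modConst
  map_add' _ _ := rfl
  map_smul' _ _ := rfl

theorem modConst_eq_iff {f g : F} : modConst f = modConst g ↔ f - g ∈ constants :=
  Submodule.Quotient.eq constants.toSubmodule

theorem modConst_surjective (κ : FmodConst) : ∃ f, modConst f = κ :=
  Submodule.Quotient.mk_surjective constants.toSubmodule κ

theorem lie_modConst {𝔥 : LieSubalgebra ℝ VF} (v : 𝔥) (f : F) :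
    ⁅v, modConst f⁆ = modConst ((v : VF) f) := rfl

/-- `η` represents the value of the cocycle `φ` at the vector field `v`. -/
def Rel {𝔥 : LieSubalgebra ℝ VF} (φ : Cocycle 𝔥) (v : VF) (η : F) : Prop :=
  ∃ h : v ∈ 𝔥, φ ⟨v, h⟩ = modConst η

/-- The cocycle `v ↦ v(f)`. -/
abbrev cobdry (𝔥 : LieSubalgebra ℝ VF) (f : F) : Cocycle 𝔥 :=
  LieDerivation.inner ℝ 𝔥 FmodConst (modConst f)

section Rel

variable {𝔥 : LieSubalgebra ℝ VF} {φ : Cocycle 𝔥} {v w : VF} {η ζ : F}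

theorem cobdry_apply (f : F) (v : 𝔥) : cobdry 𝔥 f v = modConst ((v : VF) f) := rfl

theorem exists_rel (φ : Cocycle 𝔥) (h : v ∈ 𝔥) : ∃ η, Rel φ v η := by
  obtain ⟨η, hη⟩ := modConst_surjective (φ ⟨v, h⟩)
  exact ⟨η, h, hη.symm⟩

theorem Rel.sub_mem (h : Rel φ v η) (h' : Rel φ v ζ) : η - ζ ∈ constants := by
  obtain ⟨_, h⟩ := h
  obtain ⟨_, h'⟩ := h'
  exact modConst_eq_iff.1 (h.symm.trans h')

theorem Rel.of_sub_mem (h : Rel φ v η) (h' : η - ζ ∈ constants) : Rel φ v ζ :=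
  ⟨h.1, h.2.trans (modConst_eq_iff.2 h')⟩

theorem Rel.add (h : Rel φ v η) (h' : Rel φ w ζ) : Rel φ (v + w) (η + ζ) := by
  obtain ⟨h1, h⟩ := h
  obtain ⟨h1', h'⟩ := h'
  refine ⟨add_mem h1 h1', ?_⟩
  rw [modConst_add, ← h, ← h', ← map_add]
  rfl

theorem Rel.smul (c : ℝ) (h : Rel φ v η) : Rel φ (c • v) (c • η) := by
  obtain ⟨h1, h⟩ := h
  refine ⟨𝔥.smul_mem c h1, ?_⟩
  rw [modConst_smul, ← h, ← map_smul]
  rfl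

theorem Rel.neg (h : Rel φ v η) : Rel φ (-v) (-η) := by
  rw [← neg_one_smul ℝ v, ← neg_one_smul ℝ η]
  exact h.smul (-1)

theorem Rel.sub (h : Rel φ v η) (h' : Rel φ w ζ) : Rel φ (v - w) (η - ζ) := by
  rw [sub_eq_add_neg v w, sub_eq_add_neg η ζ]
  exact h.add h'.neg

theorem Rel.lie (h : Rel φ v η) (h' : Rel φ w ζ) : Rel φ ⁅v, w⁆ (v ζ - w η) := by
  obtain ⟨h1, h⟩ := h
  obtain ⟨h1', h'⟩ := h'
  refine ⟨𝔥.lie_mem h1 h1', ?_⟩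
  have := LieDerivation.apply_lie_eq_sub φ ⟨v, h1⟩ ⟨w, h1'⟩
  rw [h, h', lie_modConst, lie_modConst] at this
  exact this

theorem Rel.congr (h : Rel φ v η) (h' : v = w) : Rel φ w η := h' ▸ h

theorem rel_zero (φ : Cocycle 𝔥) : Rel φ 0 0 := by
  refine ⟨zero_mem _, ?_⟩
  exact map_zero φ

theorem Rel.sub_cobdry (h : Rel φ v η) (f : F) : Rel (φ - cobdry 𝔥 f) v (η - v f) := by
  obtain ⟨h1, h⟩ := h
  refine ⟨h1, ?_⟩
  rw [LieDerivation.sub_apply, h, cobdry_apply, modConst_sub]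

theorem Rel.of_sub_cobdry {f : F} (h : Rel (φ - cobdry 𝔥 f) v η) : Rel φ v (η + v f) := by
  obtain ⟨h1, h⟩ := h
  refine ⟨h1, ?_⟩
  rw [LieDerivation.sub_apply, cobdry_apply, sub_eq_iff_eq_add] at h
  rw [h, modConst_add]

end Rel

/-! ### Operators -/

theorem op_apply (v : VF) (η f : F) : op v η f = v f + η * f := rfl

theorem op_one (v : VF) (η : F) : op v η 1 = η := by
  rw [op_apply, Derivation.map_one_eq_zero, zero_add, mul_one]

theorem op_inj {v w : VF} {η ζ : F} (h : op v η = op w ζ) : v = w ∧ η = ζ := by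
  have h1 : η = ζ := by rw [← op_one v η, h, op_one]
  refine ⟨Derivation.ext fun f => ?_, h1⟩
  have := congr_arg (fun T : Module.End ℝ F => T f) h
  simp only [op_apply, h1] at this
  exact add_right_cancel this

theorem op_add (v w : VF) (η ζ : F) : op (v + w) (η + ζ) = op v η + op w ζ := by
  refine LinearMap.ext fun f => ?_
  simp only [LinearMap.add_apply, op_apply, Derivation.add_apply]
  ring

theorem op_smul (c : ℝ) (v : VF) (η : F) : op (c • v) (c • η) = c • op v η := by
  refine LinearMap.ext fun f => ?_
  simp only [LinearMap.smul_apply, op_apply, Derivation.smul_apply, smul_add, smul_mul_assoc]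

theorem op_zero_one : op 0 1 = 1 := by
  refine LinearMap.ext fun f => ?_
  simp [op_apply]

theorem op_commutator (v w : VF) (η ζ : F) :
    op v η * op w ζ - op w ζ * op v η = op ⁅v, w⁆ (v ζ - w η) := by
  refine LinearMap.ext fun f => ?_
  simp only [LinearMap.sub_apply, Module.End.mul_apply, op_apply, Derivation.commutator_apply,
    map_add, Derivation.leibniz, smul_eq_mul]
  ring

/-- The vector fields that satisfy the chain rule for the exponential function. -/
def expFields : Submodule F VF where
  carrier := {v | ∀ f, v (expF f) = expF f * v f}
  add_mem' {v w} hv hw f := by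
    rw [Derivation.add_apply, hv f, hw f, Derivation.add_apply, mul_add]
  zero_mem' f := by simp
  smul_mem' g v hv f := by
    rw [Derivation.smul_apply, hv f, Derivation.smul_apply, smul_eq_mul, smul_eq_mul, mul_left_comm]

theorem dirDeriv_mem_expFields (e : M) : dirDeriv e ∈ expFields := fun f =>
  Subtype.ext <| funext fun m => by
    change fderiv ℝ (fun m => Real.exp (f.1 m)) m e = Real.exp (f.1 m) * fderiv ℝ f.1 m e
    rw [fderiv_exp (smooth_differentiableAt f m)]
    rfl

theorem p_mem_expFields : p ∈ expFields := dirDeriv_mem_expFields _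
theorem q_mem_expFields : q ∈ expFields := dirDeriv_mem_expFields _
theorem r_mem_expFields : r ∈ expFields := dirDeriv_mem_expFields _

/-- The chain rule for `exp` is assumed through `expFields`, since `v` is an abstract derivation; it
holds for `p`, `q`, `r` and is preserved by `F`-linear combinations. -/
theorem gaugeConj_op {v : VF} (hv : v ∈ expFields) (f η : F) :
    gaugeConj f (op v η) = op v (η - v f) := by
  refine LinearMap.ext fun g => ?_
  have hexp : expF f * expF (-f) = 1 := by
    apply Subtype.ext
    funext m
    change Real.exp (f.1 m) * Real.exp (-(f.1 m)) = 1
    rw [← Real.exp_add, add_neg_cancel, Real.exp_zero]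
  change expF f * (v (expF (-f) * g) + η * (expF (-f) * g)) = v g + (η - v f) * g
  rw [Derivation.leibniz, hv, map_neg]
  simp only [smul_eq_mul]
  linear_combination (v g - v f * g + η * g) * hexp

theorem sub_eq_iff_eq_sub {G : Type*} [AddCommGroup G] {a b c : G} : a - b = c ↔ b = a - c := by
  constructor
  · rintro rfl
    abel
  · rintro rfl
    abel

/-! ### From cocycles to Lie algebras of differential operators -/

/-- The operators `v + η` with `η` a representative of the value of `φ` at `v`. -/
def cocycleOps {𝔥 : LieSubalgebra ℝ VF} (φ : Cocycle 𝔥) : Submodule ℝ (Module.End ℝ F) where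
  carrier := {T | ∃ v η, Rel φ v η ∧ T = op v η}
  add_mem' := by
    rintro _ _ ⟨v, η, h, rfl⟩ ⟨w, ζ, h', rfl⟩
    exact ⟨_, _, h.add h', (op_add v w η ζ).symm⟩
  zero_mem' := ⟨0, 0, rel_zero φ, by simp [op]⟩
  smul_mem' := by
    rintro c _ ⟨v, η, h, rfl⟩
    exact ⟨_, _, h.smul c, (op_smul c v η).symm⟩

theorem op_mem_cocycleOps {𝔥 : LieSubalgebra ℝ VF} {φ : Cocycle 𝔥} {v : VF} {η : F} :
    op v η ∈ cocycleOps φ ↔ Rel φ v η := by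
  constructor
  · rintro ⟨w, ζ, h, h'⟩
    obtain ⟨rfl, rfl⟩ := op_inj h'
    exact h
  · intro h
    exact ⟨v, η, h, rfl⟩

theorem isDiffOpAlgebra_cocycleOps {𝔥 : LieSubalgebra ℝ VF} (φ : Cocycle 𝔥) :
    IsDiffOpAlgebra 𝔥 (cocycleOps φ) := by
  refine ⟨?_, ?_, ?_, ?_⟩
  · rintro _ ⟨v, η, h, rfl⟩ _ ⟨w, ζ, h', rfl⟩
    exact ⟨_, _, h.lie h', op_commutator v w η ζ⟩
  · rintro _ ⟨v, η, h, rfl⟩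
    exact ⟨v, h.1, η, rfl⟩
  · intro v hv
    obtain ⟨η, hη⟩ := exists_rel φ hv
    exact ⟨η, v, η, hη, rfl⟩
  · intro ζ
    rw [op_mem_cocycleOps]
    constructor
    · intro h
      simpa using h.sub_mem (rel_zero φ)
    · intro h
      exact (rel_zero φ).of_sub_mem (by simpa using neg_mem h)

/-- Choose any `η v` over each `v`. Two choices differ by a multiplication operator in `𝔤`, hence by
a constant, so the class of `η v` is linear in `v` and satisfies the cocycle identity. -/
theorem exists_eq_cocycleOps {𝔥 : LieSubalgebra ℝ VF} {𝔤 : Submodule ℝ (Module.End ℝ F)}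
    (h : IsDiffOpAlgebra 𝔥 𝔤) : ∃ φ : Cocycle 𝔥, 𝔤 = cocycleOps φ := by
  obtain ⟨hlie, hop, hex, hconst⟩ := h
  choose! η hη using hex
  have huniq : ∀ {v : VF} {ζ ζ' : F}, op v ζ ∈ 𝔤 → op v ζ' ∈ 𝔤 → modConst ζ = modConst ζ' := by
    intro v ζ ζ' h1 h2
    refine modConst_eq_iff.2 ((hconst _).1 ?_)
    have := 𝔤.add_mem h1 (𝔤.smul_mem (-1) h2)
    rw [← op_smul, ← op_add] at this
    convert this using 2
    · exact Derivation.ext fun f => by simp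
    · simp [sub_eq_add_neg]
  let φ : Cocycle 𝔥 :=
    { toFun := fun v => modConst (η v)
      map_add' := fun v w => by
        rw [← modConst_add]
        refine huniq (v := v + w) (hη _ (v + w).2) ?_
        rw [op_add]
        exact 𝔤.add_mem (hη _ v.2) (hη _ w.2)
      map_smul' := fun c v => by
        change _ = c • modConst (η v)
        rw [← modConst_smul]
        refine huniq (v := c • (v : VF)) (hη _ (c • v).2) ?_
        rw [op_smul]
        exact 𝔤.smul_mem c (hη _ v.2)
      leibniz' := fun v w => by
        change modConst (η (⁅v, w⁆ : 𝔥)) = ⁅v, modConst (η w)⁆ - ⁅w, modConst (η v)⁆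
        rw [lie_modConst, lie_modConst, ← modConst_sub]
        refine huniq (v := ⁅(v : VF), (w : VF)⁆) (hη _ ⁅v, w⁆.2) ?_
        rw [← op_commutator]
        exact hlie _ (hη _ v.2) _ (hη _ w.2) }
  refine ⟨φ, ?_⟩
  ext T
  constructor
  · intro hT
    obtain ⟨v, hv, ζ, rfl⟩ := hop T hT
    exact ⟨v, ζ, ⟨hv, huniq (hη v hv) hT⟩, rfl⟩
  · rintro ⟨v, ζ, ⟨hv, h⟩, rfl⟩
    have h1 : op 0 (ζ - η v) ∈ 𝔤 := (hconst _).2 (modConst_eq_iff.1 h.symm)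
    have := 𝔤.add_mem (hη v hv) h1
    rw [← op_add] at this
    simpa using this

/-- This is the dictionary between gauge transformations and coboundaries. -/
theorem map_gaugeConj_cocycleOps {𝔥 : LieSubalgebra ℝ VF} (φ : Cocycle 𝔥)
    (h𝔥 : ∀ v ∈ 𝔥, v ∈ expFields) (f : F) :
    (cocycleOps φ).map (gaugeConj f) = cocycleOps (φ - cobdry 𝔥 f) := by
  ext T
  constructor
  · rintro ⟨_, ⟨v, η, h, rfl⟩, rfl⟩
    exact ⟨v, _, h.sub_cobdry f, gaugeConj_op (h𝔥 v h.1) f η⟩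
  · rintro ⟨v, η, h, rfl⟩
    refine ⟨op v (η + v f), ⟨v, _, h.of_sub_cobdry, rfl⟩, ?_⟩
    rw [gaugeConj_op (h𝔥 v h.1), add_sub_cancel_right]

theorem cocycleOps_injective {𝔥 : LieSubalgebra ℝ VF} {φ ψ : Cocycle 𝔥}
    (h : cocycleOps φ = cocycleOps ψ) : φ = ψ := by
  refine LieDerivation.ext fun v => ?_
  obtain ⟨η, hη⟩ := exists_rel φ v.2
  have h1 : Rel ψ v η := op_mem_cocycleOps.1 (h ▸ op_mem_cocycleOps.2 hη)
  exact hη.2.trans h1.2.symm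

section Families

variable {ι : Type} {v : ι → VF}

theorem subset_lieAlg (i : ι) : v i ∈ lieAlg v :=
  LieSubalgebra.subset_lieSpan (Set.mem_range_self i)

theorem lieAlg_eq_span (hspan : ∀ i j, ⁅v i, v j⁆ ∈ Submodule.span ℝ (Set.range v)) :
    (lieAlg v).toSubmodule = Submodule.span ℝ (Set.range v) := by
  apply le_antisymm
  · let K : LieSubalgebra ℝ VF :=
      { Submodule.span ℝ (Set.range v) with
        lie_mem' := by
          intro a b ha hb
          change ⁅a, b⁆ ∈ Submodule.span ℝ (Set.range v)
          change a ∈ Submodule.span ℝ (Set.range v) at ha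
          change b ∈ Submodule.span ℝ (Set.range v) at hb
          induction ha using Submodule.span_induction with
          | mem a ha =>
            obtain ⟨i, rfl⟩ := ha
            induction hb using Submodule.span_induction with
            | mem b hb => obtain ⟨j, rfl⟩ := hb; exact hspan i j
            | zero => rw [vf_lie_zero]; exact zero_mem _
            | add b b' _ _ h h' => rw [vf_lie_add]; exact add_mem h h'
            | smul c b _ h => rw [vf_lie_smul]; exact Submodule.smul_mem _ c h
          | zero => rw [vf_zero_lie]; exact zero_mem _
          | add b b' _ _ h h' => rw [vf_add_lie]; exact add_mem h h'
          | smul c b _ h => rw [vf_smul_lie]; exact Submodule.smul_mem _ c h }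
    have : lieAlg v ≤ K := LieSubalgebra.lieSpan_le.2 Submodule.subset_span
    exact this
  · rw [Submodule.span_le]
    rintro _ ⟨i, rfl⟩
    exact subset_lieAlg i

theorem rel_unique (hspan : (lieAlg v).toSubmodule = Submodule.span ℝ (Set.range v))
    {φ ψ : Cocycle (lieAlg v)} (η : ι → F) (h : ∀ i, Rel φ (v i) (η i))
    (h' : ∀ i, Rel ψ (v i) (η i)) : φ = ψ := by
  have key : ∀ w ∈ Submodule.span ℝ (Set.range v), ∃ ζ, Rel φ w ζ ∧ Rel ψ w ζ := by
    intro w hw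
    induction hw using Submodule.span_induction with
    | mem a ha => obtain ⟨i, rfl⟩ := ha; exact ⟨η i, h i, h' i⟩
    | zero => exact ⟨0, rel_zero φ, rel_zero ψ⟩
    | add a b _ _ ha hb =>
      obtain ⟨ζ, h1, h2⟩ := ha
      obtain ⟨ξ, h3, h4⟩ := hb
      exact ⟨_, h1.add h3, h2.add h4⟩
    | smul c a _ ha =>
      obtain ⟨ζ, h1, h2⟩ := ha
      exact ⟨_, h1.smul c, h2.smul c⟩
  refine LieDerivation.ext fun w => ?_
  obtain ⟨ζ, h1, h2⟩ := key w (by rw [← hspan]; exact w.2)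
  exact h1.2.trans h2.2.symm

/-- A cocycle value fixes an operator only up to a constant, and the generator `1` of the span
absorbs that ambiguity. -/
theorem opSpan_eq_cocycleOps (hspan : (lieAlg v).toSubmodule = Submodule.span ℝ (Set.range v))
    {φ : Cocycle (lieAlg v)} {η : ι → F} (h : ∀ i, Rel φ (v i) (η i)) :
    opSpan v η = cocycleOps φ := by
  apply le_antisymm
  · refine Submodule.span_le.2 ?_
    rintro _ (⟨i, rfl⟩ | rfl)
    · exact op_mem_cocycleOps.2 (h i)
    · rw [← op_zero_one]
      exact op_mem_cocycleOps.2 ((rel_zero φ).of_sub_mem (by simpa using neg_mem one_mem_constants))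
  · rintro _ ⟨w, ζ, hw, rfl⟩
    have key : ∀ w ∈ Submodule.span ℝ (Set.range v), ∃ ξ, Rel φ w ξ ∧ op w ξ ∈ opSpan v η := by
      intro w hw
      induction hw using Submodule.span_induction with
      | mem a ha =>
        obtain ⟨i, rfl⟩ := ha
        exact ⟨η i, h i, Submodule.subset_span (Or.inl ⟨i, rfl⟩)⟩
      | zero => exact ⟨0, rel_zero φ, by simp [op]⟩
      | add a b _ _ ha hb =>
        obtain ⟨ζ, h1, h2⟩ := ha
        obtain ⟨ξ, h3, h4⟩ := hb
        exact ⟨_, h1.add h3, by rw [op_add]; exact add_mem h2 h4⟩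
      | smul c a _ ha =>
        obtain ⟨ζ, h1, h2⟩ := ha
        exact ⟨_, h1.smul c, by rw [op_smul]; exact Submodule.smul_mem _ c h2⟩
    obtain ⟨ξ, h1, h2⟩ := key w (by rw [← hspan]; exact hw.1)
    obtain ⟨c, hc⟩ := mem_constants.1 (hw.sub_mem h1)
    have h3 : op w ζ = op w ξ + c • 1 := by
      rw [← op_zero_one, ← op_smul, ← op_add, ← hc, smul_zero, add_zero, add_sub_cancel]
    rw [h3]
    exact add_mem h2 (Submodule.smul_mem _ c (Submodule.subset_span (Or.inr rfl)))

/-- `Classifies` follows from a bracket table, a linear formula for the representatives, and a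
computation of the cocycles and coboundaries on the generators. -/
theorem classifies_of {P : Type} [AddCommGroup P] [Module ℝ P] {η : P → ι → F}
    {P₀ : Submodule ℝ P} (hexp : ∀ i, v i ∈ expFields)
    (hspan : ∀ i j, ⁅v i, v j⁆ ∈ Submodule.span ℝ (Set.range v))
    (L : P →ₗ[ℝ] VF →ₗ[ℝ] F)
    (hL : ∀ c i, L c (v i) - η c i ∈ constants)
    (hcoc : ∀ c i j, L c ⁅v i, v j⁆ - (v i (L c (v j)) - v j (L c (v i))) ∈ constants)
    (hsurj : ∀ φ : Cocycle (lieAlg v), ∃ c f,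
      ∀ i, Rel (φ - cobdry (lieAlg v) f) (v i) (η c i))
    (hker : ∀ c, (∃ f : F, ∀ i, v i f - η c i ∈ constants) ↔ c ∈ P₀) :
    Classifies v η P₀ := by
  have hspan' := lieAlg_eq_span hspan
  have hexp' : ∀ w ∈ lieAlg v, w ∈ expFields := by
    intro w hw
    have hw : w ∈ (lieAlg v).toSubmodule := hw
    rw [hspan'] at hw
    have hle : Submodule.span ℝ (Set.range v) ≤ expFields.restrictScalars ℝ := by
      rw [Submodule.span_le]
      rintro _ ⟨i, rfl⟩
      exact hexp i
    exact hle hw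
  replace hcoc : ∀ c i j, L c ⁅v i, v j⁆ - (v i (L c (v j)) - v j (L c (v i))) ∈
      constants.toSubmodule := hcoc
  have hcoc' : ∀ c, ∀ a ∈ lieAlg v, ∀ b ∈ lieAlg v,
      L c ⁅a, b⁆ - (a (L c b) - b (L c a)) ∈ constants.toSubmodule := by
    intro c a ha b hb
    replace ha : a ∈ (lieAlg v).toSubmodule := ha
    replace hb : b ∈ (lieAlg v).toSubmodule := hb
    rw [hspan'] at ha hb
    induction ha using Submodule.span_induction with
    | mem a ha =>
      obtain ⟨i, rfl⟩ := ha
      induction hb using Submodule.span_induction with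
      | mem b hb => obtain ⟨j, rfl⟩ := hb; exact hcoc c i j
      | zero => simp [vf_lie_zero]
      | add b b' _ _ h h' =>
        convert add_mem (S := Submodule ℝ F) (s := constants.toSubmodule) h h' using 1
        simp only [vf_lie_add, map_add, Derivation.add_apply]
        ring
      | smul t b _ h =>
        convert Submodule.smul_mem constants.toSubmodule t h using 1
        simp only [vf_lie_smul, map_smul, Derivation.map_smul, Derivation.smul_apply, smul_sub]
    | zero => simp [vf_zero_lie]
    | add b b' _ _ h h' =>
      convert add_mem (S := Submodule ℝ F) (s := constants.toSubmodule) h h' using 1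
      simp only [vf_add_lie, map_add, Derivation.add_apply]
      ring
    | smul t b _ h =>
      convert Submodule.smul_mem constants.toSubmodule t h using 1
      simp only [vf_smul_lie, map_smul, Derivation.map_smul, Derivation.smul_apply, smul_sub]
  -- Because `L c` is defined on all vector fields, its restriction is automatically well defined;
  -- no independence of the generators is needed.
  let Φ : P →ₗ[ℝ] Cocycle (lieAlg v) :=
    { toFun := fun c =>
        { toLinearMap := modConstₗ ∘ₗ L c ∘ₗ (lieAlg v).toSubmodule.subtype
          leibniz' := fun a b => modConst_eq_iff.2 (hcoc' c a a.2 b b.2) }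
      map_add' := fun c d => LieDerivation.ext fun a => by
        change modConst (L (c + d) a) = modConst (L c a) + modConst (L d a)
        rw [map_add]
        rfl
      map_smul' := fun t c => LieDerivation.ext fun a => by
        change modConst (L (t • c) a) = t • modConst (L c a)
        rw [map_smul]
        rfl }
  have hΦ : ∀ c i, Rel (Φ c) (v i) (η c i) := fun c i =>
    ⟨subset_lieAlg i, modConst_eq_iff.2 (hL c i)⟩
  have hops : ∀ c, opSpan v (η c) = cocycleOps (Φ c) := fun c =>
    opSpan_eq_cocycleOps hspan' (hΦ c)
  have hsurj' : ∀ φ : Cocycle (lieAlg v), ∃ c f, φ - cobdry _ f = Φ c := by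
    intro φ
    obtain ⟨c, f, h⟩ := hsurj φ
    exact ⟨c, f, rel_unique hspan' (η c) h (hΦ c)⟩
  have hker' : ∀ c, (∃ f : F, cobdry _ f = Φ c) ↔ c ∈ P₀ := by
    intro c
    rw [← hker c]
    refine exists_congr fun f => ⟨fun h i => ?_, fun h => ?_⟩
    · have h1 := hΦ c i
      rw [← h] at h1
      exact modConst_eq_iff.1 h1.2
    · refine rel_unique hspan' (η c) (fun i => ?_) (hΦ c)
      exact ⟨subset_lieAlg i, modConst_eq_iff.2 (h i)⟩
  refine ⟨hspan', ⟨Φ, fun c i => (hΦ c i).2, ?_, ?_⟩, ?_, ?_, ?_⟩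
  · intro κ
    obtain ⟨φ, rfl⟩ := Submodule.Quotient.mk_surjective _ κ
    obtain ⟨c, f, h⟩ := hsurj' φ
    refine ⟨c, (Submodule.Quotient.eq _).2 ?_⟩
    rw [← h, sub_sub_cancel_left]
    exact neg_mem (LinearMap.mem_range_self _ _)
  · intro c
    rw [Submodule.Quotient.mk_eq_zero, ← hker' c, LinearMap.mem_range]
    constructor
    · rintro ⟨κ, hκ⟩
      obtain ⟨f, rfl⟩ := modConst_surjective κ
      exact ⟨f, hκ⟩
    · rintro ⟨f, hf⟩
      exact ⟨_, hf⟩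
  · intro c
    rw [hops]
    exact isDiffOpAlgebra_cocycleOps _
  · intro 𝔤 h𝔤
    obtain ⟨φ, rfl⟩ := exists_eq_cocycleOps h𝔤
    obtain ⟨c, f, h⟩ := hsurj' φ
    exact ⟨c, f, by rw [map_gaugeConj_cocycleOps φ hexp', h, hops]⟩
  -- By linearity of `Φ`, a gauge transformation by `f` relates `c` to `c'` exactly when the
  -- coboundary of `f` is `Φ (c - c')`.
  · intro c c'
    rw [← hker' (c - c')]
    refine exists_congr fun f => ?_
    rw [hops, hops, map_gaugeConj_cocycleOps _ hexp', map_sub, ← sub_eq_iff_eq_sub]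
    exact ⟨fun h => cocycleOps_injective h, fun h => congr_arg cocycleOps h⟩

end Families

/-! ### The special linear algebra and weights -/

/-- The element `xp - yq` of `𝔰`. -/
def H : VF := x • p - y • q

theorem slGens_one : slGens 1 = H := rfl

theorem H_apply (f : F) : H f = x * p f - y * q f := rfl
theorem E_apply (f : F) : E f = x * p f + y * q f := rfl
theorem smul_vf_apply (a : F) (v : VF) (f : F) : (a • v) f = a * v f := rfl

theorem lie_H_X : ⁅H, x • q⁆ = (2 : ℝ) • (x • q) := Derivation.ext fun f => by
  simp only [Derivation.commutator_apply, H_apply, smul_vf_apply, Derivation.smul_apply,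
    Derivation.leibniz, smul_eq_mul, map_sub, p_x, p_y, q_x, q_y, p_q_comm, two_smul,
    Derivation.add_apply]
  ring

theorem lie_H_Y : ⁅H, y • p⁆ = (-2 : ℝ) • (y • p) := Derivation.ext fun f => by
  simp only [Derivation.commutator_apply, H_apply, smul_vf_apply, Derivation.smul_apply,
    Derivation.leibniz, smul_eq_mul, map_sub, p_x, p_y, q_x, q_y, p_q_comm, two_smul, neg_smul]
  ring

theorem lie_X_Y : ⁅x • q, y • p⁆ = H := Derivation.ext fun f => by
  simp only [Derivation.commutator_apply, H_apply, smul_vf_apply,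
    Derivation.leibniz, smul_eq_mul, p_x, p_y, q_x, q_y, p_q_comm]
  ring

theorem lie_H_p (K : smooth ℝ) : ⁅H, ofZ K • p⁆ = (-1 : ℝ) • (ofZ K • p) :=
  Derivation.ext fun f => by
    simp only [Derivation.commutator_apply, H_apply, smul_vf_apply, Derivation.smul_apply,
      Derivation.leibniz, smul_eq_mul, map_sub, p_x, p_y, q_x, q_y, p_q_comm, p_ofZ, q_ofZ,
      one_smul, neg_smul]
    ring

theorem lie_H_q (K : smooth ℝ) : ⁅H, ofZ K • q⁆ = (1 : ℝ) • (ofZ K • q) :=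
  Derivation.ext fun f => by
    simp only [Derivation.commutator_apply, H_apply, smul_vf_apply, Derivation.smul_apply,
      Derivation.leibniz, smul_eq_mul, map_sub, p_x, p_y, q_x, q_y, p_q_comm, p_ofZ, q_ofZ,
      one_smul]
    ring

theorem lie_X_p (K : smooth ℝ) : ⁅x • q, ofZ K • p⁆ = -(ofZ K • q) :=
  Derivation.ext fun f => by
    simp only [Derivation.commutator_apply, smul_vf_apply, Derivation.neg_apply,
      Derivation.leibniz, smul_eq_mul, p_x, p_q_comm, p_ofZ, q_ofZ]
    ring

theorem lie_X_q (K : smooth ℝ) : ⁅x • q, ofZ K • q⁆ = 0 :=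
  Derivation.ext fun f => by
    simp only [Derivation.commutator_apply, smul_vf_apply, Derivation.zero_apply,
      Derivation.leibniz, smul_eq_mul, q_x, q_ofZ]
    ring

theorem lie_Y_p (K : smooth ℝ) : ⁅y • p, ofZ K • p⁆ = 0 :=
  Derivation.ext fun f => by
    simp only [Derivation.commutator_apply, smul_vf_apply, Derivation.zero_apply,
      Derivation.leibniz, smul_eq_mul, p_y, p_ofZ]
    ring

theorem lie_Y_q (K : smooth ℝ) : ⁅y • p, ofZ K • q⁆ = -(ofZ K • p) :=
  Derivation.ext fun f => by
    simp only [Derivation.commutator_apply, smul_vf_apply, Derivation.neg_apply,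
      Derivation.leibniz, smul_eq_mul, q_y, p_q_comm, p_ofZ, q_ofZ]
    ring

theorem lie_p_p (K L : smooth ℝ) : ⁅ofZ K • p, ofZ L • p⁆ = 0 :=
  Derivation.ext fun f => by
    simp only [Derivation.commutator_apply, smul_vf_apply, Derivation.zero_apply,
      Derivation.leibniz, smul_eq_mul, p_ofZ]
    ring

theorem lie_q_q (K L : smooth ℝ) : ⁅ofZ K • q, ofZ L • q⁆ = 0 :=
  Derivation.ext fun f => by
    simp only [Derivation.commutator_apply, smul_vf_apply, Derivation.zero_apply,
      Derivation.leibniz, smul_eq_mul, q_ofZ]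
    ring

theorem lie_p_q (K L : smooth ℝ) : ⁅ofZ K • p, ofZ L • q⁆ = 0 :=
  Derivation.ext fun f => by
    simp only [Derivation.commutator_apply, smul_vf_apply, Derivation.zero_apply,
      Derivation.leibniz, smul_eq_mul, p_ofZ, q_ofZ, p_q_comm]
    ring

/-- `η` represents the value of the cocycle `φ` at `w`, normalized so that `φ [H, w]`, for `w` of
weight `m`, is represented by `m η`; here `σ` represents the value at `H`. -/
def WeightRel {𝔥 : LieSubalgebra ℝ VF} (φ : Cocycle 𝔥) (σ : F) (m : ℝ) (w : VF) (η : F) : Prop :=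
  Rel φ w η ∧ H η - w σ = m • η

section WeightRel

variable {𝔥 : LieSubalgebra ℝ VF} {φ : Cocycle 𝔥} {σ η ζ : F} {m k : ℝ} {v w : VF}

/-- The cocycle identity for `[H, w] = m w` shows that `m⁻¹ (H η - w σ)` also represents the value
at `w`. It differs from `η` by a constant, which `H` kills, so it satisfies the normalization
exactly. -/
theorem exists_weightRel (hσ : Rel φ H σ) (hm : m ≠ 0) (hw : w ∈ 𝔥) (hHw : ⁅H, w⁆ = m • w) :
    ∃ η, WeightRel φ σ m w η := by
  obtain ⟨η, hη⟩ := exists_rel φ hw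
  have h1 : Rel φ w (m⁻¹ • (H η - w σ)) :=
    ((hσ.lie hη).smul m⁻¹).congr (by rw [hHw, inv_smul_smul₀ hm])
  refine ⟨_, h1, ?_⟩
  have h2 : H (m⁻¹ • (H η - w σ)) = H η :=
    sub_eq_zero.1 (by rw [← map_sub]; exact derivation_apply_constant (h1.sub_mem hη) H)
  rw [h2, smul_inv_smul₀ hm]

/-- Two representatives differ by a constant, so `H` does not distinguish them, and then neither
does multiplication by `m`. -/
theorem WeightRel.unique (h : WeightRel φ σ m w η) (h' : WeightRel φ σ m w ζ) (hm : m ≠ 0) :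
    η = ζ := by
  have h1 : H η = H ζ :=
    sub_eq_zero.1 (by rw [← map_sub]; exact derivation_apply_constant (h.1.sub_mem h'.1) H)
  have h2 : m • η = m • ζ := by rw [← h.2, ← h'.2, h1]
  exact smul_right_injective F hm h2

/-- Weights add under brackets because `H` acts on values by a Leibniz rule. With uniqueness,
bracket relations of nonzero total weight become equalities of functions. -/
theorem WeightRel.lie (h : WeightRel φ σ m v η) (h' : WeightRel φ σ k w ζ)
    (hv : ⁅H, v⁆ = m • v) (hw : ⁅H, w⁆ = k • w) :
    WeightRel φ σ (m + k) ⁅v, w⁆ (v ζ - w η) := by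
  refine ⟨h.1.lie h'.1, ?_⟩
  have e1 := congr_arg (fun u : VF => u ζ) hv
  have e2 := congr_arg (fun u : VF => u η) hw
  simp only [Derivation.commutator_apply, Derivation.smul_apply] at e1 e2
  have e3 := congr_arg v h'.2
  have e4 := congr_arg w h.2
  simp only [map_sub, Derivation.map_smul] at e3 e4
  rw [map_sub, Derivation.commutator_apply, add_smul, smul_sub, smul_sub]
  linear_combination e1 - e2 + e3 - e4

theorem WeightRel.neg (h : WeightRel φ σ m v η) : WeightRel φ σ m (-v) (-η) := by
  refine ⟨h.1.neg, ?_⟩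
  rw [smul_neg, ← h.2, map_neg, Derivation.neg_apply]
  ring

theorem WeightRel.sub_cobdry (h : WeightRel φ σ m v η) (hv : ⁅H, v⁆ = m • v) (f : F) :
    WeightRel (φ - cobdry 𝔥 f) (σ - H f) m v (η - v f) := by
  refine ⟨h.1.sub_cobdry f, ?_⟩
  have e1 := congr_arg (fun u : VF => u f) hv
  simp only [Derivation.commutator_apply, Derivation.smul_apply] at e1
  rw [map_sub, map_sub, smul_sub]
  linear_combination h.2 - e1

theorem weightRel_zero (φ : Cocycle 𝔥) (σ : F) (m : ℝ) : WeightRel φ σ m 0 0 :=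
  ⟨rel_zero φ, by simp⟩

end WeightRel

/-! ### Normal form on `𝔰` and the planes `Z p`, `Z q` -/

/-- Without common zeros the sum of squares is positive, so a single global smooth function suffices
to divide by the whole family. -/
theorem exists_sum_sq_inverse {κ : Type} [Fintype κ] (Z : κ → smooth ℝ)
    (hZ : ∀ t : ℝ, ∃ k, (Z k).1 t ≠ 0) : ∃ V : smooth ℝ, V * ∑ k, Z k * Z k = 1 := by
  have hval : ∀ t, (∑ k, Z k * Z k).1 t = ∑ k, (Z k).1 t * (Z k).1 t := by
    intro t
    rw [AddSubmonoidClass.coe_finsetSum, Finset.sum_apply]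
    rfl
  have hpos : ∀ t, (∑ k, Z k * Z k).1 t ≠ 0 := by
    intro t
    rw [hval]
    obtain ⟨k, hk⟩ := hZ t
    have : 0 < ∑ k, (Z k).1 t * (Z k).1 t :=
      Finset.sum_pos' (fun k _ => mul_self_nonneg _)
        ⟨k, Finset.mem_univ k, mul_self_pos.2 hk⟩
    exact this.ne'
  exact ⟨⟨fun t => ((∑ k, Z k * Z k).1 t)⁻¹, mem_smooth.2 ((smooth_contDiff _).inv hpos)⟩,
    Subtype.ext (funext fun t => inv_mul_cancel₀ (hpos t))⟩

theorem ofZ_sum {κ : Type} [Fintype κ] (Z : κ → smooth ℝ) :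
    ofZ (∑ k, Z k) = ∑ k, ofZ (Z k) := map_sum ofZₗ Z Finset.univ

section Cancel

variable {κ : Type} [Fintype κ] {Z : κ → smooth ℝ}

theorem eq_zero_of_ofZ_sq_mul (hZ : ∀ t : ℝ, ∃ k, (Z k).1 t ≠ 0) {f : F}
    (h : ∀ k, ofZ (Z k) * ofZ (Z k) * f = 0) : f = 0 := by
  obtain ⟨V, hV⟩ := exists_sum_sq_inverse Z hZ
  have h1 := congr_arg ofZ hV
  rw [ofZ_mul, ofZ_sum, ofZ_one] at h1
  have h2 : (∑ k, ofZ (Z k * Z k)) * f = 0 := by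
    rw [Finset.sum_mul]
    exact Finset.sum_eq_zero fun k _ => h k
  linear_combination ofZ V * h2 - f * h1

theorem eq_zero_of_ofZ_mul (hZ : ∀ t : ℝ, ∃ k, (Z k).1 t ≠ 0) {f : F}
    (h : ∀ k, ofZ (Z k) * f = 0) : f = 0 :=
  eq_zero_of_ofZ_sq_mul hZ fun k => by rw [mul_assoc, h, mul_zero]

theorem eq_zero_of_mul (hZ : ∀ t : ℝ, ∃ k, (Z k).1 t ≠ 0) {K : smooth ℝ}
    (h : ∀ k, Z k * K = 0) : K = 0 :=
  ofZ_eq_zero.1 (eq_zero_of_ofZ_mul hZ fun k => by rw [← ofZ_mul, h, ofZ_zero])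

end Cancel

/-- Solves `η k = Z k ∂f/∂x - y β k` and `θ k = Z k ∂f/∂y + x β k`. -/
theorem exists_potential_of_relations {κ : Type} [Fintype κ] (Z : κ → smooth ℝ)
    (hZ : ∀ t : ℝ, ∃ k, (Z k).1 t ≠ 0) (η θ : κ → F) (σX σH : F)
    (hpp : ∀ i j, ofZ (Z i) * p (η j) - ofZ (Z j) * p (η i) = 0)
    (hpq : ∀ i j, ofZ (Z i) * p (θ j) - ofZ (Z j) * q (η i) ∈ constants)
    (hX : ∀ i, x * q (η i) - ofZ (Z i) * p σX = -θ i)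
    (hH : ∀ i, x * p (η i) - y * q (η i) - ofZ (Z i) * p σH = -η i) :
    ∃ (f : F) (β : κ → smooth ℝ),
      (∀ i j, ofZ (Z i * β j + Z j * β i) ∈ constants) ∧
      (∀ k, η k - ofZ (Z k) * p f = -(ofZ (β k) * y)) ∧
      (∀ k, θ k - ofZ (Z k) * q f = ofZ (β k) * x) := by
  obtain ⟨V, hV⟩ := exists_sum_sq_inverse Z hZ
  have hV1 := congr_arg ofZ hV
  rw [ofZ_mul, ofZ_sum, ofZ_one] at hV1
  -- the antisymmetric part
  have hD : ∀ i j, ∃ γ, ofZ (Z i) * η j - ofZ (Z j) * η i = y * ofZ γ ∧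
      ofZ (Z i) * θ j - ofZ (Z j) * θ i = -(x * ofZ γ) := by
    intro i j
    set D := ofZ (Z i) * η j - ofZ (Z j) * η i with hDdef
    have hpD : p D = 0 := by
      simp only [hDdef, map_sub, Derivation.leibniz, smul_eq_mul, p_ofZ, mul_zero, add_zero]
      exact hpp i j
    have hqD : q D = ofZ (Z i) * q (η j) - ofZ (Z j) * q (η i) := by
      simp only [hDdef, map_sub, Derivation.leibniz, smul_eq_mul, q_ofZ, mul_zero, add_zero]
    -- Antisymmetrizing the weight relation cancels `σH`; since `p D = 0`, what remains is `-y q D =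
    -- -D`.
    have hyD : D = y * q D := by
      rw [hqD, hDdef]
      linear_combination -x * hpp i j + ofZ (Z i) * hH j - ofZ (Z j) * hH i
    have hpc : p (q D) = 0 := by rw [p_q_comm, hpD, map_zero]
    -- Applying `q` to `D = y q D` gives `y q(q D) = 0`. Hence `q D` is a function of `z` alone, the
    -- desired `γ`.
    have hqc : q (q D) = 0 := by
      apply eq_zero_of_y_mul
      have := congr_arg q hyD
      rw [Derivation.leibniz, q_y, smul_eq_mul, smul_eq_mul, mul_one] at this
      linear_combination -this
    obtain ⟨γ, hγ⟩ := exists_eq_ofZ hpc hqc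
    refine ⟨γ, by rw [← hγ]; exact hyD, ?_⟩
    rw [← hγ, hqD]
    linear_combination ofZ (Z i) * hX j - ofZ (Z j) * hX i
  choose γ hγη hγθ using hD
  -- The weighted averages `A`, `B` are the candidates for `∂f/∂x` and `∂f/∂y`; the terms with `b`
  -- measure how far `η` and `θ` are from multiples of them.
  set A := ofZ V * ∑ k, ofZ (Z k) * η k with hA
  set B := ofZ V * ∑ k, ofZ (Z k) * θ k with hB
  set b : κ → smooth ℝ := fun i => V * ∑ k, Z k * γ i k with hb
  have hηA : ∀ i, η i = ofZ (Z i) * A - y * ofZ (b i) := by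
    intro i
    have h1 : ∑ k, ofZ (Z k) * (ofZ (Z i) * η k - ofZ (Z k) * η i) =
        ∑ k, ofZ (Z k) * (y * ofZ (γ i k)) :=
      Finset.sum_congr rfl fun k _ => by rw [hγη]
    have h2 : ∑ k, ofZ (Z k) * (ofZ (Z i) * η k - ofZ (Z k) * η i) =
        ofZ (Z i) * ∑ k, ofZ (Z k) * η k - (∑ k, ofZ (Z k * Z k)) * η i := by
      rw [Finset.mul_sum, Finset.sum_mul, ← Finset.sum_sub_distrib]
      exact Finset.sum_congr rfl fun k _ => by rw [ofZ_mul]; ring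
    have h3 : ∑ k, ofZ (Z k) * (y * ofZ (γ i k)) = y * ∑ k, ofZ (Z k * γ i k) := by
      rw [Finset.mul_sum]
      exact Finset.sum_congr rfl fun k _ => by rw [ofZ_mul]; ring
    rw [hA, hb, ofZ_mul, ofZ_sum]
    linear_combination -η i * hV1 - ofZ V * (h2.symm.trans (h1.trans h3))
  have hθB : ∀ i, θ i = ofZ (Z i) * B + x * ofZ (b i) := by
    intro i
    have h1 : ∑ k, ofZ (Z k) * (ofZ (Z i) * θ k - ofZ (Z k) * θ i) =
        ∑ k, ofZ (Z k) * (-(x * ofZ (γ i k))) :=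
      Finset.sum_congr rfl fun k _ => by rw [hγθ]
    have h2 : ∑ k, ofZ (Z k) * (ofZ (Z i) * θ k - ofZ (Z k) * θ i) =
        ofZ (Z i) * ∑ k, ofZ (Z k) * θ k - (∑ k, ofZ (Z k * Z k)) * θ i := by
      rw [Finset.mul_sum, Finset.sum_mul, ← Finset.sum_sub_distrib]
      exact Finset.sum_congr rfl fun k _ => by rw [ofZ_mul]; ring
    have h3 : ∑ k, ofZ (Z k) * (-(x * ofZ (γ i k))) = -x * ∑ k, ofZ (Z k * γ i k) := by
      rw [Finset.mul_sum]
      exact Finset.sum_congr rfl fun k _ => by rw [ofZ_mul]; ring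
    rw [hB, hb, ofZ_mul, ofZ_sum]
    linear_combination -θ i * hV1 - ofZ V * (h2.symm.trans (h1.trans h3))
  clear_value A B b
  -- the curl
  have hg : ∀ i j, ofZ (Z i) * ofZ (Z j) * (p B - q A) + ofZ (Z i) * ofZ (b j) +
      ofZ (Z j) * ofZ (b i) ∈ constants := by
    intro i j
    have hpθ : p (θ j) = ofZ (Z j) * p B + ofZ (b j) := by
      rw [hθB j]
      simp only [map_add, Derivation.leibniz, smul_eq_mul, p_ofZ, p_x, mul_zero, add_zero,
        mul_one, zero_add]
    have hqη : q (η i) = ofZ (Z i) * q A - ofZ (b i) := by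
      rw [hηA i]
      simp only [map_sub, Derivation.leibniz, smul_eq_mul, q_ofZ, q_y, mul_zero, add_zero,
        mul_one, zero_add]
    convert hpq i j using 1
    rw [hpθ, hqη]
    ring
  -- On the diagonal `i = j`, differentiating the constant leaves `Z_k²` times the derivative of the
  -- curl, and the squares have no common zero.
  have hpu : p (p B - q A) = 0 := eq_zero_of_ofZ_sq_mul hZ fun k => by
    have := derivation_apply_constant (hg k k) p
    simp only [map_add, Derivation.leibniz, smul_eq_mul, p_ofZ, mul_zero, add_zero] at this
    exact this
  have hqu : q (p B - q A) = 0 := eq_zero_of_ofZ_sq_mul hZ fun k => by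
    have := derivation_apply_constant (hg k k) q
    simp only [map_add, Derivation.leibniz, smul_eq_mul, q_ofZ, mul_zero, add_zero] at this
    exact this
  obtain ⟨u, hu⟩ := exists_eq_ofZ hpu hqu
  -- Half of the curl is moved into each component: `(A + yh, B - xh)` is closed, and the
  -- corrections join the terms with `b`.
  obtain ⟨h, hh⟩ : ∃ h : smooth ℝ, u = h + h :=
    ⟨(1 / 2 : ℝ) • u, by rw [← add_smul]; norm_num⟩
  rw [hh, ofZ_add] at hu
  obtain ⟨f, hpf, hqf⟩ := exists_potential (A := A + y * ofZ h) (B := B - x * ofZ h) (by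
    simp only [map_add, map_sub, Derivation.leibniz, smul_eq_mul, p_ofZ, q_ofZ, p_x, q_y,
      mul_zero, zero_add, mul_one]
    linear_combination hu)
  refine ⟨f, fun k => b k + Z k * h, fun i j => ?_, fun k => ?_, fun k => ?_⟩
  · convert hg i j using 1
    rw [hu]
    simp only [ofZ_add, ofZ_mul]
    ring
  · rw [hpf, hηA k]
    simp only [ofZ_add, ofZ_mul]
    ring
  · rw [hqf, hθB k]
    simp only [ofZ_add, ofZ_mul]
    ring

/-- Up to a coboundary, a cocycle vanishes on `𝔰` and has the values `-y β k`, `x β k` at `Z k p`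
and `Z k q`. -/
theorem exists_plane_normal_form {κ : Type} [Fintype κ] {𝔥 : LieSubalgebra ℝ VF}
    (φ : Cocycle 𝔥) (Z : κ → smooth ℝ) (hZ : ∀ t : ℝ, ∃ k, (Z k).1 t ≠ 0)
    (hs : ∀ i, slGens i ∈ 𝔥) (hp : ∀ k, ofZ (Z k) • p ∈ 𝔥) (hq : ∀ k, ofZ (Z k) • q ∈ 𝔥) :
    ∃ (f : F) (β : κ → smooth ℝ),
      (∀ i j, ofZ (Z i * β j + Z j * β i) ∈ constants) ∧
      (∀ i, Rel (φ - cobdry 𝔥 f) (slGens i) 0) ∧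
      (∀ k, Rel (φ - cobdry 𝔥 f) (ofZ (Z k) • p) (-(ofZ (β k) * y))) ∧
      (∀ k, Rel (φ - cobdry 𝔥 f) (ofZ (Z k) • q) (ofZ (β k) * x)) := by
  obtain ⟨σH, hσH⟩ := exists_rel φ (hs 1)
  rw [slGens_one] at hσH
  obtain ⟨σX, hσX⟩ : ∃ σ, WeightRel φ σH 2 (x • q) σ :=
    exists_weightRel hσH (two_ne_zero) (hs 0) lie_H_X
  obtain ⟨σY, hσY⟩ : ∃ σ, WeightRel φ σH (-2) (y • p) σ :=
    exists_weightRel hσH (by norm_num : (-2 : ℝ) ≠ 0) (hs 2) lie_H_Y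
  choose η hη using fun k =>
    exists_weightRel hσH (by norm_num : (-1 : ℝ) ≠ 0) (hp k) (lie_H_p (Z k))
  choose θ hθ using fun k => exists_weightRel hσH (one_ne_zero) (hq k) (lie_H_q (Z k))
  -- The relation for `[xq, Z_k p] = -Z_k q`, stated for any cocycle because it is used both before
  -- and after the gauge transformation.
  have relX : ∀ {ψ : Cocycle 𝔥} {τ ξ α ζ : F} {k}, WeightRel ψ τ 2 (x • q) ξ →
      WeightRel ψ τ (-1) (ofZ (Z k) • p) α → WeightRel ψ τ 1 (ofZ (Z k) • q) ζ →
      x * q α - ofZ (Z k) * p ξ = -ζ := by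
    intro ψ τ ξ α ζ k h1 h2 h3
    have h4 := h1.lie h2 lie_H_X (lie_H_p (Z k))
    rw [lie_X_p, show (2 : ℝ) + -1 = 1 by norm_num] at h4
    exact h4.unique h3.neg one_ne_zero
  obtain ⟨f, β, hg, hfη, hfθ⟩ := exists_potential_of_relations Z hZ η θ σX σH
    (fun i j => by
      have h1 := (hη i).lie (hη j) (lie_H_p _) (lie_H_p _)
      rw [lie_p_p] at h1
      exact h1.unique (weightRel_zero φ σH _) (by norm_num))
    (fun i j => by
      have h1 := (hη i).lie (hθ j) (lie_H_p _) (lie_H_q _)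
      rw [lie_p_q] at h1
      simpa using h1.1.sub_mem (rel_zero φ))
    (fun i => relX hσX (hη i) (hθ i))
    (fun i => by
      have := (hη i).2
      rw [H_apply, smul_vf_apply, neg_smul, one_smul] at this
      exact this)
  set ψ := φ - cobdry 𝔥 f with hψ
  have hη' : ∀ k, WeightRel ψ (σH - H f) (-1) (ofZ (Z k) • p) (-(ofZ (β k) * y)) := by
    intro k
    rw [← hfη k]
    exact (hη k).sub_cobdry (lie_H_p _) f
  have hθ' : ∀ k, WeightRel ψ (σH - H f) 1 (ofZ (Z k) • q) (ofZ (β k) * x) := by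
    intro k
    rw [← hfθ k]
    exact (hθ k).sub_cobdry (lie_H_q _) f
  have hσX' := hσX.sub_cobdry lie_H_X f
  have hσY' := hσY.sub_cobdry lie_H_Y f
  have hσH' := hσH.sub_cobdry f
  rw [← hψ] at hσX' hσY' hσH'
  set τH := σH - H f
  set τX := σX - (x • q : VF) f
  set τY := σY - (y • p : VF) f
  -- The values `-yβ_k` and `xβ_k` already satisfy the relations with zero values on `𝔰`. So each
  -- relation reduces to `Z_k` times a derivative of one of `τH`, `τX`, `τY`.
  have hpH : p τH = 0 := eq_zero_of_ofZ_mul hZ fun k => by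
    have := (hη' k).2
    simp only [H_apply, smul_vf_apply, map_neg, Derivation.leibniz, smul_eq_mul, p_ofZ, q_ofZ,
      p_y, q_y, neg_smul, one_smul] at this
    linear_combination -this
  have hqH : q τH = 0 := eq_zero_of_ofZ_mul hZ fun k => by
    have := (hθ' k).2
    simp only [H_apply, smul_vf_apply, Derivation.leibniz, smul_eq_mul, p_ofZ, q_ofZ,
      p_x, q_x, one_smul] at this
    linear_combination -this
  have hpX : p τX = 0 := eq_zero_of_ofZ_mul hZ fun k => by
    have := relX hσX' (hη' k) (hθ' k)
    simp only [map_neg, Derivation.leibniz, smul_eq_mul, q_ofZ, q_y] at this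
    linear_combination -this
  have hqX : q τX = 0 := eq_zero_of_ofZ_mul hZ fun k => by
    have h1 := hσX'.lie (hθ' k) lie_H_X (lie_H_q (Z k))
    rw [lie_X_q] at h1
    have := h1.unique (weightRel_zero ψ τH _) (by norm_num)
    simp only [smul_vf_apply, Derivation.leibniz, smul_eq_mul, q_ofZ, q_x] at this
    linear_combination -this
  have hpY : p τY = 0 := eq_zero_of_ofZ_mul hZ fun k => by
    have h1 := hσY'.lie (hη' k) lie_H_Y (lie_H_p (Z k))
    rw [lie_Y_p] at h1
    have := h1.unique (weightRel_zero ψ τH _) (by norm_num)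
    simp only [smul_vf_apply, Derivation.leibniz, smul_eq_mul, p_ofZ, p_y, map_neg] at this
    linear_combination -this
  have hqY : q τY = 0 := eq_zero_of_ofZ_mul hZ fun k => by
    have h1 := hσY'.lie (hθ' k) lie_H_Y (lie_H_q (Z k))
    rw [lie_Y_q, show (-2 : ℝ) + 1 = -1 by norm_num] at h1
    have := h1.unique (hη' k).neg (by norm_num)
    simp only [smul_vf_apply, Derivation.leibniz, smul_eq_mul, p_ofZ, p_x] at this
    linear_combination -this
  -- In `H τX - xq τH = 2 τX` the left side now vanishes.
  have hX0 : τX = 0 := by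
    have := hσX'.2
    rw [H_apply, smul_vf_apply, hpX, hqX, hqH] at this
    have h2 : (2 : ℝ) • τX = 0 := by rw [← this]; ring
    exact (smul_eq_zero.1 h2).resolve_left two_ne_zero
  have hY0 : τY = 0 := by
    have := hσY'.2
    rw [H_apply, smul_vf_apply, hpY, hqY, hpH] at this
    have h2 : (-2 : ℝ) • τY = 0 := by rw [← this]; ring
    exact (smul_eq_zero.1 h2).resolve_left (by norm_num)
  rw [hX0] at hσX'
  rw [hY0] at hσY'
  refine ⟨f, β, hg, fun i => ?_, fun k => (hη' k).1, fun k => (hθ' k).1⟩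
  fin_cases i
  · exact hσX'.1
  -- `H` has weight zero and so no normalized representative; its value is obtained from `H = [xq,
  -- yp]`.
  · have := (hσX'.1.lie hσY'.1).congr lie_X_Y
    rw [map_zero, map_zero, sub_zero] at this
    exact this
  · exact hσY'.1

/-! ### Fibred vector fields and divergences -/

/-- The vector field with components `a`, `b`, `c`. -/
def fld (a b c : F) : VF := a • p + b • q + c • r

theorem fld_apply (a b c f : F) : fld a b c f = a * p f + b * q f + c * r f := rfl

theorem lie_fld (a b c a' b' c' : F) : ⁅fld a b c, fld a' b' c'⁆ =
    fld (fld a b c a' - fld a' b' c' a) (fld a b c b' - fld a' b' c' b)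
      (fld a b c c' - fld a' b' c' c) := Derivation.ext fun f => by
  simp only [Derivation.commutator_apply, fld_apply, map_add, Derivation.leibniz, smul_eq_mul,
    p_q_comm, p_r_comm, q_r_comm]
  ring

theorem fld_x (a b c : F) : fld a b c x = a := by simp [fld_apply]
theorem fld_y (a b c : F) : fld a b c y = b := by simp [fld_apply]
theorem fld_z (a b c : F) : fld a b c z = c := by simp [fld_apply]

/-- Vector fields that project to the `z`-axis. -/
def IsFibred (v : VF) : Prop := ∃ a b : F, ∃ K : smooth ℝ, v = fld a b (ofZ K)

/-- The divergence in the `(x, y)`-planes. -/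
def divPlane : VF →ₗ[ℝ] F where
  toFun v := p (v x) + q (v y)
  map_add' v w := by simp only [Derivation.add_apply, map_add]; ring
  map_smul' c v := by
    simp only [Derivation.smul_apply, Derivation.map_smul, smul_add, RingHom.id_apply]

/-- The divergence along the `z`-axis. -/
def divAxis : VF →ₗ[ℝ] F where
  toFun v := r (v z)
  map_add' v w := by simp only [Derivation.add_apply, map_add]
  map_smul' c v := by
    simp only [Derivation.smul_apply, Derivation.map_smul, RingHom.id_apply]

theorem divPlane_fld (a b c : F) : divPlane (fld a b c) = p a + q b := by
  change p (fld a b c x) + q (fld a b c y) = _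
  rw [fld_x, fld_y]

theorem divAxis_fld (a b c : F) : divAxis (fld a b c) = r c := by
  change r (fld a b c z) = _
  rw [fld_z]

/-- The `z`-components depend on `z` only, so the terms `p(c) r(a)` and `q(c) r(b)` that would spoil
the identity for a partial divergence vanish. -/
theorem divPlane_lie {v w : VF} (hv : IsFibred v) (hw : IsFibred w) :
    divPlane ⁅v, w⁆ = v (divPlane w) - w (divPlane v) := by
  obtain ⟨a, b, K, rfl⟩ := hv
  obtain ⟨a', b', K', rfl⟩ := hw
  simp only [lie_fld, divPlane_fld, fld_apply, map_add, map_sub, Derivation.leibniz, smul_eq_mul,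
    p_q_comm, p_r_comm, q_r_comm, p_ofZ, q_ofZ, map_zero]
  ring

theorem divAxis_lie {v w : VF} (hv : IsFibred v) (hw : IsFibred w) :
    divAxis ⁅v, w⁆ = v (divAxis w) - w (divAxis v) := by
  obtain ⟨a, b, K, rfl⟩ := hv
  obtain ⟨a', b', K', rfl⟩ := hw
  simp only [lie_fld, divAxis_fld, fld_apply, map_add, map_sub, Derivation.leibniz, smul_eq_mul,
    p_ofZ, q_ofZ, r_ofZ, map_zero]
  ring

/-- The field `ρ(z) r + τ(z) (xp + yq)`. -/
def fib (ρ τ : smooth ℝ) : VF := ofZ ρ • r + ofZ τ • E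

theorem fib_eq_fld (ρ τ : smooth ℝ) : fib ρ τ = fld (ofZ τ * x) (ofZ τ * y) (ofZ ρ) :=
  Derivation.ext fun f => by
    change ofZ ρ * r f + ofZ τ * E f = _
    rw [fld_apply, E_apply]
    ring

theorem fib_apply (ρ τ : smooth ℝ) (f : F) :
    fib ρ τ f = ofZ τ * (x * p f + y * q f) + ofZ ρ * r f := by
  rw [fib_eq_fld, fld_apply]
  ring

theorem fib_ofZ (ρ τ K : smooth ℝ) : fib ρ τ (ofZ K) = ofZ (ρ * dz K) := by
  rw [fib_apply, p_ofZ, q_ofZ, r_ofZ, ofZ_mul]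
  ring

/-- `fib` as a linear map. -/
def fibₗ : smooth ℝ × smooth ℝ →ₗ[ℝ] VF where
  toFun e := fib e.1 e.2
  map_add' e e' := Derivation.ext fun f => by
    simp only [Derivation.add_apply, fib_apply, Prod.fst_add, Prod.snd_add, ofZ_add]
    ring
  map_smul' c e := Derivation.ext fun f => by
    simp only [Derivation.smul_apply, fib_apply, Prod.smul_fst, Prod.smul_snd, ofZ_smul,
      smul_add, smul_mul_assoc, RingHom.id_apply]

/-- `K(z) p` as a linear map in `K`. -/
def pₗ : smooth ℝ →ₗ[ℝ] VF where
  toFun K := ofZ K • p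
  map_add' K L := Derivation.ext fun f => by
    simp only [Derivation.add_apply, smul_vf_apply, ofZ_add, add_mul]
  map_smul' c K := Derivation.ext fun f => smul_mul_assoc c (ofZ K) (p f)

/-- `K(z) q` as a linear map in `K`. -/
def qₗ : smooth ℝ →ₗ[ℝ] VF where
  toFun K := ofZ K • q
  map_add' K L := Derivation.ext fun f => by
    simp only [Derivation.add_apply, smul_vf_apply, ofZ_add, add_mul]
  map_smul' c K := Derivation.ext fun f => smul_mul_assoc c (ofZ K) (q f)

theorem X_eq_fld : x • q = fld 0 x 0 := Derivation.ext fun f => by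
  rw [fld_apply, smul_vf_apply]; ring

theorem H_eq_fld : H = fld x (-y) 0 := Derivation.ext fun f => by
  rw [fld_apply, H_apply]; ring

theorem Y_eq_fld : y • p = fld y 0 0 := Derivation.ext fun f => by
  rw [fld_apply, smul_vf_apply]; ring

theorem E_eq_fld : E = fld x y 0 := Derivation.ext fun f => by
  rw [fld_apply, E_apply]; ring

theorem smul_p_eq_fld (a : F) : a • p = fld a 0 0 := Derivation.ext fun f => by
  rw [fld_apply, smul_vf_apply]; ring

theorem smul_q_eq_fld (a : F) : a • q = fld 0 a 0 := Derivation.ext fun f => by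
  rw [fld_apply, smul_vf_apply]; ring

/-- The components of the members of `slGens`. -/
theorem slGens_eq_fld (i : Fin 3) : slGens i = fld (![0, x, y] i) (![x, -y, 0] i) 0 := by
  fin_cases i
  · exact X_eq_fld
  · exact H_eq_fld
  · exact Y_eq_fld

theorem lie_slGens_fib (i : Fin 3) (ρ τ : smooth ℝ) : ⁅slGens i, fib ρ τ⁆ = 0 :=
  Derivation.ext fun f => by
    rw [slGens_eq_fld, fib_eq_fld, lie_fld]
    fin_cases i <;> simp [fld_apply, Derivation.leibniz]

theorem lie_fib_p (ρ τ K : smooth ℝ) : ⁅fib ρ τ, ofZ K • p⁆ = ofZ (ρ * dz K - τ * K) • p := by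
  rw [fib_eq_fld, smul_p_eq_fld, smul_p_eq_fld, lie_fld]
  congr 1 <;> simp [fld_apply, Derivation.leibniz, mul_comm]

theorem lie_fib_q (ρ τ K : smooth ℝ) : ⁅fib ρ τ, ofZ K • q⁆ = ofZ (ρ * dz K - τ * K) • q := by
  rw [fib_eq_fld, smul_q_eq_fld, smul_q_eq_fld, lie_fld]
  congr 1 <;> simp [fld_apply, Derivation.leibniz, mul_comm]

theorem lie_fib_fib (ρ τ ρ' τ' : smooth ℝ) : ⁅fib ρ τ, fib ρ' τ'⁆ =
    fib (ρ * dz ρ' - ρ' * dz ρ) (ρ * dz τ' - ρ' * dz τ) := by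
  rw [fib_eq_fld, fib_eq_fld, fib_eq_fld, lie_fld]
  congr 1 <;> simp [fld_apply, Derivation.leibniz] <;> ring

/-! ### Bracket tables -/

theorem vf_neg_mem {S : Submodule ℝ VF} {v : VF} (h : v ∈ S) : -v ∈ S := by
  convert S.smul_mem (-1) h using 1
  exact Derivation.ext fun f => by simp

section Span

variable {ι κ : Type} {u : ι → VF} {w : κ → VF}

theorem span_le_span_elim_left :
    Submodule.span ℝ (Set.range u) ≤ Submodule.span ℝ (Set.range (Sum.elim u w)) := by
  rw [Set.Sum.elim_range]
  exact Submodule.span_mono Set.subset_union_left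

theorem span_le_span_elim_right :
    Submodule.span ℝ (Set.range w) ≤ Submodule.span ℝ (Set.range (Sum.elim u w)) := by
  rw [Set.Sum.elim_range]
  exact Submodule.span_mono Set.subset_union_right

theorem lie_elim_mem_span
    (huu : ∀ i j, ⁅u i, u j⁆ ∈ Submodule.span ℝ (Set.range (Sum.elim u w)))
    (huw : ∀ i k, ⁅u i, w k⁆ ∈ Submodule.span ℝ (Set.range (Sum.elim u w)))
    (hww : ∀ k l, ⁅w k, w l⁆ ∈ Submodule.span ℝ (Set.range (Sum.elim u w))) (i j : ι ⊕ κ) :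
    ⁅Sum.elim u w i, Sum.elim u w j⁆ ∈ Submodule.span ℝ (Set.range (Sum.elim u w)) := by
  rcases i with i | k <;> rcases j with j | l
  · exact huu i j
  · exact huw i l
  · change ⁅w k, u j⁆ ∈ _
    rw [vf_lie_skew]
    exact vf_neg_mem (huw j k)
  · exact hww k l

end Span

theorem lie_slGens_slGens (i j : Fin 3) :
    ⁅slGens i, slGens j⁆ ∈ Submodule.span ℝ (Set.range slGens) := by
  have h0 : x • q ∈ Submodule.span ℝ (Set.range slGens) := Submodule.subset_span ⟨0, rfl⟩
  have h1 : H ∈ Submodule.span ℝ (Set.range slGens) := Submodule.subset_span ⟨1, rfl⟩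
  have h2 : y • p ∈ Submodule.span ℝ (Set.range slGens) := Submodule.subset_span ⟨2, rfl⟩
  have h10 : ⁅H, x • q⁆ ∈ Submodule.span ℝ (Set.range slGens) := by
    rw [lie_H_X]; exact Submodule.smul_mem _ _ h0
  have h12 : ⁅H, y • p⁆ ∈ Submodule.span ℝ (Set.range slGens) := by
    rw [lie_H_Y]; exact Submodule.smul_mem _ _ h2
  have h02 : ⁅x • q, y • p⁆ ∈ Submodule.span ℝ (Set.range slGens) := by
    rw [lie_X_Y]; exact h1
  have hself : ∀ v : VF, ⁅v, v⁆ ∈ Submodule.span ℝ (Set.range slGens) := by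
    intro v
    have : ⁅v, v⁆ = 0 := Derivation.ext fun f => by simp [Derivation.commutator_apply]
    rw [this]; exact zero_mem _
  have hskew : ∀ {v w : VF}, ⁅v, w⁆ ∈ Submodule.span ℝ (Set.range slGens) →
      ⁅w, v⁆ ∈ Submodule.span ℝ (Set.range slGens) := by
    intro v w h
    rw [vf_lie_skew]; exact vf_neg_mem h
  fin_cases i <;> fin_cases j
  exacts [hself _, hskew h10, h02, h10, hself _, h12, hskew h02, hskew h12, hself _]

section Plane

variable {κ : Type} (Z : κ → smooth ℝ)

theorem smul_p_mem_span {K : smooth ℝ} (h : K ∈ Submodule.span ℝ (Set.range Z)) :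
    ofZ K • p ∈ Submodule.span ℝ (Set.range (planeGens Z)) := by
  have h1 := Submodule.mem_map_of_mem (f := pₗ) h
  rw [Submodule.map_span, ← Set.range_comp] at h1
  exact span_le_span_elim_left h1

theorem smul_q_mem_span {K : smooth ℝ} (h : K ∈ Submodule.span ℝ (Set.range Z)) :
    ofZ K • q ∈ Submodule.span ℝ (Set.range (planeGens Z)) := by
  have h1 := Submodule.mem_map_of_mem (f := qₗ) h
  rw [Submodule.map_span, ← Set.range_comp] at h1
  exact span_le_span_elim_right h1

theorem lie_slGens_planeGens (i : Fin 3) (k : κ ⊕ κ) :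
    ⁅slGens i, planeGens Z k⁆ ∈ Submodule.span ℝ (Set.range (planeGens Z)) := by
  have hp : ∀ k, ofZ (Z k) • p ∈ Submodule.span ℝ (Set.range (planeGens Z)) := fun k =>
    Submodule.subset_span ⟨Sum.inl k, rfl⟩
  have hq : ∀ k, ofZ (Z k) • q ∈ Submodule.span ℝ (Set.range (planeGens Z)) := fun k =>
    Submodule.subset_span ⟨Sum.inr k, rfl⟩
  rcases k with k | k
  · change ⁅slGens i, ofZ (Z k) • p⁆ ∈ _
    fin_cases i
    · change ⁅x • q, ofZ (Z k) • p⁆ ∈ _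
      rw [lie_X_p]; exact vf_neg_mem (hq k)
    · change ⁅H, ofZ (Z k) • p⁆ ∈ _
      rw [lie_H_p]; exact Submodule.smul_mem _ _ (hp k)
    · change ⁅y • p, ofZ (Z k) • p⁆ ∈ _
      rw [lie_Y_p]; exact zero_mem _
  · change ⁅slGens i, ofZ (Z k) • q⁆ ∈ _
    fin_cases i
    · change ⁅x • q, ofZ (Z k) • q⁆ ∈ _
      rw [lie_X_q]; exact zero_mem _
    · change ⁅H, ofZ (Z k) • q⁆ ∈ _
      rw [lie_H_q]; exact Submodule.smul_mem _ _ (hq k)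
    · change ⁅y • p, ofZ (Z k) • q⁆ ∈ _
      rw [lie_Y_q]; exact vf_neg_mem (hp k)

theorem lie_planeGens_planeGens (k l : κ ⊕ κ) : ⁅planeGens Z k, planeGens Z l⁆ = 0 := by
  rcases k with k | k <;> rcases l with l | l
  · exact lie_p_p _ _
  · exact lie_p_q _ _
  · change ⁅ofZ (Z k) • q, ofZ (Z l) • p⁆ = 0
    rw [vf_lie_skew, lie_p_q]
    exact Derivation.ext fun f => by simp
  · exact lie_q_q _ _

theorem lie_slGens_elim_planeGens (i j : Fin 3 ⊕ (κ ⊕ κ)) :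
    ⁅Sum.elim slGens (planeGens Z) i, Sum.elim slGens (planeGens Z) j⁆ ∈
      Submodule.span ℝ (Set.range (Sum.elim slGens (planeGens Z))) :=
  lie_elim_mem_span (fun i j => span_le_span_elim_left (lie_slGens_slGens i j))
    (fun i k => span_le_span_elim_right (lie_slGens_planeGens Z i k))
    (fun k l => by rw [lie_planeGens_planeGens]; exact zero_mem _) i j

variable {J : Type} (e : J → smooth ℝ × smooth ℝ)

theorem fib_mem_span {ρ τ : smooth ℝ} (h : (ρ, τ) ∈ Submodule.span ℝ (Set.range e)) :
    fib ρ τ ∈ Submodule.span ℝ (Set.range fun j => fib (e j).1 (e j).2) := by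
  have h1 := Submodule.mem_map_of_mem (f := fibₗ) h
  rw [Submodule.map_span, ← Set.range_comp] at h1
  exact h1

/-- The generators `𝔰`, `Z k p`, `Z k q`, and the fields `ρ r + τ (xp + yq)` with `(ρ, τ)` in the
family `e`. -/
abbrev fibGens : Fin 3 ⊕ ((κ ⊕ κ) ⊕ J) → VF :=
  Sum.elim slGens (Sum.elim (planeGens Z) fun j => fib (e j).1 (e j).2)

theorem lie_fibGens
    (hZ : ∀ j k, (e j).1 * dz (Z k) - (e j).2 * Z k ∈ Submodule.span ℝ (Set.range Z))
    (he : ∀ i j, ((e i).1 * dz (e j).1 - (e j).1 * dz (e i).1,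
      (e i).1 * dz (e j).2 - (e j).1 * dz (e i).2) ∈ Submodule.span ℝ (Set.range e))
    (i j : Fin 3 ⊕ ((κ ⊕ κ) ⊕ J)) :
    ⁅fibGens Z e i, fibGens Z e j⁆ ∈ Submodule.span ℝ (Set.range (fibGens Z e)) := by
  refine lie_elim_mem_span (fun i j => span_le_span_elim_left (lie_slGens_slGens i j)) ?_ ?_ i j
  · rintro i (k | j)
    · exact span_le_span_elim_right (span_le_span_elim_left (lie_slGens_planeGens Z i k))
    · change ⁅slGens i, fib (e j).1 (e j).2⁆ ∈ _
      rw [lie_slGens_fib]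
      exact zero_mem _
  · refine fun k l => span_le_span_elim_right (lie_elim_mem_span ?_ ?_ ?_ k l)
    · intro k l
      rw [lie_planeGens_planeGens]
      exact zero_mem _
    · intro k j
      rw [vf_lie_skew]
      refine vf_neg_mem (span_le_span_elim_left ?_)
      rcases k with k | k
      · change ⁅fib (e j).1 (e j).2, ofZ (Z k) • p⁆ ∈ _
        rw [lie_fib_p]
        exact smul_p_mem_span Z (hZ j k)
      · change ⁅fib (e j).1 (e j).2, ofZ (Z k) • q⁆ ∈ _
        rw [lie_fib_q]
        exact smul_q_mem_span Z (hZ j k)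
    · intro i j
      rw [lie_fib_fib]
      exact span_le_span_elim_right (fib_mem_span e (he i j))

end Plane

/-! ### The projective algebra -/

theorem projGens_eq_fld (i : Fin 8) : projGens i =
    fld (![1, 0, x, 0, 0, y, x ^ 2, x * y] i) (![0, 1, 0, y, x, 0, x * y, y ^ 2] i) 0 := by
  fin_cases i <;> refine Derivation.ext fun f => ?_ <;> rw [fld_apply]
  · change p f = 1 * p f + 0 * q f + 0 * r f; ring
  · change q f = 0 * p f + 1 * q f + 0 * r f; ring
  · change x * p f = x * p f + 0 * q f + 0 * r f; ring
  · change y * q f = 0 * p f + y * q f + 0 * r f; ring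
  · change x * q f = 0 * p f + x * q f + 0 * r f; ring
  · change y * p f = y * p f + 0 * q f + 0 * r f; ring
  · change x ^ 2 * p f + x * y * q f = x ^ 2 * p f + x * y * q f + 0 * r f; ring
  · change x * y * p f + y ^ 2 * q f = x * y * p f + y ^ 2 * q f + 0 * r f; ring

/-- The linear combination of `projGens` with the coefficients `a`. -/
def projField (a : Fin 8 → ℝ) : VF :=
  let c : Fin 8 → F := fun i => algebraMap ℝ F (a i)
  fld (c 0 + c 2 * x + c 5 * y + c 6 * x ^ 2 + c 7 * (x * y))
    (c 1 + c 3 * y + c 4 * x + c 6 * (x * y) + c 7 * y ^ 2) 0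

theorem projField_eq_sum (a : Fin 8 → ℝ) : projField a = ∑ i, a i • projGens i :=
  Derivation.ext fun f => by
    have h : ∀ i, (a i • projGens i) f = algebraMap ℝ F (a i) * projGens i f := fun i => by
      rw [Derivation.smul_apply, Algebra.smul_def]
    simp only [Fin.sum_univ_eight, Derivation.add_apply, h]
    simp only [projGens_eq_fld, projField, fld_apply]
    simp
    ring

/-- One computation with indeterminate coefficients replaces a table of sixty-four brackets. -/
theorem lie_projField (a b : Fin 8 → ℝ) : ⁅projField a, projField b⁆ = projField
    ![a 0 * b 2 + a 1 * b 5 - (b 0 * a 2 + b 1 * a 5),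
      a 0 * b 4 + a 1 * b 3 - (b 0 * a 4 + b 1 * a 3),
      2 * a 0 * b 6 + a 1 * b 7 + a 4 * b 5 - (2 * b 0 * a 6 + b 1 * a 7 + b 4 * a 5),
      a 0 * b 6 + a 5 * b 4 + 2 * a 1 * b 7 - (b 0 * a 6 + b 5 * a 4 + 2 * b 1 * a 7),
      a 2 * b 4 + a 1 * b 6 + a 4 * b 3 - (b 2 * a 4 + b 1 * a 6 + b 4 * a 3),
      a 0 * b 7 + a 5 * b 2 + a 3 * b 5 - (b 0 * a 7 + b 5 * a 2 + b 3 * a 5),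
      a 2 * b 6 - a 6 * b 2 + a 4 * b 7 - a 7 * b 4,
      a 5 * b 6 - a 6 * b 5 + a 3 * b 7 - a 7 * b 3] := by
  have h2 : algebraMap ℝ F 2 = 2 := map_ofNat _ 2
  simp only [projField, lie_fld]
  congr 1 <;>
    simp [fld_apply, Derivation.leibniz, Derivation.leibniz_pow, h2] <;> ring

theorem lie_projGens (i j : Fin 8) :
    ⁅projGens i, projGens j⁆ ∈ Submodule.span ℝ (Set.range projGens) := by
  have h : ∀ i, projGens i = projField (Pi.single i 1) := fun i => by
    rw [projField_eq_sum, Finset.sum_eq_single i]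
    · rw [Pi.single_eq_same, one_smul]
    · intro j _ hj
      rw [Pi.single_eq_of_ne hj, zero_smul]
    · simp
  rw [h i, h j, lie_projField, projField_eq_sum]
  exact Submodule.sum_mem _ fun k _ => Submodule.smul_mem _ _ (Submodule.subset_span ⟨k, rfl⟩)

theorem lie_projGens_fib (i : Fin 8) (ρ : smooth ℝ) : ⁅projGens i, fib ρ 0⁆ = 0 := by
  rw [projGens_eq_fld, fib_eq_fld, lie_fld]
  fin_cases i <;> refine Derivation.ext fun f => ?_ <;>
    simp [fld_apply, Derivation.leibniz, Derivation.leibniz_pow]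

/-- The generators `projGens`, and the fields `ρ r` with `ρ` in the family `e`. -/
abbrev projFibGens {J : Type} (e : J → smooth ℝ) : Fin 8 ⊕ J → VF :=
  Sum.elim projGens fun j => fib (e j) 0

theorem lie_projFibGens {J : Type} (e : J → smooth ℝ)
    (he : ∀ i j, e i * dz (e j) - e j * dz (e i) ∈ Submodule.span ℝ (Set.range e))
    (i j : Fin 8 ⊕ J) :
    ⁅projFibGens e i, projFibGens e j⁆ ∈ Submodule.span ℝ (Set.range (projFibGens e)) := by
  refine lie_elim_mem_span (fun i j => span_le_span_elim_left (lie_projGens i j)) ?_ ?_ i j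
  · intro i k
    rw [lie_projGens_fib]
    exact zero_mem _
  · intro k l
    rw [lie_fib_fib, map_zero, mul_zero, mul_zero, sub_zero]
    have h1 := Submodule.mem_map_of_mem (f := fibₗ ∘ₗ LinearMap.inl ℝ _ _) (he k l)
    rw [Submodule.map_span, ← Set.range_comp] at h1
    exact span_le_span_elim_right h1

/-! ### Membership in `expFields` and fibredness -/

theorem fld_mem_expFields (a b c : F) : fld a b c ∈ expFields :=
  add_mem (add_mem (Submodule.smul_mem _ _ p_mem_expFields)
    (Submodule.smul_mem _ _ q_mem_expFields)) (Submodule.smul_mem _ _ r_mem_expFields)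

theorem IsFibred.mem_expFields {v : VF} (h : IsFibred v) : v ∈ expFields := by
  obtain ⟨a, b, K, rfl⟩ := h
  exact fld_mem_expFields _ _ _

theorem isFibred_slGens (i : Fin 3) : IsFibred (slGens i) :=
  ⟨_, _, 0, slGens_eq_fld i⟩

theorem isFibred_projGens (i : Fin 8) : IsFibred (projGens i) :=
  ⟨_, _, 0, projGens_eq_fld i⟩

theorem isFibred_planeGens {κ : Type} (Z : κ → smooth ℝ) (k : κ ⊕ κ) :
    IsFibred (planeGens Z k) := by
  rcases k with k | k
  · exact ⟨_, _, 0, smul_p_eq_fld _⟩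
  · exact ⟨_, _, 0, smul_q_eq_fld _⟩

theorem isFibred_fib (ρ τ : smooth ℝ) : IsFibred (fib ρ τ) :=
  ⟨_, _, _, fib_eq_fld ρ τ⟩

theorem isFibred_fibGens {κ J : Type} (Z : κ → smooth ℝ) (e : J → smooth ℝ × smooth ℝ)
    (i : Fin 3 ⊕ ((κ ⊕ κ) ⊕ J)) : IsFibred (fibGens Z e i) := by
  rcases i with i | k | j
  · exact isFibred_slGens i
  · exact isFibred_planeGens Z k
  · exact isFibred_fib _ _

theorem isFibred_projFibGens {J : Type} (e : J → smooth ℝ) (i : Fin 8 ⊕ J) :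
    IsFibred (projFibGens e i) := by
  rcases i with i | j
  · exact isFibred_projGens i
  · exact isFibred_fib _ _

/-! ### Functions of one variable -/

/-- The coordinate function on the line. -/
def zz : smooth ℝ := axis z

theorem ofZ_zz : ofZ zz = z := rfl

@[simp] theorem dz_zz : dz zz = 1 := ofZ_injective (by rw [← r_ofZ, ofZ_zz, r_z, ofZ_one])

@[simp] theorem dz_one : dz 1 = 0 := ofZ_injective (by
  rw [← r_ofZ, ofZ_one, Derivation.map_one_eq_zero, ofZ_zero])

theorem exists_eq_smul_one {K : smooth ℝ} (h : dz K = 0) : ∃ c : ℝ, K = c • 1 := by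
  obtain ⟨c, hc⟩ := mem_constants.1 (ofZ_mem_constants_iff.2 h)
  exact ⟨c, ofZ_injective hc⟩

theorem ofZ_smul_one_mem (c : ℝ) : ofZ (c • 1) ∈ constants := smul_one_mem_constants c

theorem exists_dz_sub_eq_zero {K : smooth ℝ} (h : dz (dz K) = 0) :
    ∃ c : ℝ, dz (K - c • zz) = 0 := by
  obtain ⟨c, hc⟩ := exists_eq_smul_one h
  exact ⟨c, by rw [map_sub, map_smul, dz_zz, hc, sub_self]⟩

theorem smul_eq_zero_of_ne {V : Type*} [AddCommGroup V] [Module ℝ V] {c : ℝ} {v : V}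
    (h : c • v = 0) (hc : c ≠ 0) : v = 0 := (smul_eq_zero.1 h).resolve_left hc

/-- If `Z₁ β₁`, `Z₂ β₂` and `Z₁ β₂ + Z₂ β₁` are constant and `Z₁`, `Z₂` are independent, then these
constants vanish. -/
theorem constants_eq_zero_of_independent {Z₁ Z₂ β₁ β₂ : smooth ℝ} {c₁ c₂ g : ℝ}
    (hind : ∀ a b : ℝ, a • Z₁ + b • Z₂ = 0 → a = 0 ∧ b = 0)
    (h₁ : Z₁ * β₁ = c₁ • 1) (h₂ : Z₂ * β₂ = c₂ • 1) (h : Z₁ * β₂ + Z₂ * β₁ = g • 1) :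
    c₁ = 0 ∧ c₂ = 0 ∧ g = 0 := by
  simp only [Algebra.smul_def, mul_one] at h₁ h₂ h
  obtain ⟨w, hw⟩ : ∃ w, w = Z₁ * β₂ - Z₂ * β₁ := ⟨_, rfl⟩
  -- The identity `(u - v)² = (u + v)² - 4uv` with `u = Z₁β₂`, `v = Z₂β₁`, where `uv = (Z₁β₁)(Z₂β₂)
  -- = c₁c₂`.
  have hsq : w * w = algebraMap ℝ (smooth ℝ) (g * g - 4 * (c₁ * c₂)) := by
    rw [hw, map_sub, map_mul, map_mul, map_mul, ← h₁, ← h₂, ← h,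
      show algebraMap ℝ (smooth ℝ) 4 = 4 from map_ofNat _ 4]
    ring
  have hdz : ∀ c : ℝ, dz (algebraMap ℝ (smooth ℝ) c) = 0 := fun c => by
    rw [Algebra.algebraMap_eq_smul_one, map_smul, dz_one, smul_zero]
  -- A smooth function with constant square is constant: if the square is nonzero it can be
  -- cancelled, and otherwise `w = 0`. Thus `Z₁β₂` and `Z₂β₁` are separately constant.
  have hdw : dz w = 0 := by
    have h0 : w * dz w + w * dz w = 0 := by rw [← dz_mul, hsq, hdz]
    have h1 : (w * w) * dz w = 0 := by
      have : (2 : ℝ) • ((w * w) * dz w) = 0 := by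
        rw [two_smul]
        linear_combination w * h0
      exact smul_eq_zero_of_ne this two_ne_zero
    rw [hsq, ← Algebra.smul_def] at h1
    rcases smul_eq_zero.1 h1 with h2 | h2
    · rw [h2, map_zero] at hsq
      have : w = 0 := Subtype.ext (funext fun t =>
        mul_self_eq_zero.1 (congr_fun (congr_arg Subtype.val hsq) t))
      rw [this, map_zero]
    · exact h2
  obtain ⟨k, hk⟩ := exists_eq_smul_one hdw
  rw [Algebra.smul_def, mul_one] at hk
  have h2 : algebraMap ℝ (smooth ℝ) (1 / 2) * 2 = 1 := by
    rw [← map_ofNat (algebraMap ℝ (smooth ℝ)) 2, ← map_mul]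
    norm_num
  obtain ⟨a, ha⟩ : ∃ a : ℝ, Z₁ * β₂ = algebraMap ℝ _ a := ⟨1 / 2 * (g + k), by
    rw [map_mul, map_add, ← h, ← hk, hw]
    linear_combination (-Z₁ * β₂) * h2⟩
  obtain ⟨b, hb⟩ : ∃ b : ℝ, Z₂ * β₁ = algebraMap ℝ _ b := ⟨1 / 2 * (g - k), by
    rw [map_mul, map_sub, ← h, ← hk, hw]
    linear_combination (-Z₂ * β₁) * h2⟩
  -- The combination `d Z₁ - c Z₂` is annihilated by `β`. If `c` or `d` is nonzero, multiplying by
  -- `Z₁` or `Z₂` makes that combination vanish, against independence.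
  have key : ∀ {c d : ℝ} {β : smooth ℝ}, Z₁ * β = algebraMap ℝ _ c → Z₂ * β = algebraMap ℝ _ d →
      c = 0 ∧ d = 0 := by
    intro c d β hc hd
    have h0 : β * (d • Z₁ + (-c) • Z₂) = 0 := by
      rw [Algebra.smul_def, Algebra.smul_def, map_neg, ← hc, ← hd]
      ring
    constructor
    · by_contra hne
      have h3 : c • (d • Z₁ + (-c) • Z₂) = 0 := by
        rw [Algebra.smul_def, ← hc, mul_assoc, h0, mul_zero]
      exact hne (neg_eq_zero.1 (hind _ _ (smul_eq_zero_of_ne h3 hne)).2)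
    · by_contra hne
      have h3 : d • (d • Z₁ + (-c) • Z₂) = 0 := by
        rw [Algebra.smul_def, ← hd, mul_assoc, h0, mul_zero]
      exact hne (hind _ _ (smul_eq_zero_of_ne h3 hne)).1
  obtain ⟨hc₁, hb0⟩ := key h₁ hb
  obtain ⟨ha0, hc₂⟩ := key ha h₂
  refine ⟨hc₁, hc₂, ?_⟩
  rw [ha, hb, ha0, hb0, ← map_add, add_zero] at h
  exact ((algebraMap ℝ (smooth ℝ)).injective h).symm

theorem eq_zero_of_pairwise_independent {κ : Type} [Fintype κ] [Nontrivial κ]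
    {Z β : κ → smooth ℝ} (hZ : ∀ t : ℝ, ∃ k, (Z k).1 t ≠ 0)
    (hind : ∀ i j, i ≠ j → ∀ a b : ℝ, a • Z i + b • Z j = 0 → a = 0 ∧ b = 0)
    (hβ : ∀ i j, ofZ (Z i * β j + Z j * β i) ∈ constants) (k : κ) : β k = 0 := by
  have hdz : ∀ i j, ∃ g : ℝ, Z i * β j + Z j * β i = g • 1 := fun i j =>
    exists_eq_smul_one (ofZ_mem_constants_iff.1 (hβ i j))
  have hdiag : ∀ i, ∃ c : ℝ, Z i * β i = c • 1 := fun i => by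
    obtain ⟨g, hg⟩ := hdz i i
    refine ⟨1 / 2 * g, ?_⟩
    rw [mul_smul, ← hg, ← two_smul ℝ, ← mul_smul]
    norm_num
  have hall : ∀ i j, i ≠ j → Z i * β i = 0 ∧ Z i * β j + Z j * β i = 0 := by
    intro i j hij
    obtain ⟨g, hg⟩ := hdz i j
    obtain ⟨c, hc⟩ := hdiag i
    obtain ⟨d, hd⟩ := hdiag j
    obtain ⟨h1, -, h3⟩ := constants_eq_zero_of_independent (hind i j hij) hc hd hg
    rw [hc, hg, h1, h3]
    simp
  have hii : ∀ i, Z i * β i = 0 := fun i => by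
    obtain ⟨j, hj⟩ := exists_ne i
    exact (hall i j hj.symm).1
  refine ofZ_eq_zero.1 (eq_zero_of_ofZ_sq_mul hZ fun i => ?_)
  rw [← ofZ_mul, ← ofZ_mul, ofZ_eq_zero]
  by_cases hik : i = k
  · rw [hik, mul_assoc, hii, mul_zero]
  -- Multiplying `Z_i β_k + Z_k β_i = 0` by `Z_i` and using `Z_i β_i = 0` gives `Z_i² β_k = 0`.
  · linear_combination Z i * (hall i k hik).2 - Z k * hii i

/-! ### Values at the fields `ρ r + τ (xp + yq)` -/

section Fib

variable {𝔥 : LieSubalgebra ℝ VF} {φ : Cocycle 𝔥}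

theorem fib_zero_one : fib 0 1 = E := Derivation.ext fun f => by
  rw [fib_apply, E_apply, ofZ_one, ofZ_zero]; ring

theorem fib_one_zero : fib 1 0 = r := Derivation.ext fun f => by
  rw [fib_apply, ofZ_one, ofZ_zero]; ring

theorem slGens_ofZ (i : Fin 3) (G : smooth ℝ) : slGens i (ofZ G) = 0 := by
  rw [slGens_eq_fld, fld_apply]
  simp

theorem planeGens_ofZ {κ : Type} (Z : κ → smooth ℝ) (k : κ ⊕ κ) (G : smooth ℝ) :
    planeGens Z k (ofZ G) = 0 := by
  rcases k with k | k
  · change ofZ (Z k) * p (ofZ G) = 0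
    rw [p_ofZ, mul_zero]
  · change ofZ (Z k) * q (ofZ G) = 0
    rw [q_ofZ, mul_zero]

theorem projGens_ofZ (i : Fin 8) (G : smooth ℝ) : projGens i (ofZ G) = 0 := by
  rw [projGens_eq_fld, fld_apply]
  simp

theorem Rel.sub_cobdry_ofZ {w : VF} {η : F} (h : Rel φ w η) {G : smooth ℝ} (hw : w (ofZ G) = 0) :
    Rel (φ - cobdry 𝔥 (ofZ G)) w η := by
  simpa [hw] using h.sub_cobdry (ofZ G)

theorem Rel.zero_of_mem {w : VF} {η : F} (h : Rel φ w η) (hη : η ∈ constants) : Rel φ w 0 :=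
  h.of_sub_mem (by simpa using hη)

theorem Rel.mem_constants_of_zero {η : F} (h : Rel φ 0 η) : η ∈ constants := by
  simpa using h.sub_mem (rel_zero φ)

theorem exists_eq_ofZ_of_slGens {f : F} (h : ∀ i, slGens i f ∈ constants) : ∃ K, f = ofZ K :=
  exists_eq_ofZ (eq_zero_of_y_mul_mem_constants (h 2)) (eq_zero_of_x_mul_mem_constants (h 0))

/-- The field commutes with `𝔰`, where the cocycle vanishes. So `xq` and `yp` send its value to
constants, which forces dependence on `z` alone. -/
theorem exists_rel_fib (hs : ∀ i, Rel φ (slGens i) 0) {ρ τ : smooth ℝ} (h : fib ρ τ ∈ 𝔥) :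
    ∃ K, Rel φ (fib ρ τ) (ofZ K) := by
  obtain ⟨ε, hε⟩ := exists_rel φ h
  obtain ⟨K, rfl⟩ := exists_eq_ofZ_of_slGens (f := ε) fun i => by
    have h1 := (hs i).lie hε
    rw [lie_slGens_fib, map_zero, sub_zero] at h1
    exact h1.mem_constants_of_zero
  exact ⟨K, hε⟩

theorem Rel.lie_fib {ρ τ ρ' τ' K K' : smooth ℝ} (h : Rel φ (fib ρ τ) (ofZ K))
    (h' : Rel φ (fib ρ' τ') (ofZ K')) :
    Rel φ (fib (ρ * dz ρ' - ρ' * dz ρ) (ρ * dz τ' - ρ' * dz τ))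
      (ofZ (ρ * dz K' - ρ' * dz K)) := by
  have h1 := h.lie h'
  rw [lie_fib_fib, fib_ofZ, fib_ofZ] at h1
  exact h1

theorem Rel.sub_cobdry_fib {ρ τ K : smooth ℝ} (h : Rel φ (fib ρ τ) (ofZ K)) (G : smooth ℝ) :
    Rel (φ - cobdry 𝔥 (ofZ G)) (fib ρ τ) (ofZ (K - ρ * dz G)) := by
  have h1 := h.sub_cobdry (ofZ G)
  rwa [fib_ofZ] at h1

theorem rel_fib_zero {v : VF} : Rel φ v (ofZ 0) ↔ Rel φ v 0 := Iff.rfl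

variable {ι : Type} {w : ι → VF} {η : ι → F}

/-- Gauge by a primitive in `z` of the value at `r`; functions of `z` do not disturb the values at
`w` and `𝔰`. -/
theorem exists_gauge_r (hw : ∀ i G, w i (ofZ G) = 0) (h : ∀ i, Rel φ (w i) (η i))
    (hs : ∀ i, Rel φ (slGens i) 0) (hr : fib 1 0 ∈ 𝔥) :
    ∃ f, (∀ i, Rel (φ - cobdry 𝔥 f) (w i) (η i)) ∧
      (∀ i, Rel (φ - cobdry 𝔥 f) (slGens i) 0) ∧ Rel (φ - cobdry 𝔥 f) (fib 1 0) 0 := by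
  obtain ⟨K, hK⟩ := exists_rel_fib hs hr
  obtain ⟨G, rfl⟩ := exists_dz_eq K
  refine ⟨ofZ G, fun i => (h i).sub_cobdry_ofZ (hw i G),
    fun i => (hs i).sub_cobdry_ofZ (slGens_ofZ i G), ?_⟩
  simpa using hK.sub_cobdry_fib G

theorem sub_cobdry_sub_cobdry (f g : F) :
    φ - cobdry 𝔥 f - cobdry 𝔥 g = φ - cobdry 𝔥 (f + g) := by
  rw [sub_sub, ← map_add]
  rfl

/-- Once the value at `r` is zero, `[r, zr + τE] = r` makes the derivative of the value `K`
constant, so `K` is `cz` up to a constant. -/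
theorem exists_gauge_zr (hw : ∀ i G, w i (ofZ G) = 0) (h : ∀ i, Rel φ (w i) (η i))
    (hs : ∀ i, Rel φ (slGens i) 0) (hr : fib 1 0 ∈ 𝔥) {τ : smooth ℝ} (hτ : dz τ = 0)
    (hz : fib zz τ ∈ 𝔥) :
    ∃ f, (∀ i, Rel (φ - cobdry 𝔥 f) (w i) (η i)) ∧
      (∀ i, Rel (φ - cobdry 𝔥 f) (slGens i) 0) ∧ Rel (φ - cobdry 𝔥 f) (fib 1 0) 0 ∧
      Rel (φ - cobdry 𝔥 f) (fib zz τ) 0 := by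
  obtain ⟨f, h1, h2, h3⟩ := exists_gauge_r hw h hs hr
  obtain ⟨K, hK⟩ := exists_rel_fib h2 hz
  have h4 := (rel_fib_zero.2 h3).lie_fib hK
  simp only [dz_zz, dz_one, hτ, map_zero, mul_one, mul_zero, sub_zero, one_mul] at h4
  have h5 := h4.sub_mem h3
  rw [sub_zero, ofZ_mem_constants_iff] at h5
  obtain ⟨c, hc⟩ := exists_dz_sub_eq_zero h5
  -- The coboundary of `cz` is `cz` at `zr + τE` and the constant `c` at `r`, so it removes the
  -- first value and keeps the second trivial.
  refine ⟨f + ofZ (c • zz), ?_⟩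
  rw [← sub_cobdry_sub_cobdry]
  refine ⟨fun i => (h1 i).sub_cobdry_ofZ (hw i _),
    fun i => (h2 i).sub_cobdry_ofZ (slGens_ofZ i _), ?_, ?_⟩
  · refine ((rel_fib_zero.2 h3).sub_cobdry_fib _).zero_of_mem ?_
    rw [ofZ_mem_constants_iff]
    simp
  · refine (hK.sub_cobdry_fib _).zero_of_mem ?_
    rw [ofZ_mem_constants_iff, map_smul, dz_zz, mul_smul_comm, mul_one]
    exact hc

/-- From `[r, z²r + σE] = 2(zr + τE)`, where the value is zero, the unknown value has constant
derivative. The condition on `σ` is what makes this bracket proportional to the given field. -/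
theorem exists_rel_zzr (hs : ∀ i, Rel φ (slGens i) 0) (hr : Rel φ (fib 1 0) 0) {τ σ : smooth ℝ}
    (hz : Rel φ (fib zz τ) 0) (hσ : dz σ = (2 : ℝ) • τ) (hzz : fib (zz ^ 2) σ ∈ 𝔥) :
    ∃ c : ℝ, Rel φ (fib (zz ^ 2) σ) (c • z) := by
  obtain ⟨K, hK⟩ := exists_rel_fib hs hzz
  have h4 := (rel_fib_zero.2 hr).lie_fib hK
  have h6 : fib ((2 : ℝ) • zz) ((2 : ℝ) • τ) = (2 : ℝ) • fib zz τ := fibₗ.map_smul 2 (zz, τ)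
  have h7 : dz (zz ^ 2) = (2 : ℝ) • zz := by
    rw [pow_two, dz_mul, dz_zz, mul_one, two_smul]
  simp only [h7, dz_one, hσ, map_zero, mul_one, mul_zero, sub_zero, one_mul, h6] at h4
  have h5 := h4.sub_mem (hz.smul 2)
  rw [smul_zero, sub_zero, ofZ_mem_constants_iff] at h5
  obtain ⟨c, hc⟩ := exists_dz_sub_eq_zero h5
  exact ⟨c, hK.of_sub_mem (ofZ_mem_constants_iff.2 hc)⟩

/-- `[r, E] = 0` makes the derivative of the value at `E` constant. -/
theorem exists_rel_E (hs : ∀ i, Rel φ (slGens i) 0) (hr : Rel φ (fib 1 0) 0)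
    (hE : fib 0 1 ∈ 𝔥) : ∃ c : ℝ, Rel φ (fib 0 1) (c • z) := by
  obtain ⟨K, hK⟩ := exists_rel_fib hs hE
  have h4 := (rel_fib_zero.2 hr).lie_fib hK
  simp only [dz_one, map_zero, mul_one, mul_zero, sub_zero, one_mul, zero_mul] at h4
  have h5 := h4.sub_mem ((rel_zero φ).congr (map_zero fibₗ).symm)
  rw [sub_zero, ofZ_mem_constants_iff] at h5
  obtain ⟨c, hc⟩ := exists_dz_sub_eq_zero h5
  exact ⟨c, hK.of_sub_mem (ofZ_mem_constants_iff.2 hc)⟩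

/-- `E` commutes with `zr + τE`, so `cz`, the derivative of the value `cz` along that field, must be
constant. -/
theorem rel_E_zero (hs : ∀ i, Rel φ (slGens i) 0) (hr : Rel φ (fib 1 0) 0) {τ : smooth ℝ}
    (hτ : dz τ = 0) (hz : Rel φ (fib zz τ) 0) (hE : fib 0 1 ∈ 𝔥) : Rel φ (fib 0 1) 0 := by
  obtain ⟨c, hc⟩ := exists_rel_E hs hr hE
  have h4 := (rel_fib_zero.2 hz).lie_fib (K' := c • zz) hc
  simp only [dz_zz, dz_one, hτ, map_zero, mul_zero, sub_zero, zero_mul, map_smul] at h4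
  have h5 := h4.sub_mem ((rel_zero φ).congr (map_zero fibₗ).symm)
  rw [sub_zero, ofZ_mem_constants_iff] at h5
  have h6 : c = 0 := by
    by_contra hne
    rw [mul_smul_comm, mul_one, map_smul, dz_zz] at h5
    exact one_ne_zero (smul_eq_zero_of_ne h5 hne)
  simpa [h6] using hc

end Fib

/-! ### Vanishing on `𝔰` and the planes -/

theorem rel_planeGens_zero {κ : Type} {𝔥 : LieSubalgebra ℝ VF} {Z : κ → smooth ℝ} {ψ : Cocycle 𝔥}
    {β : κ → smooth ℝ} (hβ : ∀ k, β k = 0)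
    (hp : ∀ k, Rel ψ (ofZ (Z k) • p) (-(ofZ (β k) * y)))
    (hq : ∀ k, Rel ψ (ofZ (Z k) • q) (ofZ (β k) * x)) (k : κ ⊕ κ) : Rel ψ (planeGens Z k) 0 := by
  rcases k with k | k
  · have := hp k
    rw [hβ, ofZ_zero, zero_mul, neg_zero] at this
    exact this
  · have := hq k
    rw [hβ, ofZ_zero, zero_mul] at this
    exact this

section Plane

variable {κ : Type} [Fintype κ] {𝔥 : LieSubalgebra ℝ VF} (φ : Cocycle 𝔥) {Z : κ → smooth ℝ}

theorem exists_gauge_plane_of_independent [Nontrivial κ] (hZ : ∀ t : ℝ, ∃ k, (Z k).1 t ≠ 0)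
    (hind : ∀ i j, i ≠ j → ∀ a b : ℝ, a • Z i + b • Z j = 0 → a = 0 ∧ b = 0)
    (hs : ∀ i, slGens i ∈ 𝔥) (hp : ∀ k, planeGens Z k ∈ 𝔥) :
    ∃ f, (∀ i, Rel (φ - cobdry 𝔥 f) (slGens i) 0) ∧
      ∀ k, Rel (φ - cobdry 𝔥 f) (planeGens Z k) 0 := by
  obtain ⟨f, β, h1, h2, h3, h4⟩ := exists_plane_normal_form φ Z hZ hs (fun k => hp (Sum.inl k))
    (fun k => hp (Sum.inr k))
  exact ⟨f, h2, rel_planeGens_zero (eq_zero_of_pairwise_independent hZ hind h1) h3 h4⟩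

/-- `[E, Zp] = -Zp`, whereas `E` fixes the function `-yβ`. The two signs give that `2yβ` is
constant, so `β = 0`. -/
theorem exists_gauge_plane_of_E (hZ : ∀ t : ℝ, ∃ k, (Z k).1 t ≠ 0)
    (hs : ∀ i, slGens i ∈ 𝔥) (hp : ∀ k, planeGens Z k ∈ 𝔥) (hE : fib 0 1 ∈ 𝔥) :
    ∃ f, (∀ i, Rel (φ - cobdry 𝔥 f) (slGens i) 0) ∧
      ∀ k, Rel (φ - cobdry 𝔥 f) (planeGens Z k) 0 := by
  obtain ⟨f, β, h1, h2, h3, h4⟩ := exists_plane_normal_form φ Z hZ hs (fun k => hp (Sum.inl k))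
    (fun k => hp (Sum.inr k))
  obtain ⟨K, hK⟩ := exists_rel_fib h2 hE
  refine ⟨f, h2, rel_planeGens_zero (fun k => ?_) h3 h4⟩
  have h5 := hK.lie (h3 k)
  rw [lie_fib_p, smul_vf_apply, p_ofZ, fib_apply, show 0 * dz (Z k) - 1 * Z k = -Z k by ring,
    ofZ_neg] at h5
  have h6 := (h5.add (h3 k)).congr (w := 0) (Derivation.ext fun f => by
    simp only [Derivation.add_apply, smul_vf_apply, Derivation.zero_apply]; ring)
  have h7 := h6.mem_constants_of_zero
  have h8 : ofZ (β k + β k) = 0 := by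
    apply eq_zero_of_y_mul_mem_constants
    convert neg_mem h7 using 1
    simp [Derivation.leibniz]
    ring
  rw [ofZ_eq_zero, ← two_smul ℝ] at h8
  exact smul_eq_zero_of_ne h8 two_ne_zero

/-- The bracket of `r` with `Zp` gives `β' = cβ`, so `Zβ` is a constant with logarithmic rate `2c ≠
0`, hence zero. -/
theorem exists_gauge_plane_of_r (hZ : ∀ t : ℝ, ∃ k, (Z k).1 t ≠ 0)
    {c : ℝ} (hc : c ≠ 0) (hcZ : ∀ k, dz (Z k) = c • Z k) [Subsingleton κ]
    (hs : ∀ i, slGens i ∈ 𝔥) (hp : ∀ k, planeGens Z k ∈ 𝔥) (hr : fib 1 0 ∈ 𝔥) :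
    ∃ f, (∀ i, Rel (φ - cobdry 𝔥 f) (slGens i) 0) ∧
      ∀ k, Rel (φ - cobdry 𝔥 f) (planeGens Z k) 0 := by
  obtain ⟨f, β, h1, h2, h3, h4⟩ := exists_plane_normal_form φ Z hZ hs (fun k => hp (Sum.inl k))
    (fun k => hp (Sum.inr k))
  obtain ⟨K, hK⟩ := exists_rel_fib h2 hr
  refine ⟨f, h2, rel_planeGens_zero (fun k => ?_) h3 h4⟩
  have h5 := hK.lie (h3 k)
  rw [lie_fib_p, smul_vf_apply, p_ofZ, fib_apply, hcZ,
    show 1 * c • Z k - 0 * Z k = c • Z k by ring] at h5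
  have h6 := h5.sub_mem (((h3 k).smul c).congr (pₗ.map_smul c (Z k)).symm)
  have h7 : ofZ (dz (β k) - c • β k) = 0 := by
    apply eq_zero_of_y_mul_mem_constants
    convert neg_mem h6 using 1
    rw [ofZ_sub, ofZ_smul, Algebra.smul_def, Algebra.smul_def]
    simp [Derivation.leibniz]
    ring
  rw [ofZ_eq_zero, sub_eq_zero] at h7
  have h8 := ofZ_mem_constants_iff.1 (h1 k k)
  rw [map_add, dz_mul, hcZ, h7, mul_smul_comm, mul_smul_comm, mul_comm (β k), ← add_smul,
    ← add_smul] at h8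
  have h9 : Z k * β k = 0 := smul_eq_zero_of_ne h8 (by
    intro h
    exact hc (by linarith))
  exact eq_zero_of_mul hZ fun j => by rw [Subsingleton.elim j k, h9]

end Plane

/-! ### The projective algebra -/

/-- The values `K`, `K`, `3xK`, `3yK` at `xp`, `yq`, `x²p + xyq`, `xyp + y²q`. -/
abbrev projValues (K : smooth ℝ) : Fin 8 → F :=
  ![0, 0, ofZ K, ofZ K, 0, 0, 3 * x * ofZ K, 3 * y * ofZ K]

theorem forall_fin_eight {P : Fin 8 → Prop} (h0 : P 0) (h1 : P 1) (h2 : P 2) (h3 : P 3) (h4 : P 4)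
    (h5 : P 5) (h6 : P 6) (h7 : P 7) (i : Fin 8) : P i := by
  fin_cases i
  exacts [h0, h1, h2, h3, h4, h5, h6, h7]

theorem three_mul_eq (f : F) : 3 * f = (3 : ℝ) • f := by
  rw [Algebra.smul_def, show algebraMap ℝ F 3 = 3 from map_ofNat _ 3]

theorem projGens_six : projGens 6 = fld (x ^ 2) (x * y) 0 := projGens_eq_fld 6

theorem projGens_seven : projGens 7 = fld (x * y) (y ^ 2) 0 := projGens_eq_fld 7

theorem lie_p_projGens_six : ⁅p, projGens 6⁆ = (2 : ℝ) • (x • p) + y • q :=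
  Derivation.ext fun f => by
    simp only [Derivation.commutator_apply, projGens_six, fld_apply, Derivation.add_apply,
      Derivation.smul_apply, smul_vf_apply, map_add, Derivation.leibniz, Derivation.leibniz_pow,
      smul_eq_mul, p_x, p_y, p_q_comm, p_r_comm, map_zero, two_smul]
    simp
    ring

theorem lie_X_projGens_six : ⁅x • q, projGens 6⁆ = 0 := Derivation.ext fun f => by
  rw [projGens_six, X_eq_fld, lie_fld, fld_apply]
  simp [fld_apply, Derivation.leibniz, Derivation.leibniz_pow]
  ring

theorem lie_E_projGens_six : ⁅E, projGens 6⁆ = projGens 6 := by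
  rw [projGens_six, E_eq_fld, lie_fld]
  congr 1 <;> simp [fld_apply, Derivation.leibniz, Derivation.leibniz_pow] <;> ring

theorem lie_Y_projGens_six : ⁅y • p, projGens 6⁆ = projGens 7 := by
  rw [projGens_six, projGens_seven, Y_eq_fld, lie_fld]
  congr 1 <;> simp [fld_apply, Derivation.leibniz, Derivation.leibniz_pow] <;> ring

/-- A cocycle that vanishes on `p`, `q` and `𝔰` is given by a function `K(z)`. -/
theorem exists_rel_projValues {𝔥 : LieSubalgebra ℝ VF} {ψ : Cocycle 𝔥} (hp : Rel ψ p 0)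
    (hq : Rel ψ q 0) (hX : Rel ψ (x • q) 0) (hH : Rel ψ H 0) (hY : Rel ψ (y • p) 0) {K : smooth ℝ}
    (hK : Rel ψ E (ofZ K)) (h6 : projGens 6 ∈ 𝔥) :
    ∃ K, ∀ i, Rel ψ (projGens i) (projValues K i) := by
  have hxp : Rel ψ (x • p) ((1 / 2 : ℝ) • ofZ K) := by
    refine (((hK.add hH).smul (1 / 2 : ℝ)).congr ?_).of_sub_mem (by simp)
    refine Derivation.ext fun f => ?_
    rw [Derivation.smul_apply, Derivation.add_apply, E_apply, H_apply, smul_vf_apply,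
      show x * p f + y * q f + (x * p f - y * q f) = (2 : ℝ) • (x * p f) by rw [two_smul]; ring,
      ← mul_smul]
    norm_num
  have hyq : Rel ψ (y • q) ((1 / 2 : ℝ) • ofZ K) := by
    refine (((hK.sub hH).smul (1 / 2 : ℝ)).congr ?_).of_sub_mem (by simp)
    refine Derivation.ext fun f => ?_
    rw [Derivation.smul_apply, Derivation.sub_apply, E_apply, H_apply, smul_vf_apply,
      show x * p f + y * q f - (x * p f - y * q f) = (2 : ℝ) • (y * q f) by rw [two_smul]; ring,
      ← mul_smul]
    norm_num
  obtain ⟨ζ, hζ⟩ := exists_rel ψ h6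
  have hqζ : q ζ = 0 := by
    have h3 := hX.lie hζ
    rw [lie_X_projGens_six, map_zero, sub_zero] at h3
    exact eq_zero_of_x_mul_mem_constants h3.mem_constants_of_zero
  -- The bracket with `p` is `2xp + yq`, and each of `xp`, `yq` carries half of the value at `E`;
  -- hence the factor `3/2`.
  obtain ⟨a, ha⟩ : ∃ a : ℝ, p ζ = 3 * ofZ ((1 / 2 : ℝ) • K) + a • 1 := by
    have h3 := hp.lie hζ
    rw [lie_p_projGens_six, map_zero, sub_zero] at h3
    obtain ⟨a, ha⟩ := mem_constants.1 (h3.sub_mem ((hxp.smul 2).add hyq))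
    refine ⟨a, ?_⟩
    rw [← ha, two_smul, ofZ_smul]
    ring
  -- The undetermined constant is absorbed into `K₁`. This is harmless at `xp` and `yq`, whose
  -- values count modulo constants, and makes `p ζ = 3K₁` exact.
  obtain ⟨K₁, hK₁⟩ : ∃ K₁, K₁ = (1 / 2 : ℝ) • K + (a / 3) • 1 := ⟨_, rfl⟩
  have hpζ : p ζ = 3 * ofZ K₁ := by
    have h3 : (3 : F) * ((a / 3) • 1) = a • 1 := by
      rw [three_mul_eq, ← mul_smul]
      congr 1
      ring
    rw [ha, hK₁, ofZ_add, ofZ_smul _ 1, ofZ_one, mul_add, h3]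
  have hK' : (1 / 2 : ℝ) • ofZ K - ofZ K₁ ∈ constants := by
    rw [hK₁, ofZ_add, ofZ_smul, ofZ_smul, ofZ_one, sub_add_cancel_left]
    exact neg_mem (smul_one_mem_constants _)
  have hP₁ : Rel ψ (projGens 6) (3 * x * ofZ K₁) := by
    have h3 := hK.lie hζ
    rw [lie_E_projGens_six, projGens_ofZ, sub_zero, E_apply, hqζ, hpζ] at h3
    rwa [show x * (3 * ofZ K₁) + y * 0 = 3 * x * ofZ K₁ by ring] at h3
  have hP₂ : Rel ψ (projGens 7) (3 * y * ofZ K₁) := by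
    have h3 := hY.lie hζ
    rw [lie_Y_projGens_six, map_zero, sub_zero, smul_vf_apply, hpζ] at h3
    rwa [show y * (3 * ofZ K₁) = 3 * y * ofZ K₁ by ring] at h3
  exact ⟨K₁, forall_fin_eight hp hq (hxp.of_sub_mem hK') (hyq.of_sub_mem hK') hX hY hP₁ hP₂⟩

/-- The fields `p`, `q` are the plane fields of the single function `1`, and `E` lies in the
algebra, so the plane values can be removed. -/
theorem exists_gauge_proj {𝔥 : LieSubalgebra ℝ VF} (φ : Cocycle 𝔥) (h : ∀ i, projGens i ∈ 𝔥) :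
    ∃ f K, (∀ i, Rel (φ - cobdry 𝔥 f) (slGens i) 0) ∧
      ∀ i, Rel (φ - cobdry 𝔥 f) (projGens i) (projValues K i) := by
  have hs : ∀ i, slGens i ∈ 𝔥 := by
    intro i
    fin_cases i
    exacts [h 4, sub_mem (h 2) (h 3), h 5]
  have hE : fib 0 1 ∈ 𝔥 := by
    rw [fib_zero_one]
    exact add_mem (h 2) (h 3)
  have hp1 : ofZ 1 • p = p := one_smul F p
  have hq1 : ofZ 1 • q = q := one_smul F q
  obtain ⟨f, h1, h2⟩ := exists_gauge_plane_of_E φ (Z := fun _ : Unit => 1)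
    (fun t => ⟨(), one_ne_zero⟩) hs
    (by
      rintro (k | k)
      · change ofZ 1 • p ∈ 𝔥
        rw [hp1]
        exact h 0
      · change ofZ 1 • q ∈ 𝔥
        rw [hq1]
        exact h 1) hE
  obtain ⟨K, hK⟩ := exists_rel_fib h1 hE
  rw [fib_zero_one] at hK
  obtain ⟨K, hK⟩ := exists_rel_projValues ((h2 (Sum.inl ())).congr hp1)
    ((h2 (Sum.inr ())).congr hq1) (h1 0) (h1 1) (h1 2) hK (h 6)
  exact ⟨f, K, h1, hK⟩

/-- If `r` is among the fields, the function `K` is constant. -/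
theorem exists_rel_projVals {𝔥 : LieSubalgebra ℝ VF} {φ : Cocycle 𝔥} {K : smooth ℝ}
    (h : ∀ i, Rel φ (projGens i) (projValues K i)) (hr : Rel φ (fib 1 0) 0) :
    ∃ c : ℝ, ∀ i, Rel φ (projGens i) (projVals c i) := by
  have hP₁ : Rel φ (projGens 6) (3 * x * ofZ K) := h 6
  have hP₂ : Rel φ (projGens 7) (3 * y * ofZ K) := h 7
  have h1 := hP₁.lie hr
  rw [lie_projGens_fib, map_zero, zero_sub] at h1
  have h2 := h1.mem_constants_of_zero
  -- `r` commutes with `x²p + xyq`, so `3xK'` is constant and therefore zero.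
  have h3 : ofZ ((3 : ℝ) • dz K) = 0 := by
    apply eq_zero_of_x_mul_mem_constants
    convert neg_mem h2 using 1
    rw [mul_assoc, three_mul_eq, Derivation.map_smul, fib_one_zero]
    simp [Derivation.leibniz]
  obtain ⟨k, hk⟩ := exists_eq_smul_one (smul_eq_zero_of_ne (ofZ_eq_zero.1 h3) three_ne_zero)
  have hKc : ofZ K ∈ constants := by
    rw [hk]
    exact ofZ_smul_one_mem k
  have h4 : ∀ u : F, 3 * u * ofZ K = (3 * k) • u := fun u => by
    rw [hk, ofZ_smul, ofZ_one, mul_smul_comm, mul_one, mul_comm 3 k, mul_smul, three_mul_eq]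
  rw [h4] at hP₁ hP₂
  have h0 : Rel φ (projGens 0) 0 := h 0
  have h1 : Rel φ (projGens 1) 0 := h 1
  have h2 : Rel φ (projGens 2) (ofZ K) := h 2
  have h3 : Rel φ (projGens 3) (ofZ K) := h 3
  have h4 : Rel φ (projGens 4) 0 := h 4
  have h5 : Rel φ (projGens 5) 0 := h 5
  exact ⟨3 * k, forall_fin_eight h0 h1 (h2.zero_of_mem hKc) (h3.zero_of_mem hKc) h4 h5 hP₁ hP₂⟩

/-! ### Classification from divergences -/

/-- `(K, v) ↦ K div v`, for the divergence in the `(x, y)`-planes. -/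
def mulDiv : smooth ℝ →ₗ[ℝ] VF →ₗ[ℝ] F :=
  LinearMap.mk₂ ℝ (fun K v => ofZ K * divPlane v)
    (fun K L v => by rw [ofZ_add, add_mul])
    (fun c K v => by rw [ofZ_smul, smul_mul_assoc])
    (fun K v w => by rw [map_add, mul_add])
    (fun c K v => by rw [map_smul, mul_smul_comm])

section Classify

variable {ι : Type} {v : ι → VF}

/-- Both divergences are exact cocycles. After multiplying the plane divergence by `g(z)`, the
defect is a difference of terms `v(g) div w`, and these are required to be constant. -/
theorem classifies_of_fibred {P : Type} [AddCommGroup P] [Module ℝ P] {η : P → ι → F}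
    {P₀ : Submodule ℝ P} (hv : ∀ i, IsFibred (v i))
    (hspan : ∀ i j, ⁅v i, v j⁆ ∈ Submodule.span ℝ (Set.range v))
    (g : P →ₗ[ℝ] smooth ℝ) (h : P →ₗ[ℝ] ℝ)
    (hL : ∀ c i, ofZ (g c) * divPlane (v i) + h c • divAxis (v i) - η c i ∈ constants)
    (hcoc : ∀ c i j, v i (ofZ (g c)) * divPlane (v j) ∈ constants)
    (hsurj : ∀ φ : Cocycle (lieAlg v), ∃ c f, ∀ i, Rel (φ - cobdry (lieAlg v) f) (v i) (η c i))
    (hker : ∀ c, (∃ f : F, ∀ i, v i f - η c i ∈ constants) ↔ c ∈ P₀) :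
    Classifies v η P₀ := by
  refine classifies_of (fun i => (hv i).mem_expFields) hspan
    (mulDiv ∘ₗ g + LinearMap.toSpanSingleton ℝ (VF →ₗ[ℝ] F) divAxis ∘ₗ h) hL ?_ hsurj hker
  intro c i j
  change ofZ (g c) * divPlane ⁅v i, v j⁆ + h c • divAxis ⁅v i, v j⁆ -
    (v i (ofZ (g c) * divPlane (v j) + h c • divAxis (v j)) -
      v j (ofZ (g c) * divPlane (v i) + h c • divAxis (v i))) ∈ constants
  convert sub_mem (hcoc c j i) (hcoc c i j) using 1
  rw [divPlane_lie (hv i) (hv j), divAxis_lie (hv i) (hv j)]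
  simp only [map_add, Derivation.leibniz, smul_eq_mul, Derivation.map_smul, smul_sub]
  ring

theorem classifies_bot_of_fibred {P : Type} [AddCommGroup P] [Module ℝ P] {η : P → ι → F}
    (hv : ∀ i, IsFibred (v i))
    (hspan : ∀ i j, ⁅v i, v j⁆ ∈ Submodule.span ℝ (Set.range v))
    (g : P →ₗ[ℝ] smooth ℝ) (h : P →ₗ[ℝ] ℝ)
    (hL : ∀ c i, ofZ (g c) * divPlane (v i) + h c • divAxis (v i) - η c i ∈ constants)
    (hcoc : ∀ c i j, v i (ofZ (g c)) * divPlane (v j) ∈ constants)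
    (hsurj : ∀ φ : Cocycle (lieAlg v), ∃ c f, ∀ i, Rel (φ - cobdry (lieAlg v) f) (v i) (η c i))
    (hker : ∀ c f, (∀ i, v i f - η c i ∈ constants) → c = 0) :
    Classifies v η ⊥ := by
  refine classifies_of_fibred hv hspan g h hL hcoc hsurj fun c => ?_
  rw [Submodule.mem_bot]
  refine ⟨fun ⟨f, hf⟩ => hker c f hf, ?_⟩
  rintro rfl
  exact ⟨0, fun i => by simpa using hL 0 i⟩

theorem classifiesZero_of_fibred (hv : ∀ i, IsFibred (v i))
    (hspan : ∀ i j, ⁅v i, v j⁆ ∈ Submodule.span ℝ (Set.range v))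
    (hsurj : ∀ φ : Cocycle (lieAlg v), ∃ f, ∀ i, Rel (φ - cobdry (lieAlg v) f) (v i) 0) :
    ClassifiesZero v :=
  classifies_bot_of_fibred hv hspan 0 0 (fun c i => by simp) (fun c i j => by simp)
    (fun φ => ⟨(), hsurj φ⟩) (fun _ _ _ => rfl)

end Classify

theorem divPlane_slGens (i : Fin 3) : divPlane (slGens i) = 0 := by
  rw [slGens_eq_fld, divPlane_fld]
  fin_cases i <;> simp

theorem divAxis_slGens (i : Fin 3) : divAxis (slGens i) = 0 := by
  rw [slGens_eq_fld, divAxis_fld, map_zero]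

theorem divPlane_planeGens {κ : Type} (Z : κ → smooth ℝ) (k : κ ⊕ κ) :
    divPlane (planeGens Z k) = 0 := by
  rcases k with k | k
  · change divPlane (ofZ (Z k) • p) = 0
    rw [smul_p_eq_fld, divPlane_fld, p_ofZ, map_zero, add_zero]
  · change divPlane (ofZ (Z k) • q) = 0
    rw [smul_q_eq_fld, divPlane_fld, q_ofZ, map_zero, add_zero]

theorem divAxis_planeGens {κ : Type} (Z : κ → smooth ℝ) (k : κ ⊕ κ) :
    divAxis (planeGens Z k) = 0 := by
  rcases k with k | k
  · change divAxis (ofZ (Z k) • p) = 0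
    rw [smul_p_eq_fld, divAxis_fld, map_zero]
  · change divAxis (ofZ (Z k) • q) = 0
    rw [smul_q_eq_fld, divAxis_fld, map_zero]

theorem divPlane_fib (ρ τ : smooth ℝ) : divPlane (fib ρ τ) = ofZ ((2 : ℝ) • τ) := by
  rw [fib_eq_fld, divPlane_fld, two_smul]
  simp [Derivation.leibniz]

theorem divAxis_fib (ρ τ : smooth ℝ) : divAxis (fib ρ τ) = ofZ (dz ρ) := by
  rw [fib_eq_fld, divAxis_fld, r_ofZ]

theorem divAxis_projGens (i : Fin 8) : divAxis (projGens i) = 0 := by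
  rw [projGens_eq_fld, divAxis_fld, map_zero]

theorem divPlane_projGens (i : Fin 8) :
    divPlane (projGens i) = ![0, 0, 1, 1, 0, 0, 3 * x, 3 * y] i := by
  rw [projGens_eq_fld, divPlane_fld]
  fin_cases i <;> simp [Derivation.leibniz, Derivation.leibniz_pow] <;> ring

/-! ### Tests for vanishing parameters -/

theorem exists_eq_ofZ_of_mem {f : F} (hX : (x • q : VF) f ∈ constants)
    (hY : (y • p : VF) f ∈ constants) : ∃ K, f = ofZ K :=
  exists_eq_ofZ (eq_zero_of_y_mul_mem_constants hY) (eq_zero_of_x_mul_mem_constants hX)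

theorem eq_zero_of_smul_x_mem {c : ℝ} (h : c • x ∈ constants) : c = 0 := by
  have h1 : c • (1 : F) = 0 := by
    apply eq_zero_of_x_mul_mem_constants
    rwa [mul_smul_comm, mul_one]
  by_contra hne
  exact one_ne_zero (smul_eq_zero_of_ne h1 hne)

/-! ### The families of functions of `z` -/

/-- The truncated exponent at `k = 0` is harmless because its coefficient is zero. -/
theorem dz_powExp (k : ℕ) (c : ℝ) :
    dz (powExp k c) = (k : ℝ) • powExp (k - 1) c + c • powExp k c := by
  refine Subtype.ext (funext fun t => dz_apply ?_)
  change HasDerivAt (fun t => t ^ k * Real.exp (c * t)) (k * (t ^ (k - 1) * Real.exp (c * t)) +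
    c * (t ^ k * Real.exp (c * t))) t
  have h1 := (hasDerivAt_pow k t).mul (((hasDerivAt_id t).const_mul c).exp)
  refine h1.congr_deriv ?_
  simp only [id]
  ring

theorem zz_mul_powExp (k : ℕ) (c : ℝ) : zz * powExp k c = powExp (k + 1) c := by
  refine Subtype.ext (funext fun t => ?_)
  change t * (t ^ k * Real.exp (c * t)) = t ^ (k + 1) * Real.exp (c * t)
  ring

theorem zz_mul_dz_powExp (k : ℕ) : zz * dz (powExp k 0) = (k : ℝ) • powExp k 0 := by
  rw [dz_powExp, zero_smul, add_zero, mul_smul_comm, zz_mul_powExp]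
  rcases k with _ | k
  · simp
  · rfl

theorem powExp_apply_ne_zero (c t : ℝ) : (powExp 0 c).1 t ≠ 0 := by
  change t ^ 0 * Real.exp (c * t) ≠ 0
  rw [pow_zero, one_mul]
  exact Real.exp_ne_zero _

theorem eq_of_powExp_dependent {k k' : ℕ} {c c' a b : ℝ}
    (h : a • powExp k c + b • powExp k' c' = 0) (ha : a ≠ 0) : k = k' ∧ c = c' := by
  have hev : ∀ t : ℝ, a * (t ^ k * Real.exp (c * t)) + b * (t ^ k' * Real.exp (c' * t)) = 0 :=
    fun t => congr_fun (congr_arg Subtype.val h) t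
  have hexp : ∀ (c : ℝ) (n : ℕ), Real.exp (c * n) = Real.exp c ^ n := fun c n => by
    rw [mul_comm, Real.exp_nat_mul]
  have h1 := hev (1 : ℕ)
  have h2 := hev (2 : ℕ)
  have h4 := hev (4 : ℕ)
  simp only [hexp] at h1 h2 h4
  push_cast at h1 h2 h4
  have hE := Real.exp_pos c
  have hE' := Real.exp_pos c'
  rw [one_pow, one_pow, one_mul, one_mul, pow_one, pow_one] at h1
  have h44 : ∀ n : ℕ, (4 : ℝ) ^ n = (2 ^ n) ^ 2 := fun n => by
    rw [← pow_mul, mul_comm, pow_mul]; norm_num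
  rw [h44, h44] at h4
  have hK : (0 : ℝ) < 2 ^ k := by positivity
  have hK' : (0 : ℝ) < 2 ^ k' := by positivity
  have hEE : Real.exp c ≠ 0 := hE.ne'
  -- Comparing the values at `t = 1` and `t = 2` eliminates `b`; the next identity does the same
  -- with `t = 1` and `t = 4`. Together they determine `e^c` and then `2^k`.
  have e1 : 2 ^ k * Real.exp c = 2 ^ k' * Real.exp c' := by
    have : a * Real.exp c * Real.exp c' * (2 ^ k * Real.exp c - 2 ^ k' * Real.exp c') = 0 := by
      linear_combination Real.exp c' * h2 - 2 ^ k' * Real.exp c' ^ 2 * h1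
    have h := (mul_eq_zero.1 this).resolve_left (by positivity)
    linarith
  have e2 : (2 ^ k * Real.exp c) ^ 2 * Real.exp c = (2 ^ k' * Real.exp c') ^ 2 * Real.exp c' := by
    have : a * Real.exp c * Real.exp c' * ((2 ^ k * Real.exp c) ^ 2 * Real.exp c -
        (2 ^ k' * Real.exp c') ^ 2 * Real.exp c') = 0 := by
      linear_combination Real.exp c' * h4 - (2 ^ k') ^ 2 * Real.exp c' ^ 4 * h1
    have h := (mul_eq_zero.1 this).resolve_left (by positivity)
    linarith
  rw [e1] at e2
  have e3 : Real.exp c = Real.exp c' := mul_left_cancel₀ (by positivity) e2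
  rw [e3] at e1
  have e4 : (2 : ℝ) ^ k = 2 ^ k' := mul_right_cancel₀ (by positivity) e1
  exact ⟨Nat.pow_right_injective le_rfl (by exact_mod_cast e4), Real.exp_injective e3⟩

theorem powExp_independent {k k' : ℕ} {c c' : ℝ} (hne : ¬(k = k' ∧ c = c')) {a b : ℝ}
    (h : a • powExp k c + b • powExp k' c' = 0) : a = 0 ∧ b = 0 := by
  constructor
  · by_contra ha
    exact hne (eq_of_powExp_dependent h ha)
  · by_contra hb
    rw [add_comm] at h
    obtain ⟨h1, h2⟩ := eq_of_powExp_dependent h hb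
    exact hne ⟨h1.symm, h2.symm⟩

section Powers

variable (l : ℕ)

theorem powers_ne_zero (t : ℝ) : ∃ k, (powers l k).1 t ≠ 0 := ⟨0, powExp_apply_ne_zero 0 t⟩

theorem powers_independent (i j : Fin (l + 1)) (hij : i ≠ j) (a b : ℝ)
    (h : a • powers l i + b • powers l j = 0) : a = 0 ∧ b = 0 :=
  powExp_independent (fun h => hij (Fin.ext h.1)) h

theorem powExp_mem_span_powers {k : ℕ} (hk : k ≤ l) :
    powExp k 0 ∈ Submodule.span ℝ (Set.range (powers l)) :=
  Submodule.subset_span ⟨⟨k, by omega⟩, rfl⟩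

theorem dz_powers_mem (k : Fin (l + 1)) :
    dz (powers l k) ∈ Submodule.span ℝ (Set.range (powers l)) := by
  change dz (powExp k 0) ∈ _
  rw [dz_powExp, zero_smul, add_zero]
  exact Submodule.smul_mem _ _ (powExp_mem_span_powers l (by omega))

theorem zz_mul_dz_powers (k : Fin (l + 1)) : zz * dz (powers l k) = (k : ℝ) • powers l k :=
  zz_mul_dz_powExp k

/-- The result is `(k - l) z^(k+1)`: the coefficient vanishes exactly where the degree would exceed
`l`, which is why the coefficient of `E` is `lz`. -/
theorem zz_sq_mul_dz_powers_mem (k : Fin (l + 1)) :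
    zz ^ 2 * dz (powers l k) - ((l : ℝ) • zz) * powers l k ∈
      Submodule.span ℝ (Set.range (powers l)) := by
  have h1 : zz ^ 2 * dz (powers l k) - ((l : ℝ) • zz) * powers l k =
      ((k : ℝ) - l) • powExp (k + 1) 0 := by
    rw [pow_two, mul_assoc, zz_mul_dz_powers, smul_mul_assoc, mul_smul_comm, ← sub_smul,
      ← zz_mul_powExp]
    rfl
  rw [h1]
  by_cases hk : (k : ℕ) = l
  · rw [hk, sub_self, zero_smul]
    exact zero_mem _
  · exact Submodule.smul_mem _ _ (powExp_mem_span_powers l (by omega))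

theorem powers_mem (k : Fin (l + 1)) : powers l k ∈ Submodule.span ℝ (Set.range (powers l)) :=
  Submodule.subset_span ⟨k, rfl⟩

end Powers

section PowExps

variable {b : ℕ} (n : Fin (b + 1) → ℕ) (μ : Fin (b + 1) → ℝ)

theorem powExps_ne_zero (t : ℝ) : ∃ k, (powExps n μ k).1 t ≠ 0 :=
  ⟨⟨0, 0⟩, powExp_apply_ne_zero (μ 0) t⟩

theorem powExps_independent (hμ : Function.Injective μ) (i j : Σ j : Fin (b + 1), Fin (n j + 1))
    (hij : i ≠ j) (a c : ℝ) (h : a • powExps n μ i + c • powExps n μ j = 0) :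
    a = 0 ∧ c = 0 := by
  refine powExp_independent (fun h => hij ?_) h
  obtain ⟨i, k⟩ := i
  obtain ⟨j, m⟩ := j
  obtain ⟨h1, h2⟩ := h
  obtain rfl := hμ h2
  obtain rfl : k = m := Fin.ext h1
  rfl

theorem powExps_mem (k : Σ j : Fin (b + 1), Fin (n j + 1)) :
    powExps n μ k ∈ Submodule.span ℝ (Set.range (powExps n μ)) :=
  Submodule.subset_span ⟨k, rfl⟩

theorem dz_powExps_mem (k : Σ j : Fin (b + 1), Fin (n j + 1)) :
    dz (powExps n μ k) ∈ Submodule.span ℝ (Set.range (powExps n μ)) := by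
  obtain ⟨j, k⟩ := k
  change dz (powExp k (μ j)) ∈ _
  rw [dz_powExp]
  refine add_mem (Submodule.smul_mem _ _ ?_) (Submodule.smul_mem _ _ (powExps_mem n μ ⟨j, k⟩))
  exact Submodule.subset_span ⟨⟨j, ⟨k - 1, by omega⟩⟩, rfl⟩

end PowExps

/-! ### Fibred families -/

theorem mem_span_of_eq_smul {V J : Type} [AddCommGroup V] [Module ℝ V] {e : J → V} {u : V} (k : J)
    (c : ℝ) (h : u = c • e k) : u ∈ Submodule.span ℝ (Set.range e) :=
  h ▸ Submodule.smul_mem _ c (Submodule.subset_span ⟨k, rfl⟩)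

theorem ofZ_mul_one_smul (a : ℝ) (f : F) : ofZ (a • 1) * f = a • f := by
  rw [ofZ_smul, ofZ_one, smul_mul_assoc, one_mul]

section FibGens

variable {κ J P : Type} [AddCommGroup P] [Module ℝ P] {Z : κ → smooth ℝ}
  {e : J → smooth ℝ × smooth ℝ}

/-- Everything is reduced to functions of `z`: with zero values on `𝔰`, any function giving a
coboundary depends on `z` alone, and such functions are killed by `𝔰` and by the plane fields. -/
theorem classifies_fibGens
    (hZ : ∀ j k, (e j).1 * dz (Z k) - (e j).2 * Z k ∈ Submodule.span ℝ (Set.range Z))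
    (he : ∀ i j, ((e i).1 * dz (e j).1 - (e j).1 * dz (e i).1,
      (e i).1 * dz (e j).2 - (e j).1 * dz (e i).2) ∈ Submodule.span ℝ (Set.range e))
    (k : P → J → smooth ℝ) {P₀ : Submodule ℝ P} (g : P →ₗ[ℝ] smooth ℝ) (h : P →ₗ[ℝ] ℝ)
    (hL : ∀ c j, dz (g c * (2 : ℝ) • (e j).2 + h c • dz (e j).1 - k c j) = 0)
    (hcoc : ∀ c i j, dz ((e i).1 * dz (g c) * (2 : ℝ) • (e j).2) = 0)
    (hplane : ∀ φ : Cocycle (lieAlg (fibGens Z e)),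
      ∃ f, (∀ i, Rel (φ - cobdry _ f) (slGens i) 0) ∧ ∀ i, Rel (φ - cobdry _ f) (planeGens Z i) 0)
    (hsurj : ∀ φ : Cocycle (lieAlg (fibGens Z e)), (∀ i, Rel φ (slGens i) 0) →
      (∀ i, Rel φ (planeGens Z i) 0) → ∃ c f, (∀ i, Rel (φ - cobdry _ f) (slGens i) 0) ∧
        (∀ i, Rel (φ - cobdry _ f) (planeGens Z i) 0) ∧
        ∀ j, Rel (φ - cobdry _ f) (fib (e j).1 (e j).2) (ofZ (k c j)))
    (hker : ∀ c, (∃ G, ∀ j, dz ((e j).1 * dz G - k c j) = 0) ↔ c ∈ P₀) :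
    Classifies (fibGens Z e) (fun c => Sum.elim 0 (Sum.elim 0 fun j => ofZ (k c j))) P₀ := by
  refine classifies_of_fibred (isFibred_fibGens Z e) (lie_fibGens Z e hZ he) g h ?_ ?_ ?_ ?_
  · rintro c (i | i | j)
    · change ofZ (g c) * divPlane (slGens i) + h c • divAxis (slGens i) - 0 ∈ constants
      rw [divPlane_slGens, divAxis_slGens]
      simp
    · change ofZ (g c) * divPlane (planeGens Z i) + h c • divAxis (planeGens Z i) - 0 ∈ constants
      rw [divPlane_planeGens, divAxis_planeGens]
      simp
    · change ofZ (g c) * divPlane (fib (e j).1 (e j).2) + h c • divAxis (fib (e j).1 (e j).2) -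
        ofZ (k c j) ∈ constants
      rw [divPlane_fib, divAxis_fib, ← ofZ_mul, ← ofZ_smul, ← ofZ_add, ← ofZ_sub,
        ofZ_mem_constants_iff]
      exact hL c j
  · rintro c (i | i | i) j
    · change slGens i (ofZ (g c)) * _ ∈ constants
      rw [slGens_ofZ, zero_mul]
      exact zero_mem _
    · change planeGens Z i (ofZ (g c)) * _ ∈ constants
      rw [planeGens_ofZ, zero_mul]
      exact zero_mem _
    · rcases j with j | j | j
      · change _ * divPlane (slGens j) ∈ constants
        rw [divPlane_slGens, mul_zero]
        exact zero_mem _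
      · change _ * divPlane (planeGens Z j) ∈ constants
        rw [divPlane_planeGens, mul_zero]
        exact zero_mem _
      · change fib (e i).1 (e i).2 (ofZ (g c)) * divPlane (fib (e j).1 (e j).2) ∈ constants
        rw [divPlane_fib, fib_ofZ, ← ofZ_mul, ofZ_mem_constants_iff]
        exact hcoc c i j
  · intro φ
    obtain ⟨f, h1, h2⟩ := hplane φ
    obtain ⟨c, f', h3, h4, h5⟩ := hsurj _ h1 h2
    rw [sub_cobdry_sub_cobdry] at h3 h4 h5
    refine ⟨c, f + f', ?_⟩
    rintro (i | i | j)
    · exact h3 i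
    · exact h4 i
    · exact h5 j
  · intro c
    rw [← hker c]
    constructor
    · rintro ⟨f, hf⟩
      obtain ⟨G, rfl⟩ := exists_eq_ofZ_of_slGens (f := f) fun i => by
        have h1 : slGens i f - 0 ∈ constants := hf (Sum.inl i)
        rwa [sub_zero] at h1
      refine ⟨G, fun j => ?_⟩
      have h1 : fib (e j).1 (e j).2 (ofZ G) - ofZ (k c j) ∈ constants := hf (Sum.inr (Sum.inr j))
      rwa [fib_ofZ, ← ofZ_sub, ofZ_mem_constants_iff] at h1
    · rintro ⟨G, hG⟩
      refine ⟨ofZ G, ?_⟩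
      rintro (i | i | j)
      · change slGens i (ofZ G) - 0 ∈ constants
        rw [slGens_ofZ, sub_zero]
        exact zero_mem _
      · change planeGens Z i (ofZ G) - 0 ∈ constants
        rw [planeGens_ofZ, sub_zero]
        exact zero_mem _
      · change fib (e j).1 (e j).2 (ofZ G) - ofZ (k c j) ∈ constants
        rw [fib_ofZ, ← ofZ_sub, ofZ_mem_constants_iff]
        exact hG j

theorem classifiesZero_fibGens
    (hZ : ∀ j k, (e j).1 * dz (Z k) - (e j).2 * Z k ∈ Submodule.span ℝ (Set.range Z))
    (he : ∀ i j, ((e i).1 * dz (e j).1 - (e j).1 * dz (e i).1,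
      (e i).1 * dz (e j).2 - (e j).1 * dz (e i).2) ∈ Submodule.span ℝ (Set.range e))
    (hplane : ∀ φ : Cocycle (lieAlg (fibGens Z e)),
      ∃ f, (∀ i, Rel (φ - cobdry _ f) (slGens i) 0) ∧ ∀ i, Rel (φ - cobdry _ f) (planeGens Z i) 0)
    (hsurj : ∀ φ : Cocycle (lieAlg (fibGens Z e)), (∀ i, Rel φ (slGens i) 0) →
      (∀ i, Rel φ (planeGens Z i) 0) → ∃ f, (∀ i, Rel (φ - cobdry _ f) (slGens i) 0) ∧
        (∀ i, Rel (φ - cobdry _ f) (planeGens Z i) 0) ∧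
        ∀ j, Rel (φ - cobdry _ f) (fib (e j).1 (e j).2) 0) :
    ClassifiesZero (fibGens Z e) := by
  refine classifiesZero_of_fibred (isFibred_fibGens Z e) (lie_fibGens Z e hZ he) fun φ => ?_
  obtain ⟨f, h1, h2⟩ := hplane φ
  obtain ⟨f', h3, h4, h5⟩ := hsurj _ h1 h2
  rw [sub_cobdry_sub_cobdry] at h3 h4 h5
  refine ⟨f + f', ?_⟩
  rintro (i | i | j)
  · exact h3 i
  · exact h4 i
  · exact h5 j

theorem slGens_mem_lieAlg (i : Fin 3) : slGens i ∈ lieAlg (fibGens Z e) :=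
  subset_lieAlg (v := fibGens Z e) (Sum.inl i)

theorem planeGens_mem_lieAlg (i : κ ⊕ κ) : planeGens Z i ∈ lieAlg (fibGens Z e) :=
  subset_lieAlg (v := fibGens Z e) (Sum.inr (Sum.inl i))

theorem fib_mem_lieAlg (j : J) : fib (e j).1 (e j).2 ∈ lieAlg (fibGens Z e) :=
  subset_lieAlg (v := fibGens Z e) (Sum.inr (Sum.inr j))

end FibGens

/-- The bracket of the fields `fib ρ τ`, in terms of the pairs `(ρ, τ)`. -/
abbrev fibBracket (s t : smooth ℝ × smooth ℝ) : smooth ℝ × smooth ℝ :=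
  (s.1 * dz t.1 - t.1 * dz s.1, s.1 * dz t.2 - t.1 * dz s.2)

/-- By antisymmetry, only the brackets with `i < j` need to be computed. -/
theorem fibBracket_mem_of_lt {J : Type} [LinearOrder J] {e : J → smooth ℝ × smooth ℝ}
    (he : ∀ i j, i < j → fibBracket (e i) (e j) ∈ Submodule.span ℝ (Set.range e)) (i j : J) :
    fibBracket (e i) (e j) ∈ Submodule.span ℝ (Set.range e) := by
  rcases lt_trichotomy i j with h | rfl | h
  · exact he i j h
  · rw [fibBracket, sub_self, sub_self]
    exact zero_mem _
  · have h1 := neg_mem (he j i h)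
    rwa [Prod.neg_mk, neg_sub, neg_sub] at h1

theorem fibBracket_mem_one {e : Fin 1 → smooth ℝ × smooth ℝ} (i j : Fin 1) :
    fibBracket (e i) (e j) ∈ Submodule.span ℝ (Set.range e) :=
  fibBracket_mem_of_lt (fun i j h => absurd h (by omega)) i j

theorem fibBracket_mem_two {e : Fin 2 → smooth ℝ × smooth ℝ}
    (h : fibBracket (e 0) (e 1) ∈ Submodule.span ℝ (Set.range e)) (i j : Fin 2) :
    fibBracket (e i) (e j) ∈ Submodule.span ℝ (Set.range e) := by
  refine fibBracket_mem_of_lt (fun i j hij => ?_) i j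
  obtain rfl : i = 0 := by omega
  obtain rfl : j = 1 := by omega
  exact h

theorem fibBracket_mem_three {e : Fin 3 → smooth ℝ × smooth ℝ}
    (h01 : fibBracket (e 0) (e 1) ∈ Submodule.span ℝ (Set.range e))
    (h02 : fibBracket (e 0) (e 2) ∈ Submodule.span ℝ (Set.range e))
    (h12 : fibBracket (e 1) (e 2) ∈ Submodule.span ℝ (Set.range e)) (i j : Fin 3) :
    fibBracket (e i) (e j) ∈ Submodule.span ℝ (Set.range e) := by
  refine fibBracket_mem_of_lt (fun i j hij => ?_) i j
  obtain ⟨rfl, rfl⟩ | ⟨rfl, rfl⟩ | ⟨rfl, rfl⟩ :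
    (i = 0 ∧ j = 1) ∨ (i = 0 ∧ j = 2) ∨ (i = 1 ∧ j = 2) := by omega
  exacts [h01, h02, h12]

/-- The entry `0` is treated as a whole because it is meant for `E`, which commutes with all these
fields. -/
theorem fibBracket_mem_four {e : Fin 4 → smooth ℝ × smooth ℝ}
    (h0 : ∀ t, fibBracket (e 0) t ∈ Submodule.span ℝ (Set.range e))
    (h12 : fibBracket (e 1) (e 2) ∈ Submodule.span ℝ (Set.range e))
    (h13 : fibBracket (e 1) (e 3) ∈ Submodule.span ℝ (Set.range e))
    (h23 : fibBracket (e 2) (e 3) ∈ Submodule.span ℝ (Set.range e)) (i j : Fin 4) :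
    fibBracket (e i) (e j) ∈ Submodule.span ℝ (Set.range e) := by
  refine fibBracket_mem_of_lt (fun i j hij => ?_) i j
  obtain rfl | ⟨rfl, rfl⟩ | ⟨rfl, rfl⟩ | ⟨rfl, rfl⟩ :
    i = 0 ∨ (i = 1 ∧ j = 2) ∨ (i = 1 ∧ j = 3) ∨ (i = 2 ∧ j = 3) := by omega
  exacts [h0 _, h12, h13, h23]

theorem dz_zz_sq : dz (zz ^ 2) = (2 : ℝ) • zz := by
  rw [pow_two, dz_mul, dz_zz, mul_one, two_smul]

theorem fibBracket_E (t : smooth ℝ × smooth ℝ) : fibBracket (0, 1) t = 0 := by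
  simp [fibBracket]

theorem fibBracket_r_zr {τ : smooth ℝ} (hτ : dz τ = 0) : fibBracket (1, 0) (zz, τ) = (1, 0) := by
  simp [fibBracket, hτ]

theorem fibBracket_r_zzr (a : ℝ) :
    fibBracket (1, 0) (zz ^ 2, a • zz) = ((2 : ℝ) • zz, a • 1) := by
  simp [fibBracket, dz_zz_sq]

theorem fibBracket_zr_zzr {τ : smooth ℝ} (hτ : dz τ = 0) (a : ℝ) :
    fibBracket (zz, τ) (zz ^ 2, a • zz) = (zz ^ 2, a • zz) := by
  rw [fibBracket, dz_zz_sq, hτ, map_smul, dz_zz, two_smul]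
  refine Prod.ext ?_ ?_
  · ring
  · simp

/-! ### Projective families -/

theorem wronskian_mem_of_lt {J : Type} [LinearOrder J] {e : J → smooth ℝ}
    (he : ∀ i j, i < j → e i * dz (e j) - e j * dz (e i) ∈ Submodule.span ℝ (Set.range e))
    (i j : J) : e i * dz (e j) - e j * dz (e i) ∈ Submodule.span ℝ (Set.range e) := by
  rcases lt_trichotomy i j with h | rfl | h
  · exact he i j h
  · rw [sub_self]
    exact zero_mem _
  · rw [← neg_sub]
    exact neg_mem (he j i h)

theorem wronskian_mem_two {e : Fin 2 → smooth ℝ}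
    (h : e 0 * dz (e 1) - e 1 * dz (e 0) ∈ Submodule.span ℝ (Set.range e)) (i j : Fin 2) :
    e i * dz (e j) - e j * dz (e i) ∈ Submodule.span ℝ (Set.range e) := by
  refine wronskian_mem_of_lt (fun i j hij => ?_) i j
  obtain rfl : i = 0 := by omega
  obtain rfl : j = 1 := by omega
  exact h

theorem wronskian_mem_three {e : Fin 3 → smooth ℝ}
    (h01 : e 0 * dz (e 1) - e 1 * dz (e 0) ∈ Submodule.span ℝ (Set.range e))
    (h02 : e 0 * dz (e 2) - e 2 * dz (e 0) ∈ Submodule.span ℝ (Set.range e))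
    (h12 : e 1 * dz (e 2) - e 2 * dz (e 1) ∈ Submodule.span ℝ (Set.range e)) (i j : Fin 3) :
    e i * dz (e j) - e j * dz (e i) ∈ Submodule.span ℝ (Set.range e) := by
  refine wronskian_mem_of_lt (fun i j hij => ?_) i j
  obtain ⟨rfl, rfl⟩ | ⟨rfl, rfl⟩ | ⟨rfl, rfl⟩ :
    (i = 0 ∧ j = 1) ∨ (i = 0 ∧ j = 2) ∨ (i = 1 ∧ j = 2) := by omega
  exacts [h01, h02, h12]

section ProjFibGens

variable {J P : Type} [AddCommGroup P] [Module ℝ P] {e : J → smooth ℝ}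

theorem classifies_projFibGens
    (he : ∀ i j, e i * dz (e j) - e j * dz (e i) ∈ Submodule.span ℝ (Set.range e))
    (α : P →ₗ[ℝ] ℝ) (k : P → J → smooth ℝ) (h : P →ₗ[ℝ] ℝ)
    (hL : ∀ c j, dz (h c • dz (e j) - k c j) = 0)
    (hsurj : ∀ (φ : Cocycle (lieAlg (projFibGens e))) (K : smooth ℝ),
      (∀ i, Rel φ (slGens i) 0) → (∀ i, Rel φ (projGens i) (projValues K i)) →
      ∃ c f, (∀ i, Rel (φ - cobdry _ f) (projGens i) (projVals (α c) i)) ∧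
        ∀ j, Rel (φ - cobdry _ f) (fib (e j) 0) (ofZ (k c j)))
    (hker : ∀ c G, α c = 0 → (∀ j, dz (e j * dz G - k c j) = 0) → c = 0) :
    Classifies (projFibGens e)
      (fun c => Sum.elim (projVals (α c)) fun j => ofZ (k c j)) ⊥ := by
  -- The factor `1/3` compensates the divergences `3x` and `3y`; at `xp` and `yq` only constants
  -- appear.
  refine classifies_bot_of_fibred (isFibred_projFibGens e) (lie_projFibGens e he)
    ((LinearMap.toSpanSingleton ℝ (smooth ℝ) ((1 / 3 : ℝ) • 1)) ∘ₗ α) h ?_ ?_ ?_ ?_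
  · rintro c (i | j)
    · change ofZ (α c • (1 / 3 : ℝ) • 1) * divPlane (projGens i) + h c • divAxis (projGens i) -
        projVals (α c) i ∈ constants
      rw [divPlane_projGens, divAxis_projGens, smul_zero, add_zero, ← mul_smul, ofZ_mul_one_smul]
      have h3 : ∀ f : F, (α c * (1 / 3)) • (3 * f) - α c • f ∈ constants := fun f => by
        rw [three_mul_eq, ← mul_smul, mul_assoc]
        norm_num
      have h0 : (α c * (1 / 3)) • (0 : F) - 0 ∈ constants := by simp
      have h1 : (α c * (1 / 3)) • (1 : F) - 0 ∈ constants := by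
        rw [sub_zero]
        exact smul_one_mem_constants _
      revert i
      exact forall_fin_eight h0 h0 h1 h1 h0 h0 (h3 x) (h3 y)
    · change ofZ (α c • (1 / 3 : ℝ) • 1) * divPlane (fib (e j) 0) + h c • divAxis (fib (e j) 0) -
        ofZ (k c j) ∈ constants
      rw [divPlane_fib, divAxis_fib, smul_zero, ofZ_zero, mul_zero, zero_add, ← ofZ_smul,
        ← ofZ_sub, ofZ_mem_constants_iff]
      exact hL c j
  · intro c i j
    have h0 : projFibGens e i (ofZ (α c • (1 / 3 : ℝ) • 1)) = 0 := by
      rcases i with i | i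
      · exact projGens_ofZ i _
      · change fib (e i) 0 _ = 0
        rw [fib_ofZ, map_smul, map_smul, dz_one, smul_zero, smul_zero, mul_zero, ofZ_zero]
    change projFibGens e i (ofZ (α c • (1 / 3 : ℝ) • 1)) * _ ∈ constants
    rw [h0, zero_mul]
    exact zero_mem _
  · intro φ
    obtain ⟨f, K, h1, h2⟩ := exists_gauge_proj φ fun i =>
      subset_lieAlg (v := projFibGens e) (Sum.inl i)
    obtain ⟨c, f', h3, h4⟩ := hsurj _ K h1 h2
    rw [sub_cobdry_sub_cobdry] at h3 h4
    refine ⟨c, f + f', ?_⟩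
    rintro (i | j)
    · exact h3 i
    · exact h4 j
  · intro c f hf
    obtain ⟨G, rfl⟩ := exists_eq_ofZ_of_mem (f := f)
      (by
        have h1 : (x • q : VF) f - 0 ∈ constants := hf (Sum.inl 4)
        rwa [sub_zero] at h1)
      (by
        have h1 : (y • p : VF) f - 0 ∈ constants := hf (Sum.inl 5)
        rwa [sub_zero] at h1)
    refine hker c G ?_ fun j => ?_
    · have h1 : projGens 6 (ofZ G) - α c • x ∈ constants := hf (Sum.inl 6)
      rw [projGens_ofZ, zero_sub] at h1
      exact eq_zero_of_smul_x_mem (by simpa using neg_mem h1)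
    · have h1 : fib (e j) 0 (ofZ G) - ofZ (k c j) ∈ constants := hf (Sum.inr j)
      rwa [fib_ofZ, ← ofZ_sub, ofZ_mem_constants_iff] at h1

theorem fib_mem_lieAlg_proj (j : J) : fib (e j) 0 ∈ lieAlg (projFibGens e) :=
  subset_lieAlg (v := projFibGens e) (Sum.inr j)

end ProjFibGens

/-! ### The algebras -/

theorem z_smul_r : z • r = fib zz 0 := Derivation.ext fun f => by
  rw [fib_apply, ofZ_zz, ofZ_zero, smul_vf_apply]; ring

theorem z_sq_smul_r : z ^ 2 • r = fib (zz ^ 2) 0 := Derivation.ext fun f => by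
  rw [fib_apply, pow_two zz, ofZ_mul, ofZ_zz, ofZ_zero, smul_vf_apply]; ring

theorem z_smul_r_add (a : ℝ) : z • r + a • E = fib zz (a • 1) := Derivation.ext fun f => by
  change z * r f + a • E f = _
  rw [fib_apply, ofZ_zz, ofZ_mul_one_smul, E_apply]
  ring

theorem z_sq_smul_r_add (a : ℝ) : z ^ 2 • r + (a • z) • E = fib (zz ^ 2) (a • zz) :=
  Derivation.ext fun f => by
    change z ^ 2 * r f + (a • z) * E f = _
    rw [fib_apply, pow_two zz, ofZ_mul, ofZ_smul, ofZ_zz, E_apply]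
    ring

theorem sub_cobdry_zero {𝔥 : LieSubalgebra ℝ VF} (φ : Cocycle 𝔥) : φ - cobdry 𝔥 0 = φ := by
  rw [show cobdry 𝔥 0 = 0 from map_zero _, sub_zero]

theorem powers_two_le {l : ℕ} (hl : 1 ≤ l) : Nontrivial (Fin (l + 1)) :=
  Fin.nontrivial_iff_two_le.2 (by omega)

theorem eq_zero_of_smul_one {c : ℝ} (h : c • (1 : smooth ℝ) = 0) : c = 0 := by
  by_contra hne
  exact one_ne_zero (smul_eq_zero_of_ne h hne)

theorem classifies_proj : Classifies projGens
    (fun (K : smooth ℝ) => ![0, 0, ofZ K, ofZ K, 0, 0, 3 * x * ofZ K, 3 * y * ofZ K]) ⊥ := by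
  refine classifies_bot_of_fibred isFibred_projGens lie_projGens LinearMap.id 0 ?_ ?_ ?_ ?_
  · intro K i
    change ofZ K * divPlane (projGens i) + (0 : ℝ) • divAxis (projGens i) - projValues K i ∈
      constants
    rw [divPlane_projGens, zero_smul, add_zero]
    have h0 : ofZ K * 0 - 0 ∈ constants := by simp
    have h1 : ofZ K * 1 - ofZ K ∈ constants := by simp
    have h2 : ∀ f : F, ofZ K * (3 * f) - 3 * f * ofZ K ∈ constants := fun f => by
      rw [mul_comm, sub_self]
      exact zero_mem _
    revert i
    exact forall_fin_eight h0 h0 h1 h1 h0 h0 (h2 x) (h2 y)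
  · intro K i j
    change projGens i (ofZ K) * _ ∈ constants
    rw [projGens_ofZ, zero_mul]
    exact zero_mem _
  · intro φ
    obtain ⟨f, K, -, h⟩ := exists_gauge_proj φ (subset_lieAlg (v := projGens))
    exact ⟨K, f, h⟩
  · intro K f hf
    obtain ⟨G, rfl⟩ := exists_eq_ofZ_of_mem (f := f)
      (by
        have h1 : (x • q : VF) f - 0 ∈ constants := hf 4
        rwa [sub_zero] at h1)
      (by
        have h1 : (y • p : VF) f - 0 ∈ constants := hf 5
        rwa [sub_zero] at h1)
    -- At `xp` and `yq` only `K` modulo constants is visible; the value `3xK` determines `K` itself.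
    have h1 : projGens 6 (ofZ G) - 3 * x * ofZ K ∈ constants := hf 6
    rw [projGens_ofZ, zero_sub] at h1
    have h2 : ofZ ((3 : ℝ) • K) = 0 := by
      apply eq_zero_of_x_mul_mem_constants
      convert neg_mem h1 using 1
      rw [neg_neg, ofZ_smul, ← three_mul_eq]
      ring
    exact smul_eq_zero_of_ne (ofZ_eq_zero.1 h2) three_ne_zero

theorem pair_independent {κ : Type} {Z : κ → smooth ℝ} (hind : LinearIndependent ℝ Z) {i j : κ}
    (hij : i ≠ j) : LinearIndependent ℝ ![Z i, Z j] := by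
  have h1 := hind.comp ![i, j] (by
    intro a b
    fin_cases a <;> fin_cases b <;> simp [hij, hij.symm])
  rwa [show Z ∘ ![i, j] = ![Z i, Z j] from funext fun a => by fin_cases a <;> rfl] at h1

theorem classifiesZero_plane (l : ℕ) (Z : Fin l → smooth ℝ) (hl : 2 ≤ l)
    (hind : LinearIndependent ℝ Z) (hZ : ∀ t : ℝ, ∃ i, (Z i).1 t ≠ 0) :
    ClassifiesZero (Sum.elim slGens (planeGens Z)) := by
  have : Nontrivial (Fin l) := Fin.nontrivial_iff_two_le.2 hl
  refine classifiesZero_of_fibred ?_ (lie_slGens_elim_planeGens Z) fun φ => ?_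
  · rintro (i | k)
    exacts [isFibred_slGens i, isFibred_planeGens Z k]
  · obtain ⟨f, h1, h2⟩ := exists_gauge_plane_of_independent φ hZ
      (fun i j hij => LinearIndependent.pair_iff.1 (pair_independent hind hij))
      (fun i => subset_lieAlg (v := Sum.elim slGens (planeGens Z)) (Sum.inl i))
      (fun k => subset_lieAlg (v := Sum.elim slGens (planeGens Z)) (Sum.inr k))
    refine ⟨f, ?_⟩
    rintro (i | k)
    exacts [h1 i, h2 k]

theorem classifies_plane_E (l : ℕ) (Z : Fin l → smooth ℝ) (hZ : ∀ t : ℝ, ∃ i, (Z i).1 t ≠ 0) :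
    Classifies (Sum.elim slGens (Sum.elim (planeGens Z) ![E]))
      (fun K : smooth ℝ => Sum.elim 0 (Sum.elim 0 ![ofZ K])) (Submodule.span ℝ {1}) := by
  let e : Fin 1 → smooth ℝ × smooth ℝ := ![(0, 1)]
  let k : smooth ℝ → Fin 1 → smooth ℝ := fun K => ![K]
  have hE : ![E] = fun j => fib (e j).1 (e j).2 := funext fun j => by
    fin_cases j
    exact fib_zero_one.symm
  have hk : ∀ K, ![ofZ K] = fun j => ofZ (k K j) := fun K => funext fun j => by
    fin_cases j
    rfl
  simp only [hk, hE]
  -- The factor `1/2` compensates `div E = 2`.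
  refine classifies_fibGens ?_ fibBracket_mem_one k
    ((1 / 2 : ℝ) • LinearMap.id) 0 ?_ ?_ ?_ ?_ ?_
  · intro j i
    fin_cases j
    refine mem_span_of_eq_smul i (-1) ?_
    simp [e]
  · intro K j
    fin_cases j
    simp [e, k]
  · intro K i j
    fin_cases i
    simp [e]
  · intro φ
    exact exists_gauge_plane_of_E φ hZ slGens_mem_lieAlg planeGens_mem_lieAlg
      (fib_mem_lieAlg (e := e) 0)
  · intro φ h1 h2
    obtain ⟨K, hK⟩ := exists_rel_fib h1 (fib_mem_lieAlg (e := e) 0)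
    refine ⟨K, 0, ?_⟩
    rw [sub_cobdry_zero]
    refine ⟨h1, h2, fun j => ?_⟩
    fin_cases j
    exact hK
  · intro K
    rw [Submodule.mem_span_singleton]
    constructor
    · rintro ⟨G, hG⟩
      -- `E` kills functions of `z`, so no coboundary can alter `K`; it is trivial only if it is
      -- constant.
      have h1 : dz (0 * dz G - K) = 0 := hG 0
      rw [zero_mul, zero_sub, map_neg, neg_eq_zero] at h1
      obtain ⟨c, hc⟩ := exists_eq_smul_one h1
      exact ⟨c, hc.symm⟩
    · rintro ⟨c, rfl⟩
      refine ⟨0, fun j => ?_⟩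
      fin_cases j
      simp [k, e]

/-! ### Exponential polynomial families with `r` -/

section PowExps

variable (b : ℕ) (n : Fin (b + 1) → ℕ) (μ : Fin (b + 1) → ℝ)

theorem classifiesZero_powExps_r (hμ : Function.Injective μ) (hne : 0 < b ∨ 0 < n 0 ∨ μ 0 ≠ 0) :
    ClassifiesZero (Sum.elim slGens (Sum.elim (planeGens (powExps n μ)) ![r])) := by
  let e : Fin 1 → smooth ℝ × smooth ℝ := ![(1, 0)]
  have hE : ![r] = fun j => fib (e j).1 (e j).2 := funext fun j => by
    fin_cases j
    exact fib_one_zero.symm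
  rw [hE]
  refine classifiesZero_fibGens ?_ fibBracket_mem_one ?_ ?_
  · intro j i
    fin_cases j
    simpa [e] using dz_powExps_mem n μ i
  · intro φ
    -- Two or more functions are pairwise independent. A single one is `e^{λz}`, and excluding the
    -- constant `1` gives `λ ≠ 0`, so `r` removes `β`.
    rcases subsingleton_or_nontrivial (Σ j : Fin (b + 1), Fin (n j + 1)) with hs | hs
    · have hb : ¬0 < b := fun hb => by
        have h1 : (⟨0, 0⟩ : Σ j : Fin (b + 1), Fin (n j + 1)) = ⟨Fin.last b, 0⟩ :=
          Subsingleton.elim _ _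
        have h2 := congr_arg (fun s : Σ j : Fin (b + 1), Fin (n j + 1) => (s.1 : ℕ)) h1
        simp at h2
        omega
      have hn : ¬0 < n 0 := fun hn => by
        have h1 : (⟨0, 0⟩ : Σ j : Fin (b + 1), Fin (n j + 1)) = ⟨0, Fin.last (n 0)⟩ :=
          Subsingleton.elim _ _
        have h2 := congr_arg (fun s : Σ j : Fin (b + 1), Fin (n j + 1) => (s.2 : ℕ)) h1
        simp at h2
        omega
      have h0 : μ 0 ≠ 0 := (hne.resolve_left hb).resolve_left hn
      refine exists_gauge_plane_of_r φ (powExps_ne_zero n μ) h0 (fun k => ?_) slGens_mem_lieAlg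
        planeGens_mem_lieAlg (fib_mem_lieAlg (e := e) 0)
      rw [Subsingleton.elim k ⟨0, 0⟩]
      change dz (powExp 0 (μ 0)) = μ 0 • powExp 0 (μ 0)
      rw [dz_powExp, Nat.cast_zero, zero_smul, zero_add]
    · exact exists_gauge_plane_of_independent φ (powExps_ne_zero n μ)
        (powExps_independent n μ hμ) slGens_mem_lieAlg planeGens_mem_lieAlg
  · intro φ h1 h2
    obtain ⟨f, h3, h4, h5⟩ := exists_gauge_r (planeGens_ofZ _) h2 h1 (fib_mem_lieAlg (e := e) 0)
    refine ⟨f, h4, h3, fun j => ?_⟩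
    fin_cases j
    exact h5

theorem classifies_powExps_r_E :
    Classifies (Sum.elim slGens (Sum.elim (planeGens (powExps n μ)) ![r, E]))
      (fun c : ℝ => Sum.elim 0 (Sum.elim 0 ![0, c • z])) ⊥ := by
  let e : Fin 2 → smooth ℝ × smooth ℝ := ![(1, 0), (0, 1)]
  let k : ℝ → Fin 2 → smooth ℝ := fun c => ![0, c • zz]
  have hE : ![r, E] = fun j => fib (e j).1 (e j).2 := funext fun j => by
    fin_cases j
    exacts [fib_one_zero.symm, fib_zero_one.symm]
  have hk : ∀ c, ![0, c • z] = fun j => ofZ (k c j) := fun c => funext fun j => by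
    fin_cases j <;> rfl
  simp only [hk, hE]
  refine classifies_fibGens ?_ (fibBracket_mem_two ?_) k
    (LinearMap.toSpanSingleton ℝ (smooth ℝ) ((1 / 2 : ℝ) • zz)) 0 ?_ ?_ ?_ ?_ ?_
  · intro j i
    fin_cases j
    · simpa [e] using dz_powExps_mem n μ i
    · simpa [e] using powExps_mem n μ i
  · change fibBracket (1, 0) (0, 1) ∈ _
    refine mem_span_of_eq_smul 0 0 ?_
    simp [fibBracket]
  · intro c j
    fin_cases j
    · simp [e, k]
    · simp only [e, k]
      simp [← mul_smul, mul_left_comm]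
  · intro c i j
    fin_cases i <;> fin_cases j <;> simp [e]
  · intro φ
    exact exists_gauge_plane_of_E φ (powExps_ne_zero n μ) slGens_mem_lieAlg planeGens_mem_lieAlg
      (fib_mem_lieAlg (e := e) 1)
  · intro φ h1 h2
    obtain ⟨f, h3, h4, h5⟩ := exists_gauge_r (planeGens_ofZ _) h2 h1 (fib_mem_lieAlg (e := e) 0)
    obtain ⟨c, h6⟩ := exists_rel_E h4 h5 (fib_mem_lieAlg (e := e) 1)
    refine ⟨c, f, h4, h3, fun j => ?_⟩
    fin_cases j
    exacts [h5, h6]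
  · intro c
    rw [Submodule.mem_bot]
    constructor
    · rintro ⟨G, hG⟩
      have h1 : dz (0 * dz G - c • zz) = 0 := hG 1
      rw [zero_mul, zero_sub, map_neg, neg_eq_zero, map_smul, dz_zz] at h1
      exact eq_zero_of_smul_one h1
    · rintro rfl
      refine ⟨0, fun j => ?_⟩
      fin_cases j <;> simp [k, e]

end PowExps

/-! ### Polynomial families with `r`, `zr` and `z²r` -/

section Powers

variable (l : ℕ)

theorem classifiesZero_powers_r_zr (a : ℝ) (hl : 1 ≤ l) :
    ClassifiesZero (Sum.elim slGens (Sum.elim (planeGens (powers l)) ![r, z • r + a • E])) := by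
  let e : Fin 2 → smooth ℝ × smooth ℝ := ![(1, 0), (zz, a • 1)]
  have hE : ![r, z • r + a • E] = fun j => fib (e j).1 (e j).2 := funext fun j => by
    fin_cases j
    exacts [fib_one_zero.symm, z_smul_r_add a]
  rw [hE]
  have := powers_two_le hl
  refine classifiesZero_fibGens ?_ (fibBracket_mem_two ?_) ?_ ?_
  · intro j i
    fin_cases j
    · simpa [e] using dz_powers_mem l i
    · simp only [e]
      refine mem_span_of_eq_smul i ((i : ℝ) - a) ?_
      simp [zz_mul_dz_powers, sub_smul]
  · refine mem_span_of_eq_smul 0 1 ?_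
    rw [one_smul]
    exact fibBracket_r_zr (by simp)
  · intro φ
    exact exists_gauge_plane_of_independent φ (powers_ne_zero l) (powers_independent l)
      slGens_mem_lieAlg planeGens_mem_lieAlg
  · intro φ h1 h2
    obtain ⟨f, h3, h4, h5, h6⟩ := exists_gauge_zr (planeGens_ofZ _) h2 h1
      (fib_mem_lieAlg (e := e) 0) (τ := a • 1) (by simp) (fib_mem_lieAlg (e := e) 1)
    refine ⟨f, h4, h3, fun j => ?_⟩
    fin_cases j
    exacts [h5, h6]

theorem classifiesZero_powers_E_r_zr :
    ClassifiesZero (Sum.elim slGens (Sum.elim (planeGens (powers l)) ![E, r, z • r])) := by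
  let e : Fin 3 → smooth ℝ × smooth ℝ := ![(0, 1), (1, 0), (zz, 0)]
  have hE : ![E, r, z • r] = fun j => fib (e j).1 (e j).2 := funext fun j => by
    fin_cases j
    exacts [fib_zero_one.symm, fib_one_zero.symm, z_smul_r]
  rw [hE]
  refine classifiesZero_fibGens ?_ (fibBracket_mem_three ?_ ?_ ?_) ?_ ?_
  · intro j i
    fin_cases j
    · simpa [e] using powers_mem l i
    · simpa [e] using dz_powers_mem l i
    · refine mem_span_of_eq_smul i (i : ℝ) ?_
      simp [e, zz_mul_dz_powers]
  · refine mem_span_of_eq_smul 0 0 ?_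
    rw [zero_smul]
    exact fibBracket_E _
  · refine mem_span_of_eq_smul 0 0 ?_
    rw [zero_smul]
    exact fibBracket_E _
  · refine mem_span_of_eq_smul 1 1 ?_
    rw [one_smul]
    exact fibBracket_r_zr (map_zero dz)
  · intro φ
    exact exists_gauge_plane_of_E φ (powers_ne_zero l) slGens_mem_lieAlg planeGens_mem_lieAlg
      (fib_mem_lieAlg (e := e) 0)
  · intro φ h1 h2
    obtain ⟨f, h3, h4, h5, h6⟩ := exists_gauge_zr (planeGens_ofZ _) h2 h1
      (fib_mem_lieAlg (e := e) 1) (map_zero dz) (fib_mem_lieAlg (e := e) 2)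
    refine ⟨f, h4, h3, fun j => ?_⟩
    fin_cases j
    exacts [rel_E_zero h4 h5 (map_zero dz) h6 (fib_mem_lieAlg (e := e) 0), h5, h6]

theorem classifies_powers_r_zr_zzr (hl : 1 ≤ l) :
    Classifies (Sum.elim slGens (Sum.elim (planeGens (powers l))
        ![r, z • r + ((l : ℝ) / 2) • E, z ^ 2 • r + ((l : ℝ) • z) • E]))
      (fun c : ℝ => Sum.elim 0 (Sum.elim 0 ![0, 0, c • z])) ⊥ := by
  let e : Fin 3 → smooth ℝ × smooth ℝ :=
    ![(1, 0), (zz, ((l : ℝ) / 2) • 1), (zz ^ 2, (l : ℝ) • zz)]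
  let k : ℝ → Fin 3 → smooth ℝ := fun c => ![0, 0, c • zz]
  have hE : ![r, z • r + ((l : ℝ) / 2) • E, z ^ 2 • r + ((l : ℝ) • z) • E] =
      fun j => fib (e j).1 (e j).2 := funext fun j => by
    fin_cases j
    exacts [fib_one_zero.symm, z_smul_r_add _, z_sq_smul_r_add _]
  have hk : ∀ c, ![0, 0, c • z] = fun j => ofZ (k c j) := fun c => funext fun j => by
    fin_cases j <;> rfl
  simp only [hk, hE]
  have := powers_two_le hl
  -- Only the axial divergence enters: it is `2z` at the quadratic field, whence the factor `1/2`,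
  -- and constant at the other two.
  refine classifies_fibGens ?_ (fibBracket_mem_three ?_ ?_ ?_) k 0
    ((1 / 2 : ℝ) • LinearMap.id) ?_ ?_ ?_ ?_ ?_
  · intro j i
    fin_cases j
    · simpa [e] using dz_powers_mem l i
    · refine mem_span_of_eq_smul i ((i : ℝ) - l / 2) ?_
      simp [e, zz_mul_dz_powers, sub_smul]
    · exact zz_sq_mul_dz_powers_mem l i
  · refine mem_span_of_eq_smul 0 1 ?_
    rw [one_smul]
    exact fibBracket_r_zr (by simp)
  · refine mem_span_of_eq_smul 1 2 ((fibBracket_r_zzr _).trans ?_)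
    refine Prod.ext rfl ?_
    change (l : ℝ) • (1 : smooth ℝ) = (2 : ℝ) • ((l : ℝ) / 2) • 1
    rw [← mul_smul]
    congr 1
    ring
  · refine mem_span_of_eq_smul 2 1 ?_
    rw [one_smul]
    exact fibBracket_zr_zzr (by simp) _
  · intro c j
    fin_cases j
    · simp [e, k]
    · simp [e, k]
    · simp [e, k, dz_zz_sq]
      rw [← mul_smul, ← sub_smul, show 2⁻¹ * c * 2 - c = 0 by ring, zero_smul]
  · intro c i j
    simp
  · intro φ
    exact exists_gauge_plane_of_independent φ (powers_ne_zero l) (powers_independent l)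
      slGens_mem_lieAlg planeGens_mem_lieAlg
  · intro φ h1 h2
    obtain ⟨f, h3, h4, h5, h6⟩ := exists_gauge_zr (planeGens_ofZ _) h2 h1
      (fib_mem_lieAlg (e := e) 0) (τ := ((l : ℝ) / 2) • 1) (by simp) (fib_mem_lieAlg (e := e) 1)
    obtain ⟨c, h7⟩ := exists_rel_zzr h4 h5 h6 (σ := (l : ℝ) • zz)
      (by
        rw [map_smul, dz_zz, ← mul_smul]
        congr 1
        ring) (fib_mem_lieAlg (e := e) 2)
    refine ⟨c, f, h4, h3, fun j => ?_⟩
    fin_cases j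
    exacts [h5, h6, h7]
  · intro c
    rw [Submodule.mem_bot]
    constructor
    · rintro ⟨G, hG⟩
      -- The conditions at the first two fields give `G'' = 0` and `(zG')' = 0`, hence `G' = 0`;
      -- then `cz` is constant.
      have h0 : dz (1 * dz G - 0) = 0 := hG 0
      have h1 : dz (zz * dz G - 0) = 0 := hG 1
      have h2 : dz (zz ^ 2 * dz G - c • zz) = 0 := hG 2
      rw [one_mul, sub_zero] at h0
      rw [sub_zero, dz_mul, h0, dz_zz, mul_zero, zero_add, mul_one] at h1
      rw [h1, mul_zero, zero_sub, map_neg, neg_eq_zero, map_smul, dz_zz] at h2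
      exact eq_zero_of_smul_one h2
    · rintro rfl
      refine ⟨0, fun j => ?_⟩
      fin_cases j <;> simp [k, e]

end Powers

theorem classifies_powers_E_r_zr_zzr (l : ℕ) :
    Classifies (Sum.elim slGens (Sum.elim (planeGens (powers l))
        ![E, r, z • r, z ^ 2 • r + ((l : ℝ) • z) • E]))
      (fun c : ℝ => Sum.elim 0 (Sum.elim 0 ![0, 0, 0, c • z])) ⊥ := by
  let e : Fin 4 → smooth ℝ × smooth ℝ := ![(0, 1), (1, 0), (zz, 0), (zz ^ 2, (l : ℝ) • zz)]
  let k : ℝ → Fin 4 → smooth ℝ := fun c => ![0, 0, 0, c • zz]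
  have hE : ![E, r, z • r, z ^ 2 • r + ((l : ℝ) • z) • E] =
      fun j => fib (e j).1 (e j).2 := funext fun j => by
    fin_cases j
    exacts [fib_zero_one.symm, fib_one_zero.symm, z_smul_r, z_sq_smul_r_add _]
  have hk : ∀ c, ![0, 0, 0, c • z] = fun j => ofZ (k c j) := fun c => funext fun j => by
    fin_cases j <;> rfl
  simp only [hk, hE]
  refine classifies_fibGens ?_ (fibBracket_mem_four (fun t => ?_) ?_ ?_ ?_) k 0
    ((1 / 2 : ℝ) • LinearMap.id) ?_ ?_ ?_ ?_ ?_
  · intro j i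
    fin_cases j
    · simpa [e] using powers_mem l i
    · simpa [e] using dz_powers_mem l i
    · refine mem_span_of_eq_smul i (i : ℝ) ?_
      simp [e, zz_mul_dz_powers]
    · exact zz_sq_mul_dz_powers_mem l i
  · refine mem_span_of_eq_smul 0 0 ?_
    rw [zero_smul]
    exact fibBracket_E _
  · refine mem_span_of_eq_smul 1 1 ?_
    rw [one_smul]
    exact fibBracket_r_zr (map_zero dz)
  · have h1 : fibBracket (e 1) (e 3) = (2 : ℝ) • e 2 + (l : ℝ) • e 0 := by
      refine (fibBracket_r_zzr _).trans (Prod.ext ?_ ?_)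
      · change (2 : ℝ) • zz = (2 : ℝ) • zz + (l : ℝ) • 0
        rw [smul_zero, add_zero]
      · change (l : ℝ) • (1 : smooth ℝ) = (2 : ℝ) • 0 + (l : ℝ) • 1
        rw [smul_zero, zero_add]
    rw [h1]
    exact add_mem (mem_span_of_eq_smul 2 2 rfl) (mem_span_of_eq_smul 0 l rfl)
  · refine mem_span_of_eq_smul 3 1 ?_
    rw [one_smul]
    exact fibBracket_zr_zzr (map_zero dz) _
  · intro c j
    fin_cases j
    · simp [e, k]
    · simp [e, k]
    · simp [e, k]
    · simp [e, k, dz_zz_sq]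
      rw [← mul_smul, ← sub_smul, show 2⁻¹ * c * 2 - c = 0 by ring, zero_smul]
  · intro c i j
    simp
  · intro φ
    exact exists_gauge_plane_of_E φ (powers_ne_zero l) slGens_mem_lieAlg planeGens_mem_lieAlg
      (fib_mem_lieAlg (e := e) 0)
  · intro φ h1 h2
    obtain ⟨f, h3, h4, h5, h6⟩ := exists_gauge_zr (planeGens_ofZ _) h2 h1
      (fib_mem_lieAlg (e := e) 1) (map_zero dz) (fib_mem_lieAlg (e := e) 2)
    have hE0 := rel_E_zero h4 h5 (map_zero dz) h6 (fib_mem_lieAlg (e := e) 0)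
    -- Although `zr` is the generator here, `[r, z²r + lzE]` is twice `zr + (l/2)E`; the value at
    -- this field vanishes because it vanishes at `zr` and `E`.
    have h6' : Rel (φ - cobdry _ f) (fib zz (((l : ℝ) / 2) • 1)) 0 := by
      have h7 := h6.add (hE0.smul ((l : ℝ) / 2))
      rw [smul_zero, add_zero] at h7
      refine h7.congr (Derivation.ext fun g => ?_)
      rw [Derivation.add_apply, Derivation.smul_apply, fib_apply, fib_apply, fib_apply, ofZ_zero,
        ofZ_one, ofZ_mul_one_smul, one_mul, zero_mul, zero_mul, zero_add, add_zero, add_comm]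
    obtain ⟨c, h7⟩ := exists_rel_zzr h4 h5 h6' (σ := (l : ℝ) • zz)
      (by
        rw [map_smul, dz_zz, ← mul_smul]
        congr 1
        ring) (fib_mem_lieAlg (e := e) 3)
    refine ⟨c, f, h4, h3, fun j => ?_⟩
    fin_cases j
    exacts [hE0, h5, h6, h7]
  · intro c
    rw [Submodule.mem_bot]
    constructor
    · rintro ⟨G, hG⟩
      have h0 : dz (1 * dz G - 0) = 0 := hG 1
      have h1 : dz (zz * dz G - 0) = 0 := hG 2
      have h2 : dz (zz ^ 2 * dz G - c • zz) = 0 := hG 3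
      rw [one_mul, sub_zero] at h0
      rw [sub_zero, dz_mul, h0, dz_zz, mul_zero, zero_add, mul_one] at h1
      rw [h1, mul_zero, zero_sub, map_neg, neg_eq_zero, map_smul, dz_zz] at h2
      exact eq_zero_of_smul_one h2
    · rintro rfl
      refine ⟨0, fun j => ?_⟩
      fin_cases j <;> simp [k, e]

/-! ### The projective algebra extended by `r`, `zr` and `z²r` -/

theorem classifies_proj_r :
    Classifies (Sum.elim projGens ![r]) (fun c : ℝ => Sum.elim (projVals c) 0) ⊥ := by
  let e : Fin 1 → smooth ℝ := ![1]
  have hr : ![r] = fun j => fib (e j) 0 := funext fun j => by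
    fin_cases j
    exact fib_one_zero.symm
  rw [hr]
  refine classifies_projFibGens (fun i j => ?_) LinearMap.id 0 0 ?_ ?_ ?_
  · rw [Subsingleton.elim i j, sub_self]
    exact zero_mem _
  · intro c j
    simp
  · intro φ K h1 h2
    obtain ⟨f, h3, h4, h5⟩ := exists_gauge_r projGens_ofZ h2 h1 (fib_mem_lieAlg_proj (e := e) 0)
    obtain ⟨c, h6⟩ := exists_rel_projVals h3 h5
    refine ⟨c, f, h6, fun j => ?_⟩
    fin_cases j
    exact h5
  · intro c G h _
    exact h

theorem classifies_proj_r_zr :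
    Classifies (Sum.elim projGens ![r, z • r]) (fun c : ℝ => Sum.elim (projVals c) 0) ⊥ := by
  let e : Fin 2 → smooth ℝ := ![1, zz]
  have hr : ![r, z • r] = fun j => fib (e j) 0 := funext fun j => by
    fin_cases j
    exacts [fib_one_zero.symm, z_smul_r]
  rw [hr]
  have h01 : e 0 * dz (e 1) - e 1 * dz (e 0) = e 0 := by
    change 1 * dz zz - zz * dz 1 = 1
    simp
  refine classifies_projFibGens (wronskian_mem_two ?_) LinearMap.id 0 0 ?_ ?_ ?_
  · exact mem_span_of_eq_smul 0 1 (h01.trans (one_smul ℝ _).symm)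
  · intro c j
    simp
  · intro φ K h1 h2
    obtain ⟨f, h3, h4, h5, h6⟩ := exists_gauge_zr projGens_ofZ h2 h1
      (fib_mem_lieAlg_proj (e := e) 0) (map_zero dz) (fib_mem_lieAlg_proj (e := e) 1)
    obtain ⟨c, h7⟩ := exists_rel_projVals h3 h5
    refine ⟨c, f, h7, fun j => ?_⟩
    fin_cases j
    exacts [h5, h6]
  · intro c G h _
    exact h

theorem classifies_proj_r_zr_zzr :
    Classifies (Sum.elim projGens ![r, z • r, z ^ 2 • r])
      (fun cd : ℝ × ℝ => Sum.elim (projVals cd.1) ![0, 0, cd.2 • z]) ⊥ := by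
  let e : Fin 3 → smooth ℝ := ![1, zz, zz ^ 2]
  let k : ℝ × ℝ → Fin 3 → smooth ℝ := fun c => ![0, 0, c.2 • zz]
  have hr : ![r, z • r, z ^ 2 • r] = fun j => fib (e j) 0 := funext fun j => by
    fin_cases j
    exacts [fib_one_zero.symm, z_smul_r, z_sq_smul_r]
  have hk : ∀ c : ℝ × ℝ, ![0, 0, c.2 • z] = fun j => ofZ (k c j) := fun c => funext fun j => by
    fin_cases j <;> rfl
  simp only [hk, hr]
  have h01 : e 0 * dz (e 1) - e 1 * dz (e 0) = e 0 := by
    change 1 * dz zz - zz * dz 1 = 1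
    simp
  have h02 : e 0 * dz (e 2) - e 2 * dz (e 0) = (2 : ℝ) • e 1 := by
    change 1 * dz (zz ^ 2) - zz ^ 2 * dz 1 = (2 : ℝ) • zz
    simp [dz_zz_sq]
  have h12 : e 1 * dz (e 2) - e 2 * dz (e 1) = e 2 := by
    change zz * dz (zz ^ 2) - zz ^ 2 * dz zz = zz ^ 2
    rw [dz_zz_sq, dz_zz, two_smul]
    ring
  refine classifies_projFibGens (wronskian_mem_three ?_ ?_ ?_) (LinearMap.fst ℝ ℝ ℝ) k
    ((1 / 2 : ℝ) • LinearMap.snd ℝ ℝ ℝ) ?_ ?_ ?_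
  · exact mem_span_of_eq_smul 0 1 (h01.trans (one_smul ℝ _).symm)
  · exact mem_span_of_eq_smul 1 2 h02
  · exact mem_span_of_eq_smul 2 1 (h12.trans (one_smul ℝ _).symm)
  · intro c j
    fin_cases j
    · simp [e, k]
    · simp [e, k]
    · simp [e, k, dz_zz_sq]
      rw [← mul_smul, ← sub_smul, show 2⁻¹ * c.2 * 2 - c.2 = 0 by ring, zero_smul]
  · intro φ K h1 h2
    obtain ⟨f, h3, h4, h5, h6⟩ := exists_gauge_zr projGens_ofZ h2 h1
      (fib_mem_lieAlg_proj (e := e) 0) (map_zero dz) (fib_mem_lieAlg_proj (e := e) 1)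
    obtain ⟨c, h7⟩ := exists_rel_projVals h3 h5
    obtain ⟨d, h8⟩ := exists_rel_zzr h4 h5 h6 (σ := 0) (by rw [map_zero, smul_zero])
      (fib_mem_lieAlg_proj (e := e) 2)
    refine ⟨(c, d), f, h7, fun j => ?_⟩
    fin_cases j
    exacts [h5, h6, h8]
  · intro c G h hG
    have h0 : dz (1 * dz G - 0) = 0 := hG 0
    have h1 : dz (zz * dz G - 0) = 0 := hG 1
    have h2 : dz (zz ^ 2 * dz G - c.2 • zz) = 0 := hG 2
    rw [one_mul, sub_zero] at h0
    rw [sub_zero, dz_mul, h0, dz_zz, mul_zero, zero_add, mul_one] at h1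
    rw [h1, mul_zero, zero_sub, map_neg, neg_eq_zero, map_smul, dz_zz] at h2
    exact Prod.ext h (eq_zero_of_smul_one h2)

/-! ### A single plane and its area form -/

section SinglePlane

/-- `v ↦ W² (x v(y) - y v(x))`, with the components of `v` taken on the `z`-axis. -/
def areaForm (W : smooth ℝ) : VF →ₗ[ℝ] F where
  toFun v := ofZ (W * W) * (x * ofZ (axis (v y)) - y * ofZ (axis (v x)))
  map_add' v w := by
    rw [Derivation.add_apply, Derivation.add_apply, map_add, map_add, ofZ_add, ofZ_add]
    ring
  map_smul' c v := by
    rw [Derivation.smul_apply, Derivation.smul_apply, map_smul, map_smul, ofZ_smul, ofZ_smul,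
      mul_smul_comm, mul_smul_comm, ← smul_sub, mul_smul_comm, RingHom.id_apply]

theorem areaForm_apply (W : smooth ℝ) (v : VF) :
    areaForm W v = ofZ (W * W) * (x * ofZ (axis (v y)) - y * ofZ (axis (v x))) := rfl

/-- The fields of `𝔰` vanish on the `z`-axis, where the components are taken. -/
theorem areaForm_slGens (W : smooth ℝ) (i : Fin 3) : areaForm W (slGens i) = 0 := by
  rw [areaForm_apply, slGens_eq_fld, fld_x, fld_y]
  fin_cases i <;> simp

theorem areaForm_p (W K : smooth ℝ) : areaForm W (ofZ K • p) = -(ofZ (W * W * K) * y) := by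
  rw [areaForm_apply, smul_p_eq_fld, fld_x, fld_y, axis_ofZ, map_zero, ofZ_zero, ofZ_mul _ K]
  ring

theorem areaForm_q (W K : smooth ℝ) : areaForm W (ofZ K • q) = ofZ (W * W * K) * x := by
  rw [areaForm_apply, smul_q_eq_fld, fld_x, fld_y, axis_ofZ, map_zero, ofZ_zero, ofZ_mul _ K]
  ring

/-- The failure of the cocycle identity. -/
def lieDefect (A : VF →ₗ[ℝ] F) (v w : VF) : F := A ⁅v, w⁆ - (v (A w) - w (A v))

theorem map_vf_neg (A : VF →ₗ[ℝ] F) (v : VF) : A (-v) = -A v := by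
  rw [show -v = (-1 : ℝ) • v from Derivation.ext fun f => by simp, map_smul, neg_one_smul]

theorem lieDefect_swap (A : VF →ₗ[ℝ] F) (v w : VF) : lieDefect A w v = -lieDefect A v w := by
  rw [lieDefect, lieDefect, vf_lie_skew, map_vf_neg]
  ring

/-- The form `x dy - y dx` is invariant under `𝔰`, and its coefficient depends on `z` alone, so the
cocycle identity is exact here. -/
theorem lieDefect_slGens_plane {W Z : smooth ℝ} (i : Fin 3) (k : Unit ⊕ Unit) :
    lieDefect (areaForm W) (slGens i) (planeGens (fun _ : Unit => Z) k) = 0 := by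
  rw [lieDefect, areaForm_slGens, map_zero, sub_zero]
  rcases k with k | k
  · change areaForm W ⁅slGens i, ofZ Z • p⁆ - slGens i (areaForm W (ofZ Z • p)) = 0
    rw [areaForm_p]
    fin_cases i
    · change areaForm W ⁅x • q, ofZ Z • p⁆ - x * q _ = 0
      rw [lie_X_p, map_vf_neg, areaForm_q]
      simp [Derivation.leibniz]
      ring
    · change areaForm W ⁅H, ofZ Z • p⁆ - H _ = 0
      rw [lie_H_p, map_smul, areaForm_p, H_apply]
      simp [Derivation.leibniz]
      ring
    · change areaForm W ⁅y • p, ofZ Z • p⁆ - y * p _ = 0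
      rw [lie_Y_p, map_zero]
      simp [Derivation.leibniz]
  · change areaForm W ⁅slGens i, ofZ Z • q⁆ - slGens i (areaForm W (ofZ Z • q)) = 0
    rw [areaForm_q]
    fin_cases i
    · change areaForm W ⁅x • q, ofZ Z • q⁆ - x * q _ = 0
      rw [lie_X_q, map_zero]
      simp [Derivation.leibniz]
    · change areaForm W ⁅H, ofZ Z • q⁆ - H _ = 0
      rw [lie_H_q, map_smul, areaForm_q, H_apply]
      simp [Derivation.leibniz]
      ring
    · change areaForm W ⁅y • p, ofZ Z • q⁆ - y * p _ = 0
      rw [lie_Y_q, map_vf_neg, areaForm_p]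
      simp [Derivation.leibniz]
      ring

/-- For `Zp` and `Zq` the defect is the constant `-2`, since `ZW = 1`: the identity holds in
`F(M)/{1}` but not in `F(M)`. -/
theorem lieDefect_plane_plane {Z W : smooth ℝ} (hW : W * Z = 1) (k m : Unit ⊕ Unit) :
    lieDefect (areaForm W) (planeGens (fun _ : Unit => Z) k)
      (planeGens (fun _ : Unit => Z) m) ∈ constants := by
  have hWZ : W * W * Z = W := by rw [mul_assoc, hW, mul_one]
  have hWZ' : ofZ Z * ofZ W = 1 := by rw [← ofZ_mul, mul_comm, hW, ofZ_one]
  have hpq : lieDefect (areaForm W) (ofZ Z • p) (ofZ Z • q) ∈ constants := by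
    rw [lieDefect, lie_p_q, map_zero, areaForm_p, areaForm_q, hWZ, smul_vf_apply, smul_vf_apply]
    convert smul_one_mem_constants (-2) using 1
    simp [Derivation.leibniz, hWZ']
    rw [two_smul]
    ring
  rcases k with k | k <;> rcases m with m | m
  · change lieDefect (areaForm W) (ofZ Z • p) (ofZ Z • p) ∈ constants
    rw [lieDefect, lie_p_p, map_zero, sub_self, sub_zero]
    exact zero_mem _
  · exact hpq
  · change lieDefect (areaForm W) (ofZ Z • q) (ofZ Z • p) ∈ constants
    rw [lieDefect_swap]
    exact neg_mem hpq
  · change lieDefect (areaForm W) (ofZ Z • q) (ofZ Z • q) ∈ constants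
    rw [lieDefect, lie_q_q, map_zero, sub_self, sub_zero]
    exact zero_mem _

theorem areaForm_eq_zero_of_mem (W : smooth ℝ) {v : VF}
    (hv : v ∈ Submodule.span ℝ (Set.range slGens)) : areaForm W v = 0 := by
  have hle : Submodule.span ℝ (Set.range slGens) ≤ LinearMap.ker (areaForm W) := by
    rw [Submodule.span_le]
    rintro _ ⟨i, rfl⟩
    exact areaForm_slGens W i
  exact hle hv

theorem lieDefect_mem {Z W : smooth ℝ} (hW : W * Z = 1) (i j : Fin 3 ⊕ (Unit ⊕ Unit)) :
    lieDefect (areaForm W) (Sum.elim slGens (planeGens (fun _ : Unit => Z)) i)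
      (Sum.elim slGens (planeGens (fun _ : Unit => Z)) j) ∈ constants := by
  rcases i with i | k <;> rcases j with j | m
  · change lieDefect (areaForm W) (slGens i) (slGens j) ∈ constants
    rw [lieDefect, areaForm_eq_zero_of_mem W (lie_slGens_slGens i j), areaForm_slGens,
      areaForm_slGens, map_zero, map_zero, sub_self, sub_self]
    exact zero_mem _
  · change lieDefect (areaForm W) (slGens i) (planeGens _ m) ∈ constants
    rw [lieDefect_slGens_plane]
    exact zero_mem _
  · change lieDefect (areaForm W) (planeGens _ k) (slGens j) ∈ constants
    rw [lieDefect_swap, lieDefect_slGens_plane, neg_zero]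
    exact zero_mem _
  · exact lieDefect_plane_plane hW k m

theorem classifies_single_plane (Z W : smooth ℝ) (hW : W * Z = 1) :
    Classifies (Sum.elim slGens (planeGens (fun _ : Unit => Z)))
      (fun c : ℝ => Sum.elim 0
        (Sum.elim (fun _ => -(c • (ofZ W * y))) (fun _ => c • (ofZ W * x)))) ⊥ := by
  have hWZ : W * W * Z = W := by rw [mul_assoc, hW, mul_one]
  have hZ : ∀ t : ℝ, ∃ _ : Unit, Z.1 t ≠ 0 := fun t => ⟨(), fun h => by
    have h1 : W.1 t * Z.1 t = 1 := congr_fun (congr_arg Subtype.val hW) t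
    rw [h, mul_zero] at h1
    exact zero_ne_one h1⟩
  refine classifies_of ?_ (lie_slGens_elim_planeGens _)
    (LinearMap.toSpanSingleton ℝ (VF →ₗ[ℝ] F) (areaForm W)) ?_ ?_ ?_ ?_
  · rintro (i | k)
    exacts [(isFibred_slGens i).mem_expFields, (isFibred_planeGens _ k).mem_expFields]
  · rintro c (i | k | k)
    · change c • areaForm W (slGens i) - 0 ∈ constants
      rw [areaForm_slGens, smul_zero, sub_zero]
      exact zero_mem _
    · change c • areaForm W (ofZ Z • p) - -(c • (ofZ W * y)) ∈ constants
      rw [areaForm_p, hWZ, smul_neg, sub_self]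
      exact zero_mem _
    · change c • areaForm W (ofZ Z • q) - c • (ofZ W * x) ∈ constants
      rw [areaForm_q, hWZ, sub_self]
      exact zero_mem _
  · intro c i j
    have h1 := constants.smul_mem c (lieDefect_mem hW i j)
    rw [lieDefect, smul_sub, smul_sub, ← Derivation.map_smul, ← Derivation.map_smul] at h1
    exact h1
  · intro φ
    obtain ⟨f, β, h1, h2, h3, h4⟩ := exists_plane_normal_form φ (fun _ : Unit => Z) hZ
      (fun i => subset_lieAlg (v := Sum.elim slGens (planeGens (fun _ : Unit => Z))) (Sum.inl i))
      (fun k => subset_lieAlg (v := Sum.elim slGens (planeGens (fun _ : Unit => Z)))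
        (Sum.inr (Sum.inl k)))
      (fun k => subset_lieAlg (v := Sum.elim slGens (planeGens (fun _ : Unit => Z)))
        (Sum.inr (Sum.inr k)))
    obtain ⟨c, hc⟩ := exists_eq_smul_one (ofZ_mem_constants_iff.1 (h1 () ()))
    -- The diagonal condition says `2Zβ = c`, and `W` inverts `Z`.
    have hβ : ∀ k, β k = (c / 2) • W := fun k => by
      have h5 : (2 : ℝ) • β k = c • W := by
        rw [← mul_one W, ← mul_smul_comm, ← hc, two_smul]
        linear_combination (-2 * β ()) * hW
      rw [div_eq_inv_mul, mul_smul, ← h5, ← mul_smul, inv_mul_cancel₀ two_ne_zero, one_smul]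
    refine ⟨c / 2, f, ?_⟩
    rintro (i | k | k)
    · exact h2 i
    · have h5 := h3 k
      rw [hβ, ofZ_smul, smul_mul_assoc] at h5
      exact h5
    · have h5 := h4 k
      rw [hβ, ofZ_smul, smul_mul_assoc] at h5
      exact h5
  · intro c
    rw [Submodule.mem_bot]
    constructor
    · rintro ⟨f, hf⟩
      obtain ⟨G, rfl⟩ := exists_eq_ofZ_of_slGens (f := f) fun i => by
        have h1 : slGens i f - 0 ∈ constants := hf (Sum.inl i)
        rwa [sub_zero] at h1
      have h1 : planeGens (fun _ : Unit => Z) (Sum.inl ()) (ofZ G) - -(c • (ofZ W * y)) ∈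
        constants := hf (Sum.inr (Sum.inl ()))
      rw [planeGens_ofZ, zero_sub, neg_neg] at h1
      have h2 : ofZ (c • W) = 0 := by
        apply eq_zero_of_y_mul_mem_constants
        convert h1 using 1
        rw [ofZ_smul, mul_smul_comm, mul_comm]
      have h3 : c • W * Z = 0 := by rw [ofZ_eq_zero.1 h2, zero_mul]
      rw [smul_mul_assoc, hW] at h3
      exact eq_zero_of_smul_one h3
    · rintro rfl
      refine ⟨0, ?_⟩
      rintro (i | k | k) <;> simp

end SinglePlane

end

end TypeI

open TypeI in
theorem mainTheorem1 :
    -- 1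
    Classifies projGens
      (fun (K : smooth ℝ) => ![0, 0, ofZ K, ofZ K, 0, 0, 3 * x * ofZ K, 3 * y * ofZ K]) ⊥ ∧
    -- 2
    (∀ (l : ℕ) (Z : Fin l → smooth ℝ), 2 ≤ l → LinearIndependent ℝ Z →
      (∀ t : ℝ, ∃ i, (Z i).1 t ≠ 0) →
      ClassifiesZero (Sum.elim slGens (planeGens Z))) ∧
    -- 2, with a single function `Z` (and `W = 1 / Z`)
    (∀ Z W : smooth ℝ, W * Z = 1 →
      Classifies (Sum.elim slGens (planeGens (fun _ : Unit => Z)))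
        (fun c : ℝ => Sum.elim 0
          (Sum.elim (fun _ => -(c • (ofZ W * y))) (fun _ => c • (ofZ W * x)))) ⊥) ∧
    -- 3
    (∀ (l : ℕ) (Z : Fin l → smooth ℝ), 1 ≤ l → LinearIndependent ℝ Z →
      (∀ t : ℝ, ∃ i, (Z i).1 t ≠ 0) →
      Classifies (Sum.elim slGens (Sum.elim (planeGens Z) ![E]))
        (fun K : smooth ℝ => Sum.elim 0 (Sum.elim 0 ![ofZ K])) (Submodule.span ℝ {1})) ∧
    -- 4
    Classifies (Sum.elim projGens ![r]) (fun c : ℝ => Sum.elim (projVals c) 0) ⊥ ∧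
    -- 5
    (∀ (b : ℕ) (n : Fin (b + 1) → ℕ) (μ : Fin (b + 1) → ℝ), Function.Injective μ →
      (0 < b ∨ 0 < n 0 ∨ μ 0 ≠ 0) →
      ClassifiesZero (Sum.elim slGens (Sum.elim (planeGens (powExps n μ)) ![r]))) ∧
    -- 6
    (∀ (b : ℕ) (n : Fin (b + 1) → ℕ) (μ : Fin (b + 1) → ℝ), Function.Injective μ →
      Classifies (Sum.elim slGens (Sum.elim (planeGens (powExps n μ)) ![r, E]))
        (fun c : ℝ => Sum.elim 0 (Sum.elim 0 ![0, c • z])) ⊥) ∧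
    -- 7
    Classifies (Sum.elim projGens ![r, z • r]) (fun c : ℝ => Sum.elim (projVals c) 0) ⊥ ∧
    -- 8
    (∀ (l : ℕ) (a : ℝ), 1 ≤ l →
      ClassifiesZero (Sum.elim slGens (Sum.elim (planeGens (powers l)) ![r, z • r + a • E]))) ∧
    -- 9
    (∀ l : ℕ, 1 ≤ l →
      ClassifiesZero (Sum.elim slGens (Sum.elim (planeGens (powers l)) ![E, r, z • r]))) ∧
    -- 10
    Classifies (Sum.elim projGens ![r, z • r, z ^ 2 • r])
      (fun cd : ℝ × ℝ => Sum.elim (projVals cd.1) ![0, 0, cd.2 • z]) ⊥ ∧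
    -- 11
    (∀ l : ℕ, 1 ≤ l →
      Classifies (Sum.elim slGens (Sum.elim (planeGens (powers l))
          ![r, z • r + ((l : ℝ) / 2) • E, z ^ 2 • r + ((l : ℝ) • z) • E]))
        (fun c : ℝ => Sum.elim 0 (Sum.elim 0 ![0, 0, c • z])) ⊥) ∧
    -- 12
    (∀ l : ℕ, 1 ≤ l →
      Classifies (Sum.elim slGens (Sum.elim (planeGens (powers l))
          ![E, r, z • r, z ^ 2 • r + ((l : ℝ) • z) • E]))
        (fun c : ℝ => Sum.elim 0 (Sum.elim 0 ![0, 0, 0, c • z])) ⊥) :=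
  ⟨classifies_proj, classifiesZero_plane, classifies_single_plane,
    fun l Z _ _ hZ => classifies_plane_E l Z hZ, classifies_proj_r, classifiesZero_powExps_r,
    fun b n μ _ => classifies_powExps_r_E b n μ, classifies_proj_r_zr,
    classifiesZero_powers_r_zr, fun l _ => classifiesZero_powers_E_r_zr l,
    classifies_proj_r_zr_zzr, classifies_powers_r_zr_zzr,
    fun l _ => classifies_powers_E_r_zr_zzr l⟩
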